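/- Let $\mathfrak g$ be a finite-dimensional real nilpotent Lie algebra with the Baker-Campbell-Hausdorff product $\bullet$ (the group law of the associated connected simply connected nilpotent Lie group in exponential coordinates), let $\mathfrak g^\sharp$ be its dual, with Lebesgue measures $dX$, $d\xi$ normalised so that $u(X)=\int_{\mathfrak g^\sharp} e^{i\langle X|\xi\rangle}\int_{\mathfrak g} e^{-i\langle Y|\xi\rangle}u(Y)\,dY\,d\xi$ for Schwartz functions $u$, and let $\Xi=\mathfrak g\times\mathfrak g^\sharp$ with the product measure. The bracket $\langle\cdot,\cdot\rangle$ denotes the $L^2$ scalar product, linear in the first variable, and its extension to tempered distributions paired with Schwartz functions. For a symbol $f$ on $\Xi$ let $[\mathsf{Op}(f)u](X)=\int_{\mathfrak g}\int_{\mathfrak g^\sharp} e^{i\langle X\bullet(-Y)|\xi\rangle}f(X,\xi)u(Y)\,dY\,d\xi$; this extends to $f\in\mathcal S'(\Xi)$, with $\mathsf{Op}(f):\mathcal S(\mathfrak g)\to\mathcal S'(\mathfrak g)$. For $f,g\in\mathcal S(\Xi)$ let $f\#g$ and $f^\#$ be the symbols of $\mathsf{Op}(f)\mathsf{Op}(g)$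 and of $\mathsf{Op}(f)^*$. The involution extends to $F\in\mathcal S'(\Xi)$ by $\langle F^\#,k\rangle=\langle k^\#,F\rangle$ ($k\in\mathcal S(\Xi)$), and products of $F$ with a Schwartz function, or with an element $G$ of the Moyal algebra $\{G\in\mathcal S'(\Xi): G\#\mathcal S(\Xi)\subset\mathcal S(\Xi),\ \mathcal S(\Xi)\#G\subset\mathcal S(\Xi)\}$, are defined by $\langle F\#G,k\rangle=\langle F,k\#G^\#\rangle$ and $\langle G\#F,k\rangle=\langle F,G^\#\#k\rangle$. For $f,g,F\in\mathcal S'(\Xi)$ we say that $f\#g$ is defined and equal to $F$ if $F$ is the symbol of the weak operator product $\mathsf{Op}(f)\mathsf{Op}(g)$, that is, if $\mathsf{Op}(g)u\in L^2(\mathfrak g)$, $\mathsf{Op}(f)^*v\in L^2(\mathfrak g)$ and $\langle\mathsf{Op}(F)u,v\rangle=\langle\mathsf{Op}(g)u,\mathsf{Op}(f)^*v\rangle$ for all $u,v\in\mathcal S(\mathfrak g)$. Put $\varepsilon_{(Z,\zeta)}(X,\xi)=e^{i\langle X|\zeta\rangle}e^{-i\langle Z|\xi\rangle}$. For $h\in\mathcal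 S(\Xi)\setminus\{0\}$, $f\in\mathcal S'(\Xi)$ and $\mathcal Y,\mathcal Z\in\Xi$ let $$[\mathfrak E_h(f)](\mathcal Y,\mathcal Z)=\langle\varepsilon_{\mathcal Y}\#f\#\varepsilon_{\mathcal Z}^\#,h\rangle ,$$ and for a vector subspace $\mathfrak B$ of $\mathcal S'(\Xi\times\Xi)$ let $\mathsf{Co}_h(\mathfrak B)=\{f\in\mathcal S'(\Xi): \mathfrak E_h(f)\in\mathfrak B\}$. For kernels $K,L$ on $\Xi\times\Xi$ let $(K\circ L)(\mathcal Y,\mathcal Z)=\int_\Xi K(\mathcal Y,\mathcal X)L(\mathcal X,\mathcal Z)\,d\mathcal X$ and $K^\circ(\mathcal Y,\mathcal Z)=\overline{K(\mathcal Z,\mathcal Y)}$; here $K\circ L$ is said to be defined if $\int\!\!\int\!\!\int |K(\mathcal Y,\mathcal X)L(\mathcal X,\mathcal Z)\varphi(\mathcal Y,\mathcal Z)|\,d\mathcal X\,d\mathcal Y\,d\mathcal Z<\infty$ for every $\varphi\in\mathcal S(\Xi\times\Xi)$. A vector subspace is called an involutive algebra with respect to a partially defined product and an involution if the product of any two of its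 elements is defined and belongs to it, the product is bilinear and associative on it, and it is stable under the involution, which is conjugate-linear, involutive and anti-multiplicative on it. **Corollary.** Suppose that the vector subspace $\mathfrak B$ of $\mathcal S'(\Xi\times\Xi)$ consists of kernels, that is, of distributions given by measurable functions integrable against every Schwartz function, and is an involutive algebra with respect to $(\circ,{}^\circ)$, and let $h\in\mathcal S(\Xi)\setminus\{0\}$ satisfy $h=h\#h=h^\#$. Then $\mathsf{Co}_h(\mathfrak B)$ is an involutive algebra with respect to $(\#,{}^\#)$; in particular $f\#g$ is defined for all $f,g\in\mathsf{Co}_h(\mathfrak B)$. -/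

import Mathlib

open MeasureTheory SchwartzMap ComplexConjugate

noncomputable section

namespace NilPseudo

/-- A real Lie algebra whose underlying vector space carries a norm. In finite dimension, which is
the only case used, the norm is auxiliary: it serves to define Schwartz functions, and the Schwartz
space does not depend on its choice. -/
class RealNormedLieAlgebra (𝔤 : Type*) extends NormedAddCommGroup 𝔤, LieRing 𝔤, NormedSpace ℝ 𝔤,
  LieAlgebra ℝ 𝔤

/-- An involutive algebra realised on a set `B` of vectors of a complex vector space `V`:
`B` is a linear subspace, the possibly only partially defined product `prod` (the relation
`prod a b c` means that the product of `a` and `b` exists and is `c`) is everywhere defined on `B`,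
has values in `B`, is bilinear and associative there, and `inv` is a conjugate-linear
anti-multiplicative involution of `B`. -/
structure IsInvolutiveAlgebra {V : Type*} [AddCommGroup V] [Module ℂ V]
    (prod : V → V → V → Prop) (inv : V → V) (B : Set V) : Prop where
  zero_mem : (0 : V) ∈ B
  add_mem : ∀ a ∈ B, ∀ b ∈ B, a + b ∈ B
  smul_mem : ∀ (z : ℂ), ∀ a ∈ B, z • a ∈ B
  exists_prod : ∀ a ∈ B, ∀ b ∈ B, ∃! c, prod a b c
  prod_mem : ∀ a ∈ B, ∀ b ∈ B, ∀ c, prod a b c → c ∈ B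
  add_prod : ∀ a ∈ B, ∀ b ∈ B, ∀ c ∈ B, ∀ x y, prod a c x → prod b c y → prod (a + b) c (x + y)
  prod_add : ∀ a ∈ B, ∀ b ∈ B, ∀ c ∈ B, ∀ x y, prod a b x → prod a c y → prod a (b + c) (x + y)
  smul_prod : ∀ (z : ℂ), ∀ a ∈ B, ∀ b ∈ B, ∀ x, prod a b x → prod (z • a) b (z • x)
  prod_smul : ∀ (z : ℂ), ∀ a ∈ B, ∀ b ∈ B, ∀ x, prod a b x → prod a (z • b) (z • x)
  prod_assoc : ∀ a ∈ B, ∀ b ∈ B, ∀ c ∈ B, ∀ ab bc d,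
    prod a b ab → prod b c bc → prod ab c d → prod a bc d
  inv_mem : ∀ a ∈ B, inv a ∈ B
  inv_inv : ∀ a ∈ B, inv (inv a) = a
  inv_add : ∀ a ∈ B, ∀ b ∈ B, inv (a + b) = inv a + inv b
  inv_smul : ∀ (z : ℂ), ∀ a ∈ B, inv (z • a) = conj z • inv a
  inv_prod : ∀ a ∈ B, ∀ b ∈ B, ∀ x, prod a b x → prod (inv b) (inv a) (inv x)

section BCH

variable {𝔤 : Type*} [RealNormedLieAlgebra 𝔤]

/-- The right-nested bracket `[x₁, [x₂, [… , xₙ]]]` of a list of vectors. -/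
def nestedBracket : List 𝔤 → 𝔤
  | [] => 0
  | [x] => x
  | x :: y :: l => ⁅x, nestedBracket (y :: l)⁆

/-- The Baker-Campbell-Hausdorff product `X • Y`, by Dynkin's formula
`∑_{k ≥ 1} (-1)^(k-1)/k ∑ [X^{r₁} Y^{s₁} ⋯ X^{r_k} Y^{s_k}] / ((∑ (rᵢ + sᵢ)) ∏ rᵢ! sᵢ!)`,
the inner sum being over all pairs `(rᵢ, sᵢ) ≠ (0, 0)`. For a nilpotent Lie algebra all brackets of
more than `N` factors vanish, where `N` is the nilpotency length, so that the sums may be restricted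
to `k, rᵢ, sᵢ ≤ N`. -/
def bch (X Y : 𝔤) : 𝔤 :=
  ∑ k ∈ Finset.Icc 1 (LieModule.nilpotencyLength 𝔤 𝔤),
    ∑ p ∈ Fintype.piFinset (fun _ : Fin k =>
        (Finset.range (LieModule.nilpotencyLength 𝔤 𝔤 + 1) ×ˢ
          Finset.range (LieModule.nilpotencyLength 𝔤 𝔤 + 1)).erase (0, 0)),
      ((-1 : ℝ) ^ (k - 1) / ((k : ℝ) * (∑ i, (((p i).1 : ℝ) + ((p i).2 : ℝ))) *
          ∏ i, ((Nat.factorial (p i).1 : ℝ) * (Nat.factorial (p i).2 : ℝ)))) •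
        nestedBracket ((List.ofFn p).flatMap
          (fun rs => List.replicate rs.1 X ++ List.replicate rs.2 Y))

end BCH

section Schwartz

variable {E : Type*} [NormedAddCommGroup E] [NormedSpace ℝ E]

/-- Complex conjugation of Schwartz functions. -/
def conjS (φ : 𝓢(E, ℂ)) : 𝓢(E, ℂ) :=
  SchwartzMap.postcompCLM (𝕜 := ℝ) (Complex.conjCLE : ℂ →L[ℝ] ℂ) φ

/-- The duality `⟨F, φ⟩` between tempered distributions and Schwartz functions which extends the
`L²` scalar product; it is linear in `F` and conjugate-linear in `φ`. -/
def pair (F : 𝓢'(E, ℂ)) (φ : 𝓢(E, ℂ)) : ℂ := F (conjS φ)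

open Classical in
/-- The Schwartz function with values `φ` (zero if `φ` is not a Schwartz function). -/
def toSchwartz (φ : E → ℂ) : 𝓢(E, ℂ) :=
  if h : ∃ s : 𝓢(E, ℂ), ∀ x, s x = φ x then h.choose else 0

open Classical in
/-- The tempered distribution `F` with `⟨F, φ⟩ = Φ φ` for all Schwartz functions `φ`
(zero if there is none). -/
def distOf (Φ : 𝓢(E, ℂ) → ℂ) : 𝓢'(E, ℂ) :=
  if h : ∃ F : 𝓢'(E, ℂ), ∀ φ, pair F φ = Φ φ then h.choose else 0

open Classical in
/-- The Schwartz function that represents the tempered distribution `F` with respect to the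
measure `m` (zero if there is none). -/
def schwartzRep [MeasurableSpace E] (m : Measure E) (F : 𝓢'(E, ℂ)) : 𝓢(E, ℂ) :=
  if h : ∃ s : 𝓢(E, ℂ), ∀ φ, F φ = ∫ x, s x * φ x ∂m then h.choose else 0

/-- The tempered distribution `T` on `E × E` is given by the (measurable, integrable against all
Schwartz functions) integral kernel `K : E × E → ℂ`. -/
def IsKernel [MeasurableSpace E] (m : Measure E) (T : 𝓢'(E × E, ℂ)) (K : E × E → ℂ) : Prop :=
  AEStronglyMeasurable K (m.prod m) ∧
    ∀ φ : 𝓢(E × E, ℂ), Integrable (fun p => K p * φ p) (m.prod m) ∧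
      T φ = ∫ p, K p * φ p ∂(m.prod m)

/-- `U = T ∘ S` for the composition of integral kernels
`(K ∘ L)(Y, Z) = ∫ K(Y, X) L(X, Z) dX`: the distributions `T` and `S` are given by kernels
`K` and `L`, the integral that defines `K ∘ L` converges absolutely, also when it is
tested against Schwartz functions, and `U` is given by the kernel `K ∘ L`. -/
def IsKernelProd [MeasurableSpace E] (m : Measure E) (T S U : 𝓢'(E × E, ℂ)) : Prop :=
  ∃ K L : E × E → ℂ, IsKernel m T K ∧ IsKernel m S L ∧
    (∀ φ : 𝓢(E × E, ℂ), Integrable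
      (fun p : (E × E) × E => K (p.1.1, p.2) * L (p.2, p.1.2) * φ p.1) ((m.prod m).prod m)) ∧
    IsKernel m U (fun p => ∫ x, K (p.1, x) * L (x, p.2) ∂m)

/-- The kernel adjoint `T°`, given on kernels by `K°(Y, Z) = conj (K(Z, Y))`. -/
def kernelAdj (T : 𝓢'(E × E, ℂ)) : 𝓢'(E × E, ℂ) :=
  distOf fun φ => conj (T (SchwartzMap.compCLMOfContinuousLinearEquiv ℂ
    (ContinuousLinearEquiv.prodComm ℝ E E) φ))

end Schwartz

section Calculus

variable {𝔤 : Type*} [RealNormedLieAlgebra 𝔤]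

/-- Phase space `Ξ = 𝔤 × 𝔤^♯`. -/
abbrev Phase (𝔤 : Type*) [RealNormedLieAlgebra 𝔤] := 𝔤 × (𝔤 →L[ℝ] ℝ)

variable [MeasurableSpace 𝔤] (μ : Measure 𝔤) (ν : Measure (𝔤 →L[ℝ] ℝ))

/-- The measure `ν` on the dual is normalised so that Fourier inversion
`u(X) = ∫ e^{i⟨X, ξ⟩} (∫ e^{-i⟨Y, ξ⟩} u(Y) dY) dξ` holds. -/
def IsDualMeasure : Prop :=
  ∀ (u : 𝓢(𝔤, ℂ)) (X : 𝔤),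
    u X = ∫ ξ, Complex.exp (Complex.I * (ξ X : ℝ)) *
      (∫ Y, Complex.exp (-(Complex.I * (ξ Y : ℝ))) * u Y ∂μ) ∂ν

/-- The integral kernel of `Op(f)`: `Ker_f(X, Y) = ∫ e^{i⟨X • (-Y), ξ⟩} f(X, ξ) dξ`. -/
def ker (f : Phase 𝔤 → ℂ) (X Y : 𝔤) : ℂ :=
  ∫ ξ, Complex.exp (Complex.I * (ξ (bch X (-Y)) : ℝ)) * f (X, ξ) ∂ν

/-- The symbol of the integral operator with kernel `K`:
`f(X, ξ) = ∫ e^{-i⟨Y, ξ⟩} K(X, (-Y) • X) dY`. -/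
def symbolOfKer (K : 𝔤 → 𝔤 → ℂ) (p : Phase 𝔤) : ℂ :=
  ∫ Y, Complex.exp (-(Complex.I * (p.2 Y : ℝ))) * K p.1 (bch (-Y) p.1) ∂μ

/-- The symbol product `f # g` of Schwartz functions, the symbol of `Op(f) Op(g)`. -/
def sharp (f g : 𝓢(Phase 𝔤, ℂ)) : 𝓢(Phase 𝔤, ℂ) :=
  toSchwartz (symbolOfKer μ fun X Y => ∫ Z, ker ν f X Z * ker ν g Z Y ∂μ)

/-- The symbol adjoint `f^#` of a Schwartz function, the symbol of `Op(f)*`. -/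
def adj (f : 𝓢(Phase 𝔤, ℂ)) : 𝓢(Phase 𝔤, ℂ) :=
  toSchwartz (symbolOfKer μ fun X Y => conj (ker ν f Y X))

/-- `F^#` for a tempered distribution: `⟨F^#, k⟩ = ⟨k^#, F⟩`. -/
def adjD (F : 𝓢'(Phase 𝔤, ℂ)) : 𝓢'(Phase 𝔤, ℂ) :=
  distOf fun k => conj (pair F (adj μ ν k))

/-- `F # g` for a distribution `F` and a Schwartz function `g`: `⟨F # g, k⟩ = ⟨F, k # g^#⟩`. -/
def sharpDS (F : 𝓢'(Phase 𝔤, ℂ)) (g : 𝓢(Phase 𝔤, ℂ)) : 𝓢'(Phase 𝔤, ℂ) :=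
  distOf fun k => pair F (sharp μ ν k (adj μ ν g))

/-- `g # F` for a distribution `F` and a Schwartz function `g`: `⟨g # F, k⟩ = ⟨F, g^# # k⟩`. -/
def sharpSD (g : 𝓢(Phase 𝔤, ℂ)) (F : 𝓢'(Phase 𝔤, ℂ)) : 𝓢'(Phase 𝔤, ℂ) :=
  distOf fun k => pair F (sharp μ ν (adj μ ν g) k)

/-- `F # G` for a distribution `F` and an element `G` of the Moyal algebra (that is, `G # k` and
`k # G` are Schwartz functions for all Schwartz functions `k`): `⟨F # G, k⟩ = ⟨F, k # G^#⟩`. -/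
def sharpDM (F G : 𝓢'(Phase 𝔤, ℂ)) : 𝓢'(Phase 𝔤, ℂ) :=
  distOf fun k => pair F (schwartzRep (μ.prod ν) (sharpSD μ ν k (adjD μ ν G)))

/-- `G # F` for a distribution `F` and an element `G` of the Moyal algebra:
`⟨G # F, k⟩ = ⟨F, G^# # k⟩`. -/
def sharpMD (G F : 𝓢'(Phase 𝔤, ℂ)) : 𝓢'(Phase 𝔤, ℂ) :=
  distOf fun k => pair F (schwartzRep (μ.prod ν) (sharpDS μ ν (adjD μ ν G) k))

/-- The function `ε_{(Z, ζ)}(X, ξ) = e^{i⟨X, ζ⟩} e^{-i⟨Z, ξ⟩}` as a tempered distribution. -/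
def eps (z : Phase 𝔤) : 𝓢'(Phase 𝔤, ℂ) :=
  distOf fun k => ∫ x : Phase 𝔤, Complex.exp (Complex.I * (z.2 x.1 : ℝ)) *
    Complex.exp (-(Complex.I * (x.2 z.1 : ℝ))) * conj (k x) ∂(μ.prod ν)

/-- The phase-space shift `θ_{y, z}(f) = ε_y # f # ε_z^#`. -/
def theta (y z : Phase 𝔤) (f : 𝓢'(Phase 𝔤, ℂ)) : 𝓢'(Phase 𝔤, ℂ) :=
  sharpDM μ ν (sharpMD μ ν (eps μ ν y) f) (adjD μ ν (eps μ ν z))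

/-- The transform `𝔈_h(f)(y, z) = ⟨θ_{y, z}(f), h⟩`. -/
def frakE (h : 𝓢(Phase 𝔤, ℂ)) (f : 𝓢'(Phase 𝔤, ℂ)) (p : Phase 𝔤 × Phase 𝔤) : ℂ :=
  pair (theta μ ν p.1 p.2 f) h

/-- The coorbit space `Co_h(𝔅) = {f ∈ 𝓢'(Ξ) | 𝔈_h(f) ∈ 𝔅}`. -/
def Co (h : 𝓢(Phase 𝔤, ℂ)) (𝔅 : Submodule ℂ 𝓢'(Phase 𝔤 × Phase 𝔤, ℂ)) :
    Set 𝓢'(Phase 𝔤, ℂ) :=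
  {f | ∃ T ∈ 𝔅, IsKernel (μ.prod ν) T (frakE μ ν h f)}

/-- The Wigner transform `W_{u,v}(X, ξ) = v(X) ∫ e^{-i⟨X • (-Y), ξ⟩} conj (u(Y)) dY`, for which
`⟨Op(f) u, v⟩ = ⟨f, W_{u,v}⟩`. -/
def wigner (u v : 𝓢(𝔤, ℂ)) : 𝓢(Phase 𝔤, ℂ) :=
  toSchwartz fun p : Phase 𝔤 => v p.1 *
    ∫ Y, Complex.exp (-(Complex.I * (p.2 (bch p.1 (-Y)) : ℝ))) * conj (u Y) ∂μ

/-- The pairing `⟨Op(F) u, v⟩`, which defines `Op(F) : 𝓢(𝔤) → 𝓢'(𝔤)` for `F ∈ 𝓢'(Ξ)`. -/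
def opForm (F : 𝓢'(Phase 𝔤, ℂ)) (u v : 𝓢(𝔤, ℂ)) : ℂ := pair F (wigner μ u v)

/-- `F = f # g` for tempered distributions: `F` is the symbol of the operator product
`Op(f) Op(g)`, taken in the weak sense: for all `u, v ∈ 𝓢(𝔤)` one has `a := Op(g) u ∈ L²(𝔤)`,
`b := Op(f)* v ∈ L²(𝔤)`, and `⟨Op(F) u, v⟩ = ⟨Op(g) u, Op(f)* v⟩`. -/
def IsSymbolProd (f g F : 𝓢'(Phase 𝔤, ℂ)) : Prop :=
  ∀ u v : 𝓢(𝔤, ℂ), ∃ a b : 𝔤 → ℂ, MemLp a 2 μ ∧ MemLp b 2 μ ∧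
    (∀ k : 𝓢(𝔤, ℂ), opForm μ g u k = ∫ X, a X * conj (k X) ∂μ) ∧
    (∀ k : 𝓢(𝔤, ℂ), opForm μ f k v = ∫ X, k X * conj (b X) ∂μ) ∧
    opForm μ F u v = ∫ X, a X * conj (b X) ∂μ

end Calculus

end NilPseudo

end

/-! The conditions on h say that Op(h) is a nonzero orthogonal projection whose integral kernel P is
a Schwartz function. Its trace is finite and every unit vector split off its range lowers the trace
by one, so P = ∑ e_i ⊗ conj e_i for finitely many orthonormal Schwartz functions e_i
(`IsProjection.exists_orthonormal`). Put (U_x e)(X) = e^{-iζ(Z • X)} e(Z • X) for x = (Z, ζ); this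
is the adjoint of Op(ε_x). Unwinding the symbol products gives 𝔈_h(f)(y, z) = ∑_i ⟨Op(f) U_z e_i,
U_y e_i⟩ (`IsDualMeasure.frakE_eq_sum`).

The shifts satisfy the orthogonality relations ∫ ⟨u, U_x e⟩ ⟨U_x e', v⟩ dx = ⟨e', e⟩ ⟨u, v⟩. They
come from Fourier inversion in ζ and from the invariance of Lebesgue measure under translations of
the group (`IsDualMeasure.fibreIntegral_synth_coeff`). Since the e_i are orthonormal, integrating
𝔈_h(f) against the coefficients of u or v with window e_j keeps only the summand i = j and returns
matrix coefficients of Op(f). Hence f is determined by 𝔈_h(f), the adjoint f^# corresponds to the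
kernel adjoint, and composition of kernels corresponds to the operator product.

The delicate point is the existence of f # g. If f lies in the coorbit space and T is the
distribution of 𝔈_h(f), then T° ∘ T is defined, because 𝔅 is an involutive algebra. Testing its
absolutely convergent integral on the coefficients of u shows that x ↦ ⟨Op(f)u, U_x e_j⟩ is square
integrable (`IsFrame.memLp_opForm`), so Op(f)u is in L². The same holds for f^#. The kernel 𝔈_h(f) ∘
𝔈_h(g), paired with coefficients of u and v, then defines the symbol of the weak product
(`IsFrame.exists_isSymbolProd`). The algebraic laws pass from 𝔅 to the coorbit space along this
injective correspondence (`IsInvolutiveAlgebra.transport`).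

Two foundations are needed. Dynkin's finite sum must be shown to be a group law with unimodular
translations; this is reduced to e^a e^b in nilpotent associative algebras. The maps between
symbols, kernels and coefficients must be continuous on Schwartz spaces; they are composed of
partial Fourier transforms, tensor products and substitutions of polynomial growth. -/

set_option linter.unusedSectionVars false

namespace NilPseudo

/-! ### Truncated exponential and logarithm of nilpotent elements -/

section NilpotentLog

open Polynomial

/-- In characteristic zero the coefficient of index d + 1 of p is a nonzero multiple of the
coefficient of index d of p'. Identities of truncated series can therefore be checked after
differentiation. -/
theorem X_pow_succ_dvd_of_derivative {p : ℚ[X]} {n : ℕ} (h0 : p.coeff 0 = 0)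
    (h : X ^ n ∣ derivative p) : X ^ (n + 1) ∣ p := by
  rw [X_pow_dvd_iff] at h ⊢
  intro d hd
  rcases d with _ | d
  · exact h0
  · have := h d (by omega)
    rw [coeff_derivative] at this
    have h2 : ((d : ℚ) + 1) ≠ 0 := by positivity
    exact (mul_eq_zero.mp this).resolve_right h2

/-- The truncated exponential polynomial. -/
noncomputable def expPoly (M : ℕ) : ℚ[X] :=
  ∑ i ∈ Finset.range (M + 1), C ((i.factorial : ℚ)⁻¹) * X ^ i

/-- The truncated series of `log (1 + X) / X`. -/
noncomputable def psiPoly (M : ℕ) : ℚ[X] :=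
  ∑ k ∈ Finset.range M, C ((-1 : ℚ) ^ k / ((k : ℚ) + 1)) * X ^ k

/-- The truncated series of `(exp X - 1) / X`. -/
noncomputable def expQuotPoly (M : ℕ) : ℚ[X] :=
  ∑ i ∈ Finset.range (M + 1), C (((i + 1).factorial : ℚ)⁻¹) * X ^ i

theorem derivative_expPoly (M : ℕ) :
    derivative (expPoly M) = expPoly M - C ((M.factorial : ℚ)⁻¹) * X ^ M := by
  have h : ∀ i : ℕ, derivative (C (((i + 1).factorial : ℚ)⁻¹) * X ^ (i + 1)) =
      (C ((i.factorial : ℚ)⁻¹) * X ^ i : ℚ[X]) := by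
    intro i
    rw [derivative_C_mul_X_pow, Nat.add_sub_cancel]
    congr 2
    rw [Nat.factorial_succ]
    push_cast
    have : (i.factorial : ℚ) ≠ 0 := by positivity
    field_simp
  rw [expPoly, derivative_sum, Finset.sum_range_succ', Finset.sum_congr rfl fun i _ => h i,
    Finset.sum_range_succ]
  simp

theorem expPoly_coeff_zero (M : ℕ) : (expPoly M).coeff 0 = 1 := by
  rw [expPoly, Finset.sum_range_succ']
  simp [coeff_zero_eq_eval_zero, eval_finsetSum]

theorem expPoly_succ (M : ℕ) : expPoly (M + 1) - 1 = X * expQuotPoly M := by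
  rw [expPoly, Finset.sum_range_succ', expQuotPoly, Finset.mul_sum]
  simp only [Nat.factorial_zero, Nat.cast_one, inv_one, map_one, pow_zero, mul_one,
    add_sub_cancel_right]
  refine Finset.sum_congr rfl fun i _ => ?_
  ring

theorem derivative_X_mul_psiPoly (M : ℕ) :
    derivative (X * psiPoly M) = ∑ k ∈ Finset.range M, (-X : ℚ[X]) ^ k := by
  rw [psiPoly, Finset.mul_sum, derivative_sum]
  refine Finset.sum_congr rfl fun k _ => ?_
  rw [show (X : ℚ[X]) * (C ((-1 : ℚ) ^ k / ((k : ℚ) + 1)) * X ^ k) =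
    C ((-1 : ℚ) ^ k / ((k : ℚ) + 1)) * X ^ (k + 1) by ring, derivative_C_mul_X_pow,
    Nat.add_sub_cancel]
  have : ((k : ℚ) + 1) ≠ 0 := by positivity
  have h2 : ((-1 : ℚ) ^ k / ((k : ℚ) + 1)) * ((k + 1 : ℕ) : ℚ) = (-1) ^ k := by
    push_cast; field_simp
  rw [h2, neg_pow (X : ℚ[X]), map_pow, map_neg, map_one]

theorem one_add_X_mul_geom (M : ℕ) :
    (1 + X) * ∑ k ∈ Finset.range M, (-X : ℚ[X]) ^ k = 1 - (-X) ^ M := by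
  have := mul_neg_geom_sum (-X : ℚ[X]) M
  rwa [sub_neg_eq_add] at this

theorem X_dvd_expPoly_sub_one (M : ℕ) : X ∣ expPoly M - 1 := by
  rw [X_dvd_iff]; simp [expPoly_coeff_zero]

/-- The derivative of log(exp X) is exp X times 1 / exp X, where a geometric sum stands for the
inverse; both truncation errors are multiples of X^M. -/
theorem X_pow_dvd_log_exp (M : ℕ) :
    X ^ (M + 1) ∣ (X * psiPoly M).comp (expPoly M - 1) - X := by
  refine X_pow_succ_dvd_of_derivative ?_ ?_
  · have h0 : eval 0 (expPoly M) = 1 := by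
      rw [← coeff_zero_eq_eval_zero, expPoly_coeff_zero]
    simp [coeff_zero_eq_eval_zero, eval_comp, h0]
  · rw [derivative_sub, derivative_comp, derivative_X_mul_psiPoly, derivative_X, derivative_sub,
      derivative_one, sub_zero, derivative_expPoly]
    set S := (∑ k ∈ Finset.range M, (-X : ℚ[X]) ^ k).comp (expPoly M - 1) with hS
    have h1 : expPoly M * S = 1 - (-(expPoly M - 1)) ^ M := by
      have := congrArg (fun q => q.comp (expPoly M - 1)) (one_add_X_mul_geom M)
      simpa [mul_comp, hS] using this
    have h2 : X ^ M ∣ (-(expPoly M - 1)) ^ M :=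
      pow_dvd_pow_of_dvd ((X_dvd_expPoly_sub_one M).neg_right) M
    have : (expPoly M - C ((M.factorial : ℚ)⁻¹) * X ^ M) * S - 1 =
        -(-(expPoly M - 1)) ^ M - X ^ M * (C ((M.factorial : ℚ)⁻¹) * S) := by
      linear_combination h1
    rw [this]
    exact (h2.neg_right).sub (Dvd.intro _ rfl)

/-- The product form exp(-log(1 + X)) (1 + X) = 1 is chosen because its derivative vanishes up to
truncation errors, with no division. -/
theorem X_pow_dvd_exp_log (M : ℕ) :
    X ^ (M + 1) ∣ (expPoly M).comp (-(X * psiPoly M)) * (1 + X) - 1 := by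
  refine X_pow_succ_dvd_of_derivative ?_ ?_
  · have h0 : eval 0 (expPoly M) = 1 := by
      rw [← coeff_zero_eq_eval_zero, expPoly_coeff_zero]
    simp [coeff_zero_eq_eval_zero, eval_comp, h0]
  · rw [derivative_sub, derivative_mul, derivative_comp, derivative_expPoly, derivative_neg,
      derivative_X_mul_psiPoly, derivative_one, derivative_add, derivative_one, derivative_X]
    set l := X * psiPoly M
    set S := (∑ k ∈ Finset.range M, (-X : ℚ[X]) ^ k)
    have h1 : (1 + X) * S = 1 - (-X) ^ M := one_add_X_mul_geom M
    have h2 : (expPoly M - C ((M.factorial : ℚ)⁻¹) * X ^ M).comp (-l) =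
      (expPoly M).comp (-l) - C ((M.factorial : ℚ)⁻¹) * (-l) ^ M := by simp
    rw [h2]
    have h3 : X ^ M ∣ (-l) ^ M := pow_dvd_pow_of_dvd (Dvd.intro _ rfl : (X : ℚ[X]) ∣ l).neg_right M
    have h4 : X ^ M ∣ (-X : ℚ[X]) ^ M := pow_dvd_pow_of_dvd (dvd_refl (X : ℚ[X])).neg_right M
    have : -S * ((expPoly M).comp (-l) - C ((M.factorial : ℚ)⁻¹) * (-l) ^ M) * (1 + X)
        + (expPoly M).comp (-l) * (0 + 1) - 0 =
        (-X) ^ M * (expPoly M).comp (-l) + (-l) ^ M * (S * (1 + X) * C ((M.factorial : ℚ)⁻¹)) := by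
      linear_combination (-(expPoly M).comp (-l)) * h1
    rw [this]
    exact (h4.mul_right _).add (h3.mul_right _)

/-- This is log(exp X) = X divided by X. It is used to invert the operator (e^{ad u} - 1) / ad u. -/
theorem X_pow_dvd_psi_mul_expQuot (M : ℕ) :
    X ^ (M + 1) ∣ (psiPoly (M + 1)).comp (expPoly (M + 1) - 1) * expQuotPoly M - 1 := by
  have h := X_pow_dvd_log_exp (M + 1)
  have h2 : (X * psiPoly (M + 1)).comp (expPoly (M + 1) - 1) - X =
      ((psiPoly (M + 1)).comp (expPoly (M + 1) - 1) * expQuotPoly M - 1) * X := by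
    rw [mul_comp, X_comp]
    nth_rewrite 1 [expPoly_succ]
    ring
  rw [h2, pow_succ] at h
  exact (mul_dvd_mul_iff_right X_ne_zero).mp h

variable {R : Type*} [Ring R] [Algebra ℚ R]

theorem aeval_eq_of_X_pow_dvd {u : R} {n : ℕ} (hu : u ^ n = 0) {p q : ℚ[X]} (h : X ^ n ∣ p - q) :
    aeval u p = aeval u q := by
  obtain ⟨r, hr⟩ := h
  rw [← sub_eq_zero, ← map_sub, hr, map_mul, map_pow, aeval_X, hu, zero_mul]

theorem aeval_expPoly {u : R} {M : ℕ} (hu : u ^ (M + 1) = 0) :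
    aeval u (expPoly M) = IsNilpotent.exp u := by
  rw [IsNilpotent.exp_eq_sum hu, expPoly, map_sum]
  refine Finset.sum_congr rfl fun i _ => ?_
  rw [map_mul, aeval_C, map_pow, aeval_X, Algebra.smul_def]

/-- The truncated logarithm `∑_{k=1}^M (-1)^(k-1)/k (g - 1)^k`. -/
noncomputable def nilLog (M : ℕ) (g : R) : R := aeval (g - 1) (X * psiPoly M)

theorem nilLog_exp {u : R} {M : ℕ} (hu : u ^ (M + 1) = 0) :
    nilLog M (IsNilpotent.exp u) = u := by
  have := aeval_eq_of_X_pow_dvd hu (X_pow_dvd_log_exp M)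
  rwa [aeval_comp, map_sub, map_one, aeval_expPoly hu, aeval_X] at this

theorem nilLog_pow_eq_zero {v : R} {m : ℕ} (M : ℕ) (hv : (v - 1) ^ m = 0) :
    (nilLog M v) ^ m = 0 := by
  rw [nilLog, ← map_pow, mul_pow, map_mul, map_pow, aeval_X, hv, zero_mul]

theorem exp_nilLog {v : R} {M : ℕ} (hv : (v - 1) ^ (M + 1) = 0) :
    IsNilpotent.exp (nilLog M v) = v := by
  have h0 := nilLog_pow_eq_zero M hv
  have h0' : (-(nilLog M v)) ^ (M + 1) = 0 := by rw [neg_pow, h0, mul_zero]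
  have := aeval_eq_of_X_pow_dvd hv (X_pow_dvd_exp_log M)
  rw [map_mul, aeval_comp, map_neg, ← nilLog, aeval_expPoly h0', map_add, map_one, aeval_X,
    add_sub_cancel] at this
  have h2 := congrArg (fun x => IsNilpotent.exp (nilLog M v) * x) this
  simp only [← mul_assoc] at h2
  rwa [IsNilpotent.exp_mul_exp_neg_self ⟨_, h0⟩, one_mul, mul_one, eq_comm] at h2

theorem psi_mul_expQuot {u : R} {M : ℕ} (hu : u ^ (M + 1) = 0) :
    aeval (IsNilpotent.exp u - 1) (psiPoly (M + 1)) * aeval u (expQuotPoly M) = 1 := by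
  have := aeval_eq_of_X_pow_dvd hu (X_pow_dvd_psi_mul_expQuot M)
  have hu' : u ^ (M + 1 + 1) = 0 := by rw [pow_succ, hu, zero_mul]
  rwa [map_mul, aeval_comp, map_sub, map_one, aeval_expPoly hu'] at this

theorem exp_eq_one_add_mul_expQuot {u : R} {M : ℕ} (hu : u ^ (M + 1) = 0) :
    IsNilpotent.exp u = 1 + aeval u (expQuotPoly M) * u := by
  have hu' : u ^ (M + 1 + 1) = 0 := by rw [pow_succ, hu, zero_mul]
  rw [← aeval_expPoly hu', ← sub_eq_iff_eq_add', ← map_one (aeval u : ℚ[X] →ₐ[ℚ] R), ← map_sub, expPoly_succ,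
    mul_comm, map_mul, aeval_X]

end NilpotentLog

/-! ### Combinatorics of Dynkin's formula -/

section Dynkin

/-- The right-nested bracket of a list of elements of a Lie ring. -/
def lieWord {L : Type*} [LieRing L] : List L → L
  | [] => 0
  | [x] => x
  | x :: y :: l => ⁅x, lieWord (y :: l)⁆

/-- The exponents of the blocks `x ^ r y ^ s` in Dynkin's formula, truncated at `N`. -/
def dynkinBlocks (N : ℕ) : Finset (ℕ × ℕ) :=
  (Finset.range (N + 1) ×ˢ Finset.range (N + 1)).erase (0, 0)

/-- The word of letters `x`, `y` with the block exponents `p`. -/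
def dynkinWord {L : Type*} (x y : L) {k : ℕ} (p : Fin k → ℕ × ℕ) : List L :=
  (List.ofFn p).flatMap (fun rs => List.replicate rs.1 x ++ List.replicate rs.2 y)

/-- The inverse factorials of a block. -/
def blockCoeff (q : ℕ × ℕ) : ℚ := ((q.1.factorial : ℚ) * (q.2.factorial : ℚ))⁻¹

/-- Dynkin's formula truncated at `N`, over the rationals. -/
def dynkinSum {L : Type*} [LieRing L] [LieAlgebra ℚ L] (N : ℕ) (x y : L) : L :=
  ∑ k ∈ Finset.Icc 1 N, ∑ p ∈ Fintype.piFinset (fun _ : Fin k => dynkinBlocks N),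
    ((-1 : ℚ) ^ (k - 1) / ((k : ℚ) * (∑ i, (((p i).1 : ℚ) + ((p i).2 : ℚ))) *
      ∏ i, (((p i).1.factorial : ℚ) * ((p i).2.factorial : ℚ)))) • lieWord (dynkinWord x y p)

variable {L : Type*} [LieRing L]

theorem lieWord_cons (x : L) {l : List L} (hl : l ≠ []) : lieWord (x :: l) = ⁅x, lieWord l⁆ := by
  cases l with
  | nil => exact absurd rfl hl
  | cons y l => rfl

omit [LieRing L] in
theorem length_dynkinWord (x y : L) {k : ℕ} (p : Fin k → ℕ × ℕ) :
    (dynkinWord x y p).length = ∑ i, ((p i).1 + (p i).2) := by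
  simp [dynkinWord, List.length_flatMap, List.map_ofFn, Function.comp_def, List.sum_ofFn]

omit [LieRing L] in
theorem eq_or_eq_of_mem_dynkinWord {x y z : L} {k : ℕ} {p : Fin k → ℕ × ℕ}
    (hz : z ∈ dynkinWord x y p) : z = x ∨ z = y := by
  simp only [dynkinWord, List.mem_flatMap, List.mem_append, List.mem_replicate] at hz
  obtain ⟨_, _, h | h⟩ := hz
  · exact Or.inl h.2
  · exact Or.inr h.2

theorem map_lieWord {L' F : Type*} [LieRing L'] [FunLike F L L'] (f : F)
    (h0 : f 0 = 0) (hf : ∀ x y, f ⁅x, y⁆ = ⁅f x, f y⁆) :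
    ∀ l : List L, f (lieWord l) = lieWord (l.map f)
  | [] => h0
  | [_] => rfl
  | x :: y :: l => by
    have := map_lieWord f h0 hf (y :: l)
    simp only [List.map_cons] at this ⊢
    simp only [lieWord, hf, this]

omit [LieRing L] in
theorem map_dynkinWord {L' : Type*} (f : L → L') (x y : L) {k : ℕ} (p : Fin k → ℕ × ℕ) :
    (dynkinWord x y p).map f = dynkinWord (f x) (f y) p := by
  simp [dynkinWord, List.map_flatMap]

variable [LieAlgebra ℚ L]

theorem map_dynkinSum {L' : Type*} [LieRing L'] [LieAlgebra ℚ L'] (f : L →ₗ[ℚ] L')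
    (hf : ∀ x y, f ⁅x, y⁆ = ⁅f x, f y⁆) (N : ℕ) (x y : L) :
    f (dynkinSum N x y) = dynkinSum N (f x) (f y) := by
  simp only [dynkinSum, map_sum, map_smul, map_lieWord f (map_zero f) hf, map_dynkinWord]

theorem lieWord_replicate_append (a : L) (r : ℕ) {l : List L} (hl : l ≠ []) :
    lieWord (List.replicate r a ++ l) = (LieAlgebra.ad ℚ L a ^ r) (lieWord l) := by
  induction r with
  | zero => simp
  | succ r ih =>
    rw [List.replicate_succ, List.cons_append, lieWord_cons _ (by simp [hl]), ih, pow_succ']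
    simp

omit [LieAlgebra ℚ L] in
theorem lieWord_replicate_add_two (a : L) (r : ℕ) : lieWord (List.replicate (r + 2) a) = 0 := by
  induction r with
  | zero => simp [List.replicate, lieWord]
  | succ r ih =>
    rw [show r + 1 + 2 = (r + 2) + 1 by ring, List.replicate_succ, lieWord_cons _ (by simp), ih,
      lie_zero]

theorem sum_piFinset_succ {M : Type*} [AddCommMonoid M] {α : Type*} [DecidableEq α] {k : ℕ}
    (S : Finset α) (f : (Fin (k + 1) → α) → M) :
    ∑ p ∈ Fintype.piFinset (fun _ : Fin (k + 1) => S), f p =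
      ∑ q ∈ S, ∑ p ∈ Fintype.piFinset (fun _ : Fin k => S), f (Fin.cons q p) := by
  have h := Finset.filter_piFinset_eq_map_consEquiv (n := k) (α := fun _ => α)
    (fun _ => S) (fun _ => True)
  simp only [Finset.filter_true] at h
  rw [h, Finset.sum_map, Finset.sum_product]
  rfl

/-- Brackets are nested to the right, so a block put in front acts by (ad a)^r (ad b)^s, and
independent blocks give a power of one operator. Excluding (0, 0) keeps the inner word nonempty,
which matters because the empty word has value 0. -/
theorem sum_lieWord_dynkinWord (a b : L) (S : Finset (ℕ × ℕ)) (hS : (0, 0) ∉ S)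
    (c : ℕ × ℕ → ℚ) (k : ℕ) :
    ∑ p ∈ Fintype.piFinset (fun _ : Fin (k + 1) => S),
      (∏ i, c (p i)) • lieWord (dynkinWord a b p) =
    ((∑ q ∈ S, c q • (LieAlgebra.ad ℚ L a ^ q.1 * LieAlgebra.ad ℚ L b ^ q.2)) ^ k)
      (∑ q ∈ S, c q • lieWord (List.replicate q.1 a ++ List.replicate q.2 b)) := by
  induction k with
  | zero =>
    rw [sum_piFinset_succ]
    simp [dynkinWord]
  | succ k ih =>
    rw [sum_piFinset_succ, pow_succ', Module.End.mul_apply, ← ih, LinearMap.sum_apply]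
    refine Finset.sum_congr rfl fun q _ => ?_
    rw [LinearMap.smul_apply, map_sum, Finset.smul_sum]
    refine Finset.sum_congr rfl fun p hp => ?_
    have hne : dynkinWord a b p ≠ [] := by
      have h1 : p 0 ≠ (0, 0) := fun h => hS (h ▸ Fintype.mem_piFinset.mp hp 0)
      rw [Ne, ← List.length_eq_zero_iff, length_dynkinWord]
      intro h
      have h2 := (Finset.sum_eq_zero_iff.mp h) 0 (Finset.mem_univ _)
      exact h1 (Prod.ext (by simp; omega) (by simp; omega))
    have hw : dynkinWord a b (Fin.cons q p : Fin (k + 2) → ℕ × ℕ) =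
        List.replicate q.1 a ++ (List.replicate q.2 b ++ dynkinWord a b p) := by
      simp [dynkinWord, List.ofFn_succ]
    rw [Fin.prod_univ_succ, hw, lieWord_replicate_append _ _ (by simp [hne]),
      lieWord_replicate_append _ _ hne, map_smul, smul_smul]
    simp [Fin.cons_zero, Fin.cons_succ, Module.End.mul_apply]

/-- By the Leibniz rule each letter reproduces the word once. The resulting length cancels the
denominator ∑ (r_i + s_i) of Dynkin's formula. -/
theorem derivation_lieWord (δ : L →ₗ[ℚ] L) (hδ : ∀ x y, δ ⁅x, y⁆ = ⁅δ x, y⁆ + ⁅x, δ y⁆) :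
    ∀ l : List L, (∀ x ∈ l, δ x = x) → δ (lieWord l) = (l.length : ℚ) • lieWord l
  | [], _ => by simp [lieWord]
  | [x], h => by simpa [lieWord] using h x (by simp)
  | x :: y :: l, h => by
    have := derivation_lieWord δ hδ (y :: l) fun z hz => h z (List.mem_cons_of_mem _ hz)
    rw [lieWord, hδ, this, h x (by simp), lie_smul]
    rw [List.length_cons (a := x)]
    push_cast
    module

theorem sum_Icc_one_eq_sum_range {M : Type*} [AddCommMonoid M] (N : ℕ) (f : ℕ → M) :
    ∑ k ∈ Finset.Icc 1 N, f k = ∑ k ∈ Finset.range N, f (k + 1) := by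
  symm
  refine Finset.sum_nbij (· + 1) ?_ ?_ ?_ (fun _ _ => rfl)
  · intro k hk; simp at hk ⊢; omega
  · intro k _ l _ h; simpa using h
  · intro k hk
    simp at hk
    exact ⟨k - 1, by simp; omega, by simp; omega⟩

theorem zero_notMem_dynkinBlocks (N : ℕ) : (0, 0) ∉ dynkinBlocks N := by simp [dynkinBlocks]

theorem sum_block_pos {N k : ℕ} {p : Fin (k + 1) → ℕ × ℕ}
    (hp : p ∈ Fintype.piFinset (fun _ : Fin (k + 1) => dynkinBlocks N)) :
    0 < ∑ i, ((p i).1 + (p i).2) := by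
  rw [Nat.pos_iff_ne_zero]
  intro h
  have h1 := Fintype.mem_piFinset.mp hp 0
  have h2 := (Finset.sum_eq_zero_iff.mp h) 0 (Finset.mem_univ _)
  have : p 0 = (0, 0) := Prod.ext (by simp; omega) (by simp; omega)
  exact zero_notMem_dynkinBlocks N (this ▸ h1)

/-- Once δ has cancelled the word length, the sum over k blocks is a power of the block operator,
and the remaining factors (-1)^(k-1)/k are the coefficients of `psiPoly`. -/
theorem derivation_dynkinSum (δ : L →ₗ[ℚ] L) (hδ : ∀ x y, δ ⁅x, y⁆ = ⁅δ x, y⁆ + ⁅x, δ y⁆)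
    {a b : L} (ha : δ a = a) (hb : δ b = b) (N : ℕ) :
    δ (dynkinSum N a b) = (Polynomial.aeval (∑ q ∈ dynkinBlocks N,
        blockCoeff q • (LieAlgebra.ad ℚ L a ^ q.1 * LieAlgebra.ad ℚ L b ^ q.2)) (psiPoly N))
      (∑ q ∈ dynkinBlocks N, blockCoeff q •
        lieWord (List.replicate q.1 a ++ List.replicate q.2 b)) := by
  set W := ∑ q ∈ dynkinBlocks N, blockCoeff q •
        lieWord (List.replicate q.1 a ++ List.replicate q.2 b) with hW
  rw [dynkinSum, psiPoly, sum_Icc_one_eq_sum_range, map_sum δ,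
    map_sum (Polynomial.aeval _), LinearMap.sum_apply]
  refine Finset.sum_congr rfl fun k _ => ?_
  rw [map_mul, Polynomial.aeval_C, map_pow, Polynomial.aeval_X, ← Algebra.smul_def,
    LinearMap.smul_apply, hW,
    ← sum_lieWord_dynkinWord a b _ (zero_notMem_dynkinBlocks N), map_sum, Finset.smul_sum]
  refine Finset.sum_congr rfl fun p hp => ?_
  rw [map_smul, derivation_lieWord δ hδ, length_dynkinWord, smul_smul, smul_smul]
  · congr 1
    have h1 : ((∑ i, ((p i).1 + (p i).2) : ℕ) : ℚ) ≠ 0 := by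
      exact_mod_cast (sum_block_pos hp).ne'
    have h2 : (∑ i, (((p i).1 : ℚ) + ((p i).2 : ℚ))) = ((∑ i, ((p i).1 + (p i).2) : ℕ) : ℚ) := by
      push_cast; rfl
    have h3 : (∏ i, blockCoeff (p i)) =
      (∏ i, (((p i).1.factorial : ℚ) * ((p i).2.factorial : ℚ)))⁻¹ := by
      simp only [blockCoeff, Finset.prod_inv_distrib]
    have h4 : (∏ i, (((p i).1.factorial : ℚ) * ((p i).2.factorial : ℚ))) ≠ 0 :=
      Finset.prod_ne_zero_iff.mpr fun i _ => by positivity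
    have h5 : (k : ℚ) + 1 ≠ 0 := by positivity
    rw [h2, h3, Nat.add_sub_cancel]
    push_cast at h1 ⊢
    field_simp
  · intro x hx
    rcases eq_or_eq_of_mem_dynkinWord hx with rfl | rfl <;> assumption

theorem sum_dynkinBlocks {M : Type*} [AddCommGroup M] (N : ℕ) (f : ℕ × ℕ → M) :
    ∑ q ∈ dynkinBlocks N, f q =
      ∑ r ∈ Finset.range (N + 1), ∑ s ∈ Finset.range (N + 1), f (r, s) - f (0, 0) := by
  rw [dynkinBlocks, ← Finset.sum_product', eq_sub_iff_add_eq, Finset.sum_erase_add]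
  simp

theorem sum_blocks_ad {a b : L} {N : ℕ} (ha : LieAlgebra.ad ℚ L a ^ (N + 1) = 0)
    (hb : LieAlgebra.ad ℚ L b ^ (N + 1) = 0) :
    ∑ q ∈ dynkinBlocks N, blockCoeff q • (LieAlgebra.ad ℚ L a ^ q.1 * LieAlgebra.ad ℚ L b ^ q.2) =
      IsNilpotent.exp (LieAlgebra.ad ℚ L a) * IsNilpotent.exp (LieAlgebra.ad ℚ L b) - 1 := by
  rw [sum_dynkinBlocks, IsNilpotent.exp_eq_sum ha, IsNilpotent.exp_eq_sum hb, Finset.sum_mul_sum]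
  congr 1
  · refine Finset.sum_congr rfl fun r _ => Finset.sum_congr rfl fun s _ => ?_
    rw [smul_mul_smul_comm, blockCoeff, mul_inv]
  · simp [blockCoeff]

/-- Words ending in b b vanish; those ending in a single b sum to e^{ad a} b; among the words
without b only the single letter a survives. -/
theorem sum_blocks_lieWord {a b : L} {N : ℕ} (ha : LieAlgebra.ad ℚ L a ^ (N + 2) = 0) :
    ∑ q ∈ dynkinBlocks (N + 1), blockCoeff q •
        lieWord (List.replicate q.1 a ++ List.replicate q.2 b) =
      a + IsNilpotent.exp (LieAlgebra.ad ℚ L a) b := by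
  have h0 : ∀ r s, lieWord (List.replicate r a ++ List.replicate (s + 2) b) = 0 := by
    intro r s
    rw [lieWord_replicate_append _ _ (by simp [List.replicate]), lieWord_replicate_add_two, map_zero]
  have h1 : ∀ r, lieWord (List.replicate r a ++ List.replicate 1 b) =
      (LieAlgebra.ad ℚ L a ^ r) b := by
    intro r
    rw [lieWord_replicate_append _ _ (by simp [List.replicate])]
    rfl
  rw [sum_dynkinBlocks, IsNilpotent.exp_eq_sum ha, LinearMap.sum_apply]
  simp only [Finset.sum_range_succ' _ (N + 1), Finset.sum_range_succ' _ N, Finset.sum_add_distrib]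
  simp only [h0, zero_add, h1, lieWord_replicate_add_two, List.replicate_zero, List.append_nil,
    blockCoeff, smul_zero, Finset.sum_const_zero, LinearMap.smul_apply, Nat.factorial_one,
    Nat.factorial_zero, Nat.cast_one, mul_one, inv_one, one_smul, pow_zero, Module.End.one_apply]
  have h2 : ∀ s, lieWord (List.replicate (s + 1 + 1) b) = 0 := lieWord_replicate_add_two b
  simp [lieWord, h2]
  abel

/-- Every block has at least one letter, so a term with more than N blocks or with an exponent above
N belongs to a word longer than N. -/
theorem dynkinSum_eq_of_le {N N' : ℕ} (h : N ≤ N') {x y : L}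
    (hw : ∀ l : List L, (∀ z ∈ l, z = x ∨ z = y) → N < l.length → lieWord l = 0) :
    dynkinSum N' x y = dynkinSum N x y := by
  have hlong : ∀ {k : ℕ} (p : Fin k → ℕ × ℕ), N < ∑ i, ((p i).1 + (p i).2) →
      lieWord (dynkinWord x y p) = 0 := fun p hp =>
    hw _ (fun z hz => eq_or_eq_of_mem_dynkinWord hz) (by rwa [length_dynkinWord])
  have hk : ∀ {k : ℕ} {p : Fin k → ℕ × ℕ},
      p ∈ Fintype.piFinset (fun _ : Fin k => dynkinBlocks N') → k ≤ ∑ i, ((p i).1 + (p i).2) := by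
    intro k p hp
    calc k = ∑ _i : Fin k, 1 := by simp
      _ ≤ _ := Finset.sum_le_sum fun i _ => by
        have h1 := Fintype.mem_piFinset.mp hp i
        by_contra hlt
        have : p i = (0, 0) := Prod.ext (by simp; omega) (by simp; omega)
        exact zero_notMem_dynkinBlocks N' (this ▸ h1)
  unfold dynkinSum
  symm
  rw [← Finset.sum_subset (Finset.Icc_subset_Icc_right h)]
  · refine Finset.sum_congr rfl fun k _ => ?_
    refine Finset.sum_subset ?_ ?_
    · refine Fintype.piFinset_subset _ _ fun i => Finset.erase_subset_erase _ ?_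
      exact Finset.product_subset_product (by simpa using h) (by simpa using h)
    · intro p hp hp'
      rw [hlong, smul_zero]
      by_contra hle
      apply hp'
      rw [Fintype.mem_piFinset] at hp ⊢
      intro i
      have := hp i
      have h3 : (p i).1 + (p i).2 ≤ ∑ i, ((p i).1 + (p i).2) :=
        Finset.single_le_sum (f := fun i => (p i).1 + (p i).2) (fun _ _ => Nat.zero_le _)
          (Finset.mem_univ i)
      simp only [dynkinBlocks, Finset.mem_erase, Finset.mem_product, Finset.mem_range] at this ⊢
      exact ⟨this.1, by omega, by omega⟩
  · intro k hk1 hk2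
    refine Finset.sum_eq_zero fun p hp => ?_
    rw [hlong, smul_zero]
    have := hk hp
    simp at hk1 hk2
    have := hk2 hk1.1
    omega

end Dynkin

/-! ### Derivations of exponentials and logarithms -/

section ExpDerivation

open Polynomial

attribute [local instance] LieRing.ofAssociativeRing

variable {R : Type*} [Ring R] [Algebra ℚ R]

/-- ad u is the sum of the commuting operators of left multiplication by u and right multiplication
by -u, and the exponential of each is again a multiplication. -/
theorem exp_ad_eq {u : R} (hu : IsNilpotent u) :
    IsNilpotent.exp (LieAlgebra.ad ℚ R u) =
      LinearMap.mulLeft ℚ (IsNilpotent.exp u) * LinearMap.mulRight ℚ (IsNilpotent.exp (-u)) := by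
  obtain ⟨k, hk⟩ := hu
  have hk' : (-u) ^ k = 0 := by rw [neg_pow, hk, mul_zero]
  have h1 : LinearMap.mulLeft ℚ u ^ k = 0 := by
    rw [LinearMap.pow_mulLeft, hk, LinearMap.mulLeft_zero_eq_zero]
  have h2 : LinearMap.mulRight ℚ (-u) ^ k = 0 := by
    rw [LinearMap.pow_mulRight, hk', LinearMap.mulRight_zero_eq_zero]
  have h3 : LieAlgebra.ad ℚ R u = LinearMap.mulLeft ℚ u + LinearMap.mulRight ℚ (-u) := by
    ext x
    simp [LieRing.of_associative_ring_bracket, sub_eq_add_neg]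
  rw [h3, IsNilpotent.exp_add_of_commute (LinearMap.commute_mulLeft_right u (-u)) ⟨k, h1⟩ ⟨k, h2⟩]
  congr 1
  · rw [IsNilpotent.exp_eq_sum h1, IsNilpotent.exp_eq_sum hk]
    ext x
    simp [LinearMap.pow_mulLeft, Finset.sum_mul]
  · rw [IsNilpotent.exp_eq_sum h2, IsNilpotent.exp_eq_sum hk']
    ext x
    simp [LinearMap.pow_mulRight, Finset.mul_sum]

theorem exp_ad_apply {u : R} (hu : IsNilpotent u) (x : R) :
    IsNilpotent.exp (LieAlgebra.ad ℚ R u) x = IsNilpotent.exp u * x * IsNilpotent.exp (-u) := by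
  rw [exp_ad_eq hu]
  simp [mul_assoc]

theorem aeval_ad_map {S : Type*} [Ring S] [Algebra ℚ S] (f : R →ₐ[ℚ] S) (u x : R) (p : ℚ[X]) :
    aeval (LieAlgebra.ad ℚ S (f u)) p (f x) = f (aeval (LieAlgebra.ad ℚ R u) p x) := by
  induction p using Polynomial.induction_on' with
  | add p q hp hq => simp [hp, hq]
  | monomial n c =>
    simp only [aeval_monomial, Module.End.mul_apply, Module.algebraMap_end_apply, map_smul]
    congr 1
    induction n with
    | zero => simp
    | succ n ih => simp [pow_succ', ih, LieRing.of_associative_ring_bracket]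

/-- Conjugate δ, as an endomorphism of R, by left multiplication with e^u. Since the commutator of
left multiplication by u with δ is left multiplication by -δ u, the series of e^{ad} can be summed;
its value at 1 is e^u δ(e^{-u}), and δ(e^u e^{-u}) = 0 gives the claim. -/
theorem derivation_exp (δ : R →ₗ[ℚ] R) (hδ : ∀ x y, δ (x * y) = δ x * y + x * δ y) {u : R}
    {K : ℕ} (hu : IsNilpotent u)
    (hK : LieAlgebra.ad ℚ (Module.End ℚ R) (Algebra.lmul ℚ R u) ^ (K + 1) = 0) :
    δ (IsNilpotent.exp u) = aeval (LieAlgebra.ad ℚ R u) (expQuotPoly K) (δ u) *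
      IsNilpotent.exp u := by
  have hδ1 : δ 1 = 0 := by simpa using hδ 1 1
  have hl : IsNilpotent (Algebra.lmul ℚ R u) := hu.map _
  have h1 := LinearMap.congr_fun (exp_eq_one_add_mul_expQuot hK) δ
  rw [exp_ad_apply hl] at h1
  have h2 : LieAlgebra.ad ℚ (Module.End ℚ R) (Algebra.lmul ℚ R u) δ = - Algebra.lmul ℚ R (δ u) := by
    ext x
    simp [LieRing.of_associative_ring_bracket, hδ]
  rw [LinearMap.add_apply, Module.End.mul_apply, h2, map_neg, aeval_ad_map, ← map_neg,
    ← IsNilpotent.map_exp hu, ← IsNilpotent.map_exp hu.neg] at h1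
  have h3 := LinearMap.congr_fun h1 1
  simp [hδ1] at h3
  have h4 : δ (IsNilpotent.exp u * IsNilpotent.exp (-u)) = 0 := by
    rw [IsNilpotent.exp_mul_exp_neg_self hu, hδ1]
  rw [hδ, h3] at h4
  have h5 := congrArg (· * IsNilpotent.exp u) (add_neg_eq_zero.mp h4)
  simpa [mul_assoc, IsNilpotent.exp_neg_mul_exp_self hu] using h5

/-- Let M = log(e^a e^b). Differentiating e^M = e^a e^b in two ways gives ((e^{ad M} - 1) / ad M)(δ
M) = a + e^{ad a} b. Inverting the operator on the left, with e^{ad M} = e^{ad a} e^{ad b}, produces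
the derivative of Dynkin's sum. -/
theorem derivation_nilLog (δ : R →ₗ[ℚ] R) (hδ : ∀ x y, δ (x * y) = δ x * y + x * δ y)
    {a b : R} (ha : IsNilpotent a) (hb : IsNilpotent b)
    (hv : IsNilpotent (IsNilpotent.exp a * IsNilpotent.exp b - 1))
    (hδa : δ a = a) (hδb : δ b = b) :
    ∃ n₀, ∀ n ≥ n₀, δ (nilLog n (IsNilpotent.exp a * IsNilpotent.exp b)) =
      δ (dynkinSum (n + 1) a b) := by
  set v := IsNilpotent.exp a * IsNilpotent.exp b with hvdef
  obtain ⟨k1, hk1⟩ := hv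
  have hv1 : ∀ n ≥ k1, (v - 1) ^ (n + 1) = 0 := fun n hn => pow_eq_zero_of_le (by omega) hk1
  have hadnil : ∀ u : R, IsNilpotent u → IsNilpotent (LieAlgebra.ad ℚ R u) := fun u hu =>
    LieAlgebra.ad_nilpotent_of_nilpotent hu
  have hadnil' : ∀ u : R, IsNilpotent u → IsNilpotent
      (LieAlgebra.ad ℚ (Module.End ℚ R) (Algebra.lmul ℚ R u)) := fun u hu =>
    LieAlgebra.ad_nilpotent_of_nilpotent (hu.map _)
  obtain ⟨ka, hka⟩ := hadnil a ha
  obtain ⟨kb, hkb⟩ := hadnil b hb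
  obtain ⟨ka', hka'⟩ := hadnil' a ha
  obtain ⟨kb', hkb'⟩ := hadnil' b hb
  set M := nilLog k1 v with hMdef
  have hexp : IsNilpotent.exp M = v := exp_nilLog (hv1 k1 le_rfl)
  have hMnil : IsNilpotent M := ⟨_, nilLog_pow_eq_zero k1 hk1⟩
  have hMn : ∀ n ≥ k1, nilLog n v = M := by
    intro n hn
    rw [← hexp]
    exact nilLog_exp (pow_eq_zero_of_le (by omega) (nilLog_pow_eq_zero k1 hk1))
  have hv' : IsNilpotent.exp (-M) = IsNilpotent.exp (-b) * IsNilpotent.exp (-a) := by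
    have h1 : v * (IsNilpotent.exp (-b) * IsNilpotent.exp (-a)) = 1 := by
      rw [hvdef, mul_assoc, ← mul_assoc (IsNilpotent.exp b), IsNilpotent.exp_mul_exp_neg_self hb,
        one_mul, IsNilpotent.exp_mul_exp_neg_self ha]
    have h2 := IsNilpotent.exp_neg_mul_exp_self hMnil
    rw [hexp] at h2
    exact left_inv_eq_right_inv h2 h1
  obtain ⟨km, hkm⟩ := hadnil M hMnil
  obtain ⟨km', hkm'⟩ := hadnil' M hMnil
  have hself : ∀ {u : R} {K : ℕ}, aeval (LieAlgebra.ad ℚ R u) (expQuotPoly K) u = u := by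
    intro u K
    rw [expQuotPoly, map_sum, LinearMap.sum_apply, Finset.sum_eq_single_of_mem 0 (by simp)]
    · simp
    · intro i _ hi
      obtain ⟨j, rfl⟩ := Nat.exists_eq_succ_of_ne_zero hi
      simp [pow_succ]
  have hda : δ (IsNilpotent.exp a) = a * IsNilpotent.exp a := by
    rw [derivation_exp δ hδ ha (pow_eq_zero_of_le (Nat.le_succ ka') hka'), hδa, hself]
  have hdb : δ (IsNilpotent.exp b) = b * IsNilpotent.exp b := by
    rw [derivation_exp δ hδ hb (pow_eq_zero_of_le (Nat.le_succ kb') hkb'), hδb, hself]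
  have hW : ∀ K, LieAlgebra.ad ℚ (Module.End ℚ R) (Algebra.lmul ℚ R M) ^ (K + 1) = 0 →
      aeval (LieAlgebra.ad ℚ R M) (expQuotPoly K) (δ M) =
        a + IsNilpotent.exp (LieAlgebra.ad ℚ R a) b := by
    intro K hK
    have h1 := derivation_exp δ hδ hMnil hK
    have h2 : δ v = (a + IsNilpotent.exp (LieAlgebra.ad ℚ R a) b) * v := by
      rw [hvdef, hδ, hda, hdb, exp_ad_apply ha, add_mul]
      simp only [mul_assoc]
      rw [← mul_assoc (IsNilpotent.exp (-a)), IsNilpotent.exp_neg_mul_exp_self ha, one_mul]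
    rw [hexp, h2] at h1
    have h3 := congrArg (· * IsNilpotent.exp (-M)) h1
    simp only [mul_assoc] at h3
    rw [← hexp, IsNilpotent.exp_mul_exp_neg_self hMnil, mul_one, mul_one] at h3
    exact h3.symm
  have hadexp : IsNilpotent.exp (LieAlgebra.ad ℚ R M) =
      IsNilpotent.exp (LieAlgebra.ad ℚ R a) * IsNilpotent.exp (LieAlgebra.ad ℚ R b) := by
    ext x
    rw [Module.End.mul_apply, exp_ad_apply hMnil, exp_ad_apply ha, exp_ad_apply hb, hexp, hv',
      hvdef]
    simp only [mul_assoc]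
  refine ⟨k1 + ka + kb + km + km', fun n hn => ?_⟩
  have h1 := congrArg (fun T => T (δ M)) (psi_mul_expQuot (u := LieAlgebra.ad ℚ R M) (M := n)
    (pow_eq_zero_of_le (by omega) hkm))
  simp only [Module.End.mul_apply, Module.End.one_apply] at h1
  rw [hW n (pow_eq_zero_of_le (by omega) hkm'), hadexp] at h1
  have hδ' : ∀ x y : R, δ ⁅x, y⁆ = ⁅δ x, y⁆ + ⁅x, δ y⁆ := by
    intro x y
    simp only [LieRing.of_associative_ring_bracket, map_sub, hδ]
    abel
  rw [hMn n (by omega), ← h1, derivation_dynkinSum δ hδ' hδa hδb,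
    sum_blocks_ad (pow_eq_zero_of_le (by omega) hka) (pow_eq_zero_of_le (by omega) hkb),
    sum_blocks_lieWord (pow_eq_zero_of_le (by omega) hka)]

end ExpDerivation

/-! ### Baker-Campbell-Hausdorff in nilpotent associative algebras -/

section ExpDynkin

open Polynomial

attribute [local instance] LieRing.ofAssociativeRing

variable {R : Type*} [Ring R] [Algebra ℚ R]

/-- A decreasing multiplicative filtration of an algebra which vanishes from step `N + 1` on. -/
structure NilFiltration (N : ℕ) (F : ℕ → Submodule ℚ R) : Prop where
  mul_mem : ∀ i j x y, x ∈ F i → y ∈ F j → x * y ∈ F (i + j)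
  anti : ∀ i j, i ≤ j → F j ≤ F i
  eq_bot : F (N + 1) = ⊥

variable {N : ℕ} {F : ℕ → Submodule ℚ R}

theorem NilFiltration.pow_mem (hF : NilFiltration N F) {x : R} (hx : x ∈ F 1) (n : ℕ) :
    x ^ (n + 1) ∈ F (n + 1) := by
  induction n with
  | zero => simpa using hx
  | succ n ih => rw [pow_succ]; exact hF.mul_mem _ _ _ _ ih hx

theorem NilFiltration.pow_eq_zero (hF : NilFiltration N F) {x : R} (hx : x ∈ F 1) :
    x ^ (N + 1) = 0 := by
  have := hF.pow_mem hx N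
  rwa [hF.eq_bot, Submodule.mem_bot] at this

theorem NilFiltration.isNilpotent (hF : NilFiltration N F) {x : R} (hx : x ∈ F 1) :
    IsNilpotent x := ⟨_, hF.pow_eq_zero hx⟩

theorem NilFiltration.exp_sub_one_mem (hF : NilFiltration N F) {x : R} (hx : x ∈ F 1) :
    IsNilpotent.exp x - 1 ∈ F 1 := by
  rw [IsNilpotent.exp_eq_sum (hF.pow_eq_zero hx), Finset.sum_range_succ']
  simp only [Nat.factorial_zero, Nat.cast_one, inv_one, pow_zero, one_smul, add_sub_cancel_right]
  exact Submodule.sum_mem _ fun i _ => Submodule.smul_mem _ _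
    (hF.anti _ _ (by omega) (hF.pow_mem hx i))

theorem NilFiltration.exp_mul_exp_sub_one_mem (hF : NilFiltration N F) {x y : R} (hx : x ∈ F 1)
    (hy : y ∈ F 1) : IsNilpotent.exp x * IsNilpotent.exp y - 1 ∈ F 1 := by
  have h1 := hF.exp_sub_one_mem hx
  have h2 := hF.exp_sub_one_mem hy
  have h3 : IsNilpotent.exp x * IsNilpotent.exp y - 1 = (IsNilpotent.exp x - 1) *
      (IsNilpotent.exp y - 1) + (IsNilpotent.exp x - 1) + (IsNilpotent.exp y - 1) := by noncomm_ring
  rw [h3]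
  exact add_mem (add_mem (hF.anti _ _ (by omega) (hF.mul_mem _ _ _ _ h1 h2)) h1) h2

theorem NilFiltration.lieWord_mem (hF : NilFiltration N F) :
    ∀ l : List R, (∀ x ∈ l, x ∈ F 1) → lieWord l ∈ F l.length
  | [], _ => Submodule.zero_mem _
  | [x], h => h x (by simp)
  | x :: y :: l, h => by
    have h1 := hF.lieWord_mem (y :: l) fun z hz => h z (List.mem_cons_of_mem _ hz)
    rw [lieWord, LieRing.of_associative_ring_bracket, List.length_cons (a := x)]
    refine sub_mem ?_ (hF.mul_mem _ _ _ _ h1 (h x (by simp)))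
    rw [add_comm]
    exact hF.mul_mem _ _ _ _ (h x (by simp)) h1

theorem NilFiltration.dynkinSum_eq (hF : NilFiltration N F) {x y : R} (hx : x ∈ F 1)
    (hy : y ∈ F 1) {n : ℕ} (hn : N ≤ n) : dynkinSum n x y = dynkinSum N x y := by
  refine dynkinSum_eq_of_le hn fun l hl hlen => ?_
  have h1 := hF.lieWord_mem l fun z hz => by rcases hl z hz with rfl | rfl <;> assumption
  have h2 := hF.anti _ _ (Nat.succ_le_of_lt hlen) h1
  rwa [Nat.succ_eq_add_one, hF.eq_bot, Submodule.mem_bot] at h2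

/-- The coefficientwise extension of a filtration to polynomials. -/
def polyFiltration (F : ℕ → Submodule ℚ R) (i : ℕ) : Submodule ℚ R[X] where
  carrier := {p | ∀ n, p.coeff n ∈ F i}
  add_mem' hp hq n := by rw [coeff_add]; exact add_mem (hp n) (hq n)
  zero_mem' n := by simp
  smul_mem' c p hp n := by rw [coeff_smul]; exact Submodule.smul_mem _ _ (hp n)

theorem NilFiltration.poly (hF : NilFiltration N F) : NilFiltration N (polyFiltration F) where
  mul_mem i j x y hx hy n := by
    rw [coeff_mul]
    exact Submodule.sum_mem _ fun q _ => hF.mul_mem _ _ _ _ (hx _) (hy _)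
  anti i j hij x hx n := hF.anti i j hij (hx n)
  eq_bot := by
    rw [eq_bot_iff]
    intro p hp
    rw [Submodule.mem_bot]
    ext n
    have := hp n
    rwa [hF.eq_bot, Submodule.mem_bot] at this

theorem C_mul_X_mem_polyFiltration {a : R} (ha : a ∈ F 1) : C a * X ∈ polyFiltration F 1 := by
  intro n
  rw [coeff_C_mul, coeff_X]
  split_ifs <;> simp [ha]

/-- The Euler derivation `X d/dX` of polynomials with coefficients in a noncommutative algebra. -/
noncomputable def polyEuler : R[X] →ₗ[ℚ] R[X] where
  toFun p := X * derivative p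
  map_add' p q := by rw [derivative_add, mul_add]
  map_smul' c p := by rw [derivative_smul, mul_smul_comm]; rfl

theorem polyEuler_mul (p q : R[X]) : polyEuler (p * q) = polyEuler p * q + p * polyEuler q := by
  simp only [polyEuler, LinearMap.coe_mk, AddHom.coe_mk, derivative_mul, mul_add, ← mul_assoc]
  rw [X_mul (p := p)]

theorem polyEuler_C_mul_X (a : R) : polyEuler (C a * X) = C a * X := by
  simp [polyEuler, X_mul]

/-- The Euler derivation multiplies the coefficient of index n by n, so only constants are lost. -/
theorem eq_zero_of_polyEuler_eq_zero {p : R[X]} (hp : polyEuler p = 0) (h0 : p.coeff 0 = 0) :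
    p = 0 := by
  ext n
  rcases n with _ | n
  · simpa using h0
  · have h1 : (X * derivative p).coeff (n + 1) = 0 := by
      have : X * derivative p = 0 := hp
      rw [this, coeff_zero]
    rw [coeff_X_mul, coeff_derivative] at h1
    have h2 : ((n : ℚ) + 1) • p.coeff (n + 1) = 0 := by
      rw [Algebra.smul_def, ← h1, map_add, map_natCast, map_one]
      exact ((Nat.cast_commute n _).add_left (Commute.one_left _)).eq
    rw [coeff_zero]
    exact (smul_eq_zero.mp h2).resolve_left (by positivity)

theorem map_nilLog {S : Type*} [Ring S] [Algebra ℚ S] (f : R →ₐ[ℚ] S) (n : ℕ) (v : R) :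
    f (nilLog n v) = nilLog n (f v) := by
  rw [nilLog, nilLog, ← map_one f, ← map_sub, aeval_algHom_apply]

theorem lieWord_eq_zero_of_forall {L : Type*} [LieRing L] :
    ∀ l : List L, (∀ x ∈ l, x = 0) → lieWord l = 0
  | [], _ => rfl
  | [x], h => h x (by simp)
  | x :: y :: l, h => by rw [lieWord, h x (by simp), zero_lie]

theorem dynkinSum_zero_zero {L : Type*} [LieRing L] [LieAlgebra ℚ L] (n : ℕ) :
    dynkinSum n (0 : L) 0 = 0 := by
  refine Finset.sum_eq_zero fun k _ => Finset.sum_eq_zero fun p _ => ?_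
  rw [lieWord_eq_zero_of_forall, smul_zero]
  intro x hx
  rcases eq_or_eq_of_mem_dynkinWord hx with rfl | rfl <;> rfl

theorem map_lie_of_algHom {S : Type*} [Ring S] [Algebra ℚ S] (f : R →ₐ[ℚ] S) (x y : R) :
    f ⁅x, y⁆ = ⁅f x, f y⁆ := by simp [LieRing.of_associative_ring_bracket]

/-- The Baker-Campbell-Hausdorff-Dynkin formula in a nilpotent associative algebra. -/
theorem NilFiltration.exp_dynkinSum (hF : NilFiltration N F) {a b : R} (ha : a ∈ F 1)
    (hb : b ∈ F 1) :
    IsNilpotent.exp (dynkinSum N a b) = IsNilpotent.exp a * IsNilpotent.exp b := by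
  have hP := hF.poly
  have ha' := C_mul_X_mem_polyFiltration ha
  have hb' := C_mul_X_mem_polyFiltration hb
  -- Passing to aX and bX provides a derivation, X d/dX, that fixes both generators; X is set to 1
  -- at the end.
  set a' : R[X] := C a * X with hadef
  set b' : R[X] := C b * X with hbdef
  have hv := hP.exp_mul_exp_sub_one_mem ha' hb'
  obtain ⟨n₀, hn₀⟩ := derivation_nilLog polyEuler polyEuler_mul (hP.isNilpotent ha')
    (hP.isNilpotent hb') (hP.isNilpotent hv) (polyEuler_C_mul_X a) (polyEuler_C_mul_X b)
  set n := n₀ + N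
  have h1 := hn₀ n (by omega)
  have hconst : ∀ f : R[X] →ₐ[ℚ] R, f a' = 0 → f b' = 0 →
      f (nilLog n (IsNilpotent.exp a' * IsNilpotent.exp b') - dynkinSum (n + 1) a' b') = 0 := by
    intro f hfa hfb
    rw [map_sub, map_nilLog, map_mul, IsNilpotent.map_exp (hP.isNilpotent ha'),
      IsNilpotent.map_exp (hP.isNilpotent hb'), hfa, hfb,
      show f (dynkinSum (n + 1) a' b') = dynkinSum (n + 1) (f a') (f b') from
        map_dynkinSum f.toLinearMap (map_lie_of_algHom f) _ _ _, hfa, hfb, dynkinSum_zero_zero]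
    simp [nilLog]
  have h2 : nilLog n (IsNilpotent.exp a' * IsNilpotent.exp b') = dynkinSum (n + 1) a' b' := by
    -- The two sides have the same Euler derivative, and their constant terms vanish because aX and
    -- bX are sent to 0.
    rw [← sub_eq_zero]
    refine eq_zero_of_polyEuler_eq_zero (by rw [map_sub, h1, sub_self]) ?_
    exact hconst (RingHom.toRatAlgHom (constantCoeff (R := R))) (by simp [hadef]) (by simp [hbdef])
  -- Evaluation at 1 is multiplicative although R need not be commutative, because 1 is central.
  let φ : R[X] →ₐ[ℚ] R := RingHom.toRatAlgHom
    (eval₂RingHom' (RingHom.id R) 1 (fun a => Commute.one_right a))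
  have hφ : ∀ x : R, φ (C x * X) = x := by
    intro x
    change eval₂ (RingHom.id R) 1 (C x * X) = x
    rw [eval₂_mul_X, eval₂_C]; simp
  have h3 := congrArg φ h2
  rw [map_nilLog, map_mul, IsNilpotent.map_exp (hP.isNilpotent ha'),
    IsNilpotent.map_exp (hP.isNilpotent hb'),
    show φ (dynkinSum (n + 1) a' b') = dynkinSum (n + 1) (φ a') (φ b') from
      map_dynkinSum φ.toLinearMap (map_lie_of_algHom φ) _ _ _, hφ, hφ,
    hF.dynkinSum_eq ha hb (by omega)] at h3
  rw [← h3]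
  exact exp_nilLog (pow_eq_zero_of_le (by omega)
    (hF.pow_eq_zero (hF.exp_mul_exp_sub_one_mem ha hb)))

theorem NilFiltration.exp_injOn (hF : NilFiltration N F) {a b : R} (ha : a ∈ F 1)
    (hb : b ∈ F 1) (h : IsNilpotent.exp a = IsNilpotent.exp b) : a = b := by
  rw [← nilLog_exp (hF.pow_eq_zero ha), h, nilLog_exp (hF.pow_eq_zero hb)]

end ExpDynkin

/-! ### The group law in nilpotent Lie algebras, by a faithful representation -/

section PolyRep

open Polynomial TensorProduct

attribute [local instance] LieRing.ofAssociativeRing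

variable {𝔤 : Type*} [LieRing 𝔤] [LieAlgebra ℚ 𝔤]

/-- A decreasing central filtration of a Lie algebra of length `N`. -/
structure CentralFiltration (N : ℕ) (G : ℕ → Submodule ℚ 𝔤) : Prop where
  zero_eq : G 0 = ⊤
  lie_mem : ∀ j (x y : 𝔤), y ∈ G j → ⁅x, y⁆ ∈ G (j + 1)
  anti : ∀ i j, i ≤ j → G j ≤ G i
  eq_bot : G N = ⊥

variable (𝔤) in
/-- The Lie algebra `ℚ[t] ⊗ 𝔤` of polynomials with coefficients in `𝔤`. -/
def PolyLie := ℚ[X] ⊗[ℚ] 𝔤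

namespace PolyLie

noncomputable instance : LieRing (PolyLie 𝔤) := inferInstanceAs (LieRing (ℚ[X] ⊗[ℚ] 𝔤))

noncomputable instance : Module ℚ (PolyLie 𝔤) := inferInstanceAs (Module ℚ (ℚ[X] ⊗[ℚ] 𝔤))

/-- The elementary polynomial `p(t) x`. -/
noncomputable def tmul (p : ℚ[X]) (x : 𝔤) : PolyLie 𝔤 := p ⊗ₜ[ℚ] x

@[elab_as_elim]
theorem induction_on {motive : PolyLie 𝔤 → Prop} (w : PolyLie 𝔤) (zero : motive 0)
    (tmul : ∀ p x, motive (tmul p x)) (add : ∀ u v, motive u → motive v → motive (u + v)) :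
    motive w :=
  TensorProduct.induction_on w zero tmul add

theorem lie_tmul_tmul (p q : ℚ[X]) (x y : 𝔤) :
    ⁅tmul p x, tmul q y⁆ = tmul (p * q) ⁅x, y⁆ := rfl

theorem add_tmul (p q : ℚ[X]) (x : 𝔤) : tmul (p + q) x = tmul p x + tmul q x :=
  TensorProduct.add_tmul p q x

theorem tmul_zero (p : ℚ[X]) : tmul p (0 : 𝔤) = 0 := TensorProduct.tmul_zero _ p

theorem smul_tmul (c : ℚ) (p : ℚ[X]) (x : 𝔤) : c • tmul p x = tmul (c • p) x := rfl

noncomputable instance : LieAlgebra ℚ (PolyLie 𝔤) where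
  lie_smul c u v := by
    induction u using induction_on with
    | zero => simp
    | add u₁ u₂ h₁ h₂ => rw [add_lie, h₁, h₂, add_lie, smul_add]
    | tmul p x =>
      induction v using induction_on with
      | zero => simp
      | add v₁ v₂ h₁ h₂ => rw [smul_add, lie_add, h₁, h₂, lie_add, smul_add]
      | tmul q y => rw [smul_tmul, lie_tmul_tmul, lie_tmul_tmul, smul_tmul, mul_smul_comm]

/-- The linear map with given values on elementary polynomials. -/
noncomputable def map {V : Type*} [AddCommGroup V] [Module ℚ V] (f : ℚ[X] ⊗[ℚ] 𝔤 →ₗ[ℚ] V) :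
    PolyLie 𝔤 →ₗ[ℚ] V where
  toFun := f
  map_add' := f.map_add
  map_smul' := f.map_smul

theorem map_tmul {V : Type*} [AddCommGroup V] [Module ℚ V] (f : ℚ[X] ⊗[ℚ] 𝔤 →ₗ[ℚ] V) (p : ℚ[X])
    (x : 𝔤) : map f (tmul p x) = f (p ⊗ₜ x) := rfl

end PolyLie

open PolyLie

/-- The derivation `d/dt` of the Lie algebra `ℚ[t] ⊗ 𝔤`. -/
noncomputable def polyDeriv : PolyLie 𝔤 →ₗ[ℚ] PolyLie 𝔤 :=
  PolyLie.map (LinearMap.rTensor 𝔤 (derivative : ℚ[X] →ₗ[ℚ] ℚ[X]) : _ →ₗ[ℚ] ℚ[X] ⊗[ℚ] 𝔤)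

theorem polyDeriv_tmul (p : ℚ[X]) (x : 𝔤) : polyDeriv (tmul p x) = tmul (derivative p) x := rfl

theorem polyDeriv_lie (u v : PolyLie 𝔤) :
    polyDeriv ⁅u, v⁆ = ⁅polyDeriv u, v⁆ + ⁅u, polyDeriv v⁆ := by
  induction u using PolyLie.induction_on with
  | zero => simp
  | add u₁ u₂ h₁ h₂ => rw [add_lie, map_add, h₁, h₂, map_add, add_lie, add_lie]; abel
  | tmul p x =>
    induction v using PolyLie.induction_on with
    | zero => simp
    | add v₁ v₂ h₁ h₂ => rw [lie_add, map_add, h₁, h₂, map_add, lie_add, lie_add]; abel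
    | tmul q y =>
      simp only [polyDeriv_tmul, lie_tmul_tmul, derivative_mul, PolyLie.add_tmul]

/-- A faithful representation of `t ℚ[t] ⊗ 𝔤` on `(ℚ[t] ⊗ 𝔤) × ℚ`. -/
noncomputable def polyRep : PolyLie 𝔤 →ₗ[ℚ] Module.End ℚ ((PolyLie 𝔤) × ℚ) where
  toFun w :=
    { toFun := fun v => (⁅w, v.1⁆ + v.2 • polyDeriv w, 0)
      map_add' := fun v v' => by
        ext1
        · simp only [Prod.fst_add, Prod.snd_add, lie_add, add_smul]; abel
        · simp
      map_smul' := fun c v => by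
        ext1
        · simp [smul_smul]
        · simp }
  map_add' w w' := by
    refine LinearMap.ext fun v => ?_
    ext1
    · simp only [LinearMap.coe_mk, AddHom.coe_mk, LinearMap.add_apply, Prod.fst_add, add_lie,
        map_add, smul_add]
      abel
    · simp
  map_smul' c w := by
    refine LinearMap.ext fun v => ?_
    ext1
    · simp [smul_comm c]
    · simp

theorem polyRep_apply (w : PolyLie 𝔤) (v : (PolyLie 𝔤) × ℚ) :
    polyRep w v = (⁅w, v.1⁆ + v.2 • polyDeriv w, 0) := rfl

/-- The Leibniz rule for d/dt is the cocycle identity that lets ad be extended by one scalar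
coordinate. The extension remembers dw/dt, whereas ad alone forgets the centre. -/
theorem polyRep_lie (u v : PolyLie 𝔤) : polyRep ⁅u, v⁆ = ⁅polyRep u, polyRep v⁆ := by
  refine LinearMap.ext fun z => ?_
  rw [LieRing.of_associative_ring_bracket, LinearMap.sub_apply, Module.End.mul_apply,
    Module.End.mul_apply]
  simp only [polyRep_apply, polyDeriv_lie]
  ext1
  · simp only [Prod.fst_sub, lie_add, lie_smul, zero_smul, add_zero, smul_add]
    rw [leibniz_lie u v z.1, ← lie_skew (polyDeriv u) v, smul_neg]
    abel
  · simp

/-- The tensor extension of a submodule of `𝔤` to `ℚ[t] ⊗ 𝔤`. -/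
noncomputable def polySpan (W : Submodule ℚ 𝔤) : Submodule ℚ (PolyLie 𝔤) :=
  Submodule.span ℚ {t | ∃ (p : ℚ[X]) (x : 𝔤), x ∈ W ∧ t = tmul p x}

theorem polySpan_mono {W W' : Submodule ℚ 𝔤} (h : W ≤ W') : polySpan W ≤ polySpan W' :=
  Submodule.span_mono fun _ ⟨p, x, hx, ht⟩ => ⟨p, x, h hx, ht⟩

theorem mem_polySpan_top (w : PolyLie 𝔤) : w ∈ polySpan (⊤ : Submodule ℚ 𝔤) := by
  induction w using PolyLie.induction_on with
  | zero => exact zero_mem _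
  | add u v hu hv => exact add_mem hu hv
  | tmul p x => exact Submodule.subset_span ⟨p, x, trivial, rfl⟩

theorem polySpan_bot : polySpan (⊥ : Submodule ℚ 𝔤) = ⊥ := by
  rw [polySpan, Submodule.span_eq_bot]
  rintro _ ⟨p, x, hx, rfl⟩
  rw [(Submodule.mem_bot ℚ).mp hx, PolyLie.tmul_zero]

variable {N : ℕ} {G : ℕ → Submodule ℚ 𝔤}

theorem CentralFiltration.lie_mem_polySpan (hG : CentralFiltration N G) (j : ℕ)
    (u v : PolyLie 𝔤) (hv : v ∈ polySpan (G j)) : ⁅u, v⁆ ∈ polySpan (G (j + 1)) := by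
  induction hv using Submodule.span_induction with
  | zero => simp
  | add v v' _ _ h h' => rw [lie_add]; exact add_mem h h'
  | smul c v _ h => rw [lie_smul]; exact Submodule.smul_mem _ _ h
  | mem v hv =>
    obtain ⟨q, y, hy, rfl⟩ := hv
    induction u using PolyLie.induction_on with
    | zero => simp
    | add u u' h h' => rw [add_lie]; exact add_mem h h'
    | tmul p x =>
      rw [lie_tmul_tmul]
      exact Submodule.subset_span ⟨_, _, hG.lie_mem _ _ _ hy, rfl⟩

/-- The filtration of the representation space of `polyRep`. -/
noncomputable def repSpaceFiltration (G : ℕ → Submodule ℚ 𝔤) :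
    ℕ → Submodule ℚ ((PolyLie 𝔤) × ℚ)
  | 0 => ⊤
  | j + 1 => (polySpan (G j)).prod ⊥

theorem repSpaceFiltration_anti (hG : CentralFiltration N G) (i j : ℕ) (hij : i ≤ j) :
    repSpaceFiltration G j ≤ repSpaceFiltration G i := by
  rcases i with _ | i
  · exact le_top
  · obtain ⟨j, rfl⟩ : ∃ k, j = k + 1 := ⟨j - 1, by omega⟩
    exact Submodule.prod_mono (polySpan_mono (hG.anti _ _ (by omega))) le_rfl

/-- The filtration of the endomorphisms of the representation space of `polyRep`. -/
noncomputable def repFiltration (G : ℕ → Submodule ℚ 𝔤) (k : ℕ) :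
    Submodule ℚ (Module.End ℚ ((PolyLie 𝔤) × ℚ)) where
  carrier := {A | ∀ j, ∀ v ∈ repSpaceFiltration G j, A v ∈ repSpaceFiltration G (k + j)}
  add_mem' hA hB j v hv := add_mem (hA j v hv) (hB j v hv)
  zero_mem' _ _ _ := zero_mem _
  smul_mem' _ _ hA j v hv := Submodule.smul_mem _ _ (hA j v hv)

/-- The scalar coordinate adds one step above the N steps of G, so operators that raise the
filtration by N + 1 vanish. -/
theorem CentralFiltration.nilFiltration (hG : CentralFiltration N G) :
    NilFiltration N (repFiltration G) where
  mul_mem i j A B hA hB k v hv := by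
    rw [add_assoc]
    exact hA _ _ (hB _ _ hv)
  anti i j hij A hA k v hv := repSpaceFiltration_anti hG _ _ (by omega) (hA k v hv)
  eq_bot := by
    rw [eq_bot_iff]
    intro A hA
    rw [Submodule.mem_bot]
    refine LinearMap.ext fun v => ?_
    have := hA 0 v trivial
    simp only [repSpaceFiltration, hG.eq_bot, polySpan_bot, Submodule.prod_bot,
      Submodule.mem_bot] at this
    simpa using this

theorem CentralFiltration.polyRep_mem (hG : CentralFiltration N G) (w : PolyLie 𝔤) :
    polyRep w ∈ repFiltration G 1 := by
  intro j v hv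
  rw [polyRep_apply, add_comm 1 j]
  rcases j with _ | j
  · refine ⟨?_, zero_mem _⟩
    rw [hG.zero_eq]
    exact mem_polySpan_top _
  · obtain ⟨h1, h2⟩ := hv
    refine ⟨?_, zero_mem _⟩
    rw [(Submodule.mem_bot ℚ).mp h2, zero_smul, add_zero]
    exact hG.lie_mem_polySpan _ _ _ h1

/-- Evaluation of polynomials with values in `𝔤`. -/
noncomputable def polyEval (t : ℚ) : PolyLie 𝔤 →ₗ[ℚ] 𝔤 :=
  PolyLie.map ((TensorProduct.lid ℚ 𝔤).toLinearMap ∘ₗ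
    LinearMap.rTensor 𝔤 (aeval t : ℚ[X] →ₐ[ℚ] ℚ).toLinearMap)

theorem polyEval_tmul (t : ℚ) (p : ℚ[X]) (x : 𝔤) :
    polyEval t (tmul p x) = (aeval t p : ℚ) • x := by
  simp [polyEval, PolyLie.map_tmul]

theorem polyEval_lie (t : ℚ) (u v : PolyLie 𝔤) :
    polyEval t ⁅u, v⁆ = ⁅polyEval t u, polyEval t v⁆ := by
  induction u using PolyLie.induction_on with
  | zero => simp
  | add u₁ u₂ h₁ h₂ => rw [add_lie, map_add, h₁, h₂, map_add, add_lie]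
  | tmul p x =>
    induction v using PolyLie.induction_on with
    | zero => simp
    | add v₁ v₂ h₁ h₂ => rw [lie_add, map_add, h₁, h₂, map_add, lie_add]
    | tmul q y =>
      simp only [lie_tmul_tmul, polyEval_tmul, map_mul, smul_lie, lie_smul, smul_smul, mul_comm]

/-- The functional `∫₀¹` on polynomials. -/
noncomputable def unitIntegral : ℚ[X] →ₗ[ℚ] ℚ :=
  Polynomial.lsum fun n => ((n : ℚ) + 1)⁻¹ • LinearMap.id

theorem unitIntegral_derivative (p : ℚ[X]) :
    unitIntegral (derivative p) = aeval (1 : ℚ) p - aeval (0 : ℚ) p := by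
  induction p using Polynomial.induction_on' with
  | add p q hp hq => simp only [map_add, hp, hq]; ring
  | monomial n c =>
    rcases n with _ | n
    · simp
    · rw [derivative_monomial, unitIntegral, Polynomial.lsum_apply, Polynomial.sum_monomial_index]
      · have : (n : ℚ) + 1 ≠ 0 := by positivity
        simp [aeval_monomial]
        field_simp
      · simp

/-- The fundamental theorem of calculus: the difference of the end values depends on the derivative
only. -/
theorem polyEval_one_sub_zero (w : PolyLie 𝔤) :
    polyEval 1 w - polyEval 0 w =
      PolyLie.map ((TensorProduct.lid ℚ 𝔤).toLinearMap ∘ₗ LinearMap.rTensor 𝔤 unitIntegral)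
        (polyDeriv w) := by
  induction w using PolyLie.induction_on with
  | zero => simp
  | add u v hu hv => simp only [map_add, ← hu, ← hv]; abel
  | tmul p x =>
    simp [polyEval_tmul, polyDeriv_tmul, PolyLie.map_tmul, unitIntegral_derivative, sub_smul]

/-- The exponential is injective on nilpotent operators of the filtration, and the operators applied
to (0, 1) return du/dt and dv/dt. Equal derivatives and equal values at 0 give equal values at 1. -/
theorem CentralFiltration.polyEval_eq_of_exp_eq (hG : CentralFiltration N G)
    {u v : PolyLie 𝔤} (h : IsNilpotent.exp (polyRep u) = IsNilpotent.exp (polyRep v))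
    (h0 : polyEval 0 u = polyEval 0 v) : polyEval 1 u = polyEval 1 v := by
  have h1 := hG.nilFiltration.exp_injOn (hG.polyRep_mem u) (hG.polyRep_mem v) h
  have h2 : polyDeriv u = polyDeriv v := by
    have := congrArg (fun A => (A (0, 1)).1) h1
    simpa [polyRep_apply] using this
  have hu := polyEval_one_sub_zero u
  have hv := polyEval_one_sub_zero v
  rw [h2, ← hv, h0] at hu
  exact sub_left_inj.mp hu

theorem CentralFiltration.exp_polyRep_dynkinSum (hG : CentralFiltration N G)
    (u v : PolyLie 𝔤) : IsNilpotent.exp (polyRep (dynkinSum N u v)) =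
      IsNilpotent.exp (polyRep u) * IsNilpotent.exp (polyRep v) := by
  rw [map_dynkinSum polyRep polyRep_lie,
    hG.nilFiltration.exp_dynkinSum (hG.polyRep_mem u) (hG.polyRep_mem v)]

theorem polyEval_dynkinSum (t : ℚ) (n : ℕ) (u v : PolyLie 𝔤) :
    polyEval t (dynkinSum n u v) = dynkinSum n (polyEval t u) (polyEval t v) :=
  map_dynkinSum _ (polyEval_lie t) _ _ _

/-- Associativity of the Baker-Campbell-Hausdorff product. -/
theorem CentralFiltration.dynkinSum_assoc (hG : CentralFiltration N G) (x y z : 𝔤) :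
    dynkinSum N (dynkinSum N x y) z = dynkinSum N x (dynkinSum N y z) := by
  -- Work with tx, ty, tz: both products vanish at t = 0, and their exponentials agree because
  -- operators compose associatively. The value at t = 1 is the claim; the other group laws below
  -- follow in the same way.
  have := hG.polyEval_eq_of_exp_eq
    (u := dynkinSum N (dynkinSum N (tmul (X : ℚ[X]) x) (tmul X y)) (tmul X z))
    (v := dynkinSum N (tmul X x) (dynkinSum N (tmul X y) (tmul X z)))
    (by simp only [hG.exp_polyRep_dynkinSum, mul_assoc])
    (by simp [polyEval_dynkinSum, polyEval_tmul, dynkinSum_zero_zero])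
  simpa [polyEval_dynkinSum, polyEval_tmul] using this

theorem CentralFiltration.dynkinSum_zero_right (hG : CentralFiltration N G) (x : 𝔤) :
    dynkinSum N x 0 = x := by
  have := hG.polyEval_eq_of_exp_eq (u := dynkinSum N (tmul (X : ℚ[X]) x) 0) (v := tmul X x)
    (by simp [hG.exp_polyRep_dynkinSum])
    (by simp [polyEval_dynkinSum, polyEval_tmul, dynkinSum_zero_zero])
  simpa [polyEval_dynkinSum, polyEval_tmul] using this

theorem CentralFiltration.dynkinSum_zero_left (hG : CentralFiltration N G) (x : 𝔤) :
    dynkinSum N 0 x = x := by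
  have := hG.polyEval_eq_of_exp_eq (u := dynkinSum N 0 (tmul (X : ℚ[X]) x)) (v := tmul X x)
    (by simp [hG.exp_polyRep_dynkinSum])
    (by simp [polyEval_dynkinSum, polyEval_tmul, dynkinSum_zero_zero])
  simpa [polyEval_dynkinSum, polyEval_tmul] using this

theorem CentralFiltration.dynkinSum_neg_right (hG : CentralFiltration N G) (x : 𝔤) :
    dynkinSum N x (-x) = 0 := by
  have := hG.polyEval_eq_of_exp_eq (u := dynkinSum N (tmul (X : ℚ[X]) x) (-(tmul X x))) (v := 0)
    (by rw [hG.exp_polyRep_dynkinSum, map_neg, IsNilpotent.exp_mul_exp_neg_self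
          (hG.nilFiltration.isNilpotent (hG.polyRep_mem _))]; simp)
    (by simp [polyEval_dynkinSum, polyEval_tmul, dynkinSum_zero_zero])
  simpa [polyEval_dynkinSum, polyEval_tmul] using this

end PolyRep

/-! ### The group law of `bch` -/

section BCHGroup

variable {𝔤 : Type*} [RealNormedLieAlgebra 𝔤]

variable (𝔤) in
/-- The rational Lie algebra underlying a real one. -/
@[reducible] noncomputable def ratLieAlgebra : LieAlgebra ℚ 𝔤 where
  __ := Module.compHom 𝔤 (algebraMap ℚ ℝ)
  lie_smul c x y := lie_smul (algebraMap ℚ ℝ c) x y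

theorem smul_def_rat (c : ℚ) (x : 𝔤) :
    (ratLieAlgebra 𝔤).toSMul.smul c x = (c : ℝ) • x := rfl

theorem nestedBracket_eq_lieWord : ∀ l : List 𝔤, nestedBracket l = lieWord l
  | [] => rfl
  | [_] => rfl
  | x :: y :: l => by rw [nestedBracket, nestedBracket_eq_lieWord (y :: l), lieWord]

theorem bch_eq_dynkinSum (x y : 𝔤) :
    bch x y = @dynkinSum 𝔤 _ (ratLieAlgebra 𝔤) (LieModule.nilpotencyLength 𝔤 𝔤) x y := by
  let _ := ratLieAlgebra 𝔤
  rw [bch, dynkinSum]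
  refine Finset.sum_congr rfl fun k _ => Finset.sum_congr rfl fun p _ => ?_
  rw [nestedBracket_eq_lieWord, dynkinWord]
  refine Eq.trans ?_ (smul_def_rat _ _).symm
  congr 1
  simp

/-- The nilpotency length is defined through the lower central series over ℤ, which has the same
underlying sets as the one over ℝ. -/
theorem lowerCentralSeries_nilpotencyLength [LieRing.IsNilpotent 𝔤] :
    LieModule.lowerCentralSeries ℝ 𝔤 𝔤 (LieModule.nilpotencyLength 𝔤 𝔤) = ⊥ := by
  have hs : {k | LieModule.lowerCentralSeries ℤ 𝔤 𝔤 k = ⊥}.Nonempty :=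
    LieModule.IsNilpotent.nilpotent ℤ 𝔤 𝔤
  have h : LieModule.lowerCentralSeries ℤ 𝔤 𝔤 (LieModule.nilpotencyLength 𝔤 𝔤) = ⊥ :=
    Nat.sInf_mem hs
  have h2 := LieModule.coe_lowerCentralSeries_eq_int ℝ 𝔤 𝔤 (LieModule.nilpotencyLength 𝔤 𝔤)
  rw [h] at h2
  exact SetLike.coe_injective h2

theorem lie_mem_lowerCentralSeries (j : ℕ) (x y : 𝔤)
    (hy : y ∈ LieModule.lowerCentralSeries ℝ 𝔤 𝔤 j) :
    ⁅x, y⁆ ∈ LieModule.lowerCentralSeries ℝ 𝔤 𝔤 (j + 1) := by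
  rw [LieModule.lowerCentralSeries_succ]
  exact LieSubmodule.lie_mem_lie (LieSubmodule.mem_top x) hy

theorem centralFiltration_lowerCentralSeries [LieRing.IsNilpotent 𝔤] :
    letI := ratLieAlgebra 𝔤
    CentralFiltration (LieModule.nilpotencyLength 𝔤 𝔤) (fun j =>
      ({ carrier := LieModule.lowerCentralSeries ℝ 𝔤 𝔤 j
         add_mem' := fun h h' => add_mem h h'
         zero_mem' := zero_mem _
         smul_mem' := fun c _ h => (LieModule.lowerCentralSeries ℝ 𝔤 𝔤 j).smul_mem
          (algebraMap ℚ ℝ c) h } : Submodule ℚ 𝔤)) := by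
  let _ := ratLieAlgebra 𝔤
  refine ⟨?_, fun j x y hy => lie_mem_lowerCentralSeries j x y hy, fun i j hij x hx =>
    LieModule.antitone_lowerCentralSeries ℝ 𝔤 𝔤 hij hx, ?_⟩
  · ext x
    simp [← SetLike.mem_coe]
  · ext x
    simp [← SetLike.mem_coe, lowerCentralSeries_nilpotencyLength]

variable [LieRing.IsNilpotent 𝔤]

theorem bch_assoc (x y z : 𝔤) : bch (bch x y) z = bch x (bch y z) := by
  let _ := ratLieAlgebra 𝔤
  simp only [bch_eq_dynkinSum]
  exact centralFiltration_lowerCentralSeries.dynkinSum_assoc x y z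

@[simp]
theorem bch_zero (x : 𝔤) : bch x 0 = x := by
  let _ := ratLieAlgebra 𝔤
  rw [bch_eq_dynkinSum]
  exact centralFiltration_lowerCentralSeries.dynkinSum_zero_right x

@[simp]
theorem zero_bch (x : 𝔤) : bch 0 x = x := by
  let _ := ratLieAlgebra 𝔤
  rw [bch_eq_dynkinSum]
  exact centralFiltration_lowerCentralSeries.dynkinSum_zero_left x

@[simp]
theorem bch_neg_self (x : 𝔤) : bch x (-x) = 0 := by
  let _ := ratLieAlgebra 𝔤
  rw [bch_eq_dynkinSum]
  exact centralFiltration_lowerCentralSeries.dynkinSum_neg_right x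

@[simp]
theorem neg_bch_self (x : 𝔤) : bch (-x) x = 0 := by
  simpa using bch_neg_self (-x)

@[simp]
theorem bch_neg_bch (x y : 𝔤) : bch x (bch (-x) y) = y := by
  rw [← bch_assoc, bch_neg_self, zero_bch]

@[simp]
theorem neg_bch_bch (x y : 𝔤) : bch (-x) (bch x y) = y := by
  rw [← bch_assoc, neg_bch_self, zero_bch]

@[simp]
theorem bch_neg_bch_self (x y : 𝔤) : bch (bch x (-y)) y = x := by
  rw [bch_assoc, neg_bch_self, bch_zero]

theorem neg_bch (x y : 𝔤) : -(bch x y) = bch (-y) (-x) := by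
  have h : bch (bch x y) (bch (-y) (-x)) = 0 := by
    rw [bch_assoc, bch_neg_bch, bch_neg_self]
  calc -(bch x y) = bch (-(bch x y)) (bch (bch x y) (bch (-y) (-x))) := by rw [h, bch_zero]
    _ = bch (-y) (-x) := neg_bch_bch _ _

end BCHGroup

/-! ### Temperate growth of the group law and invariance of Lebesgue measure -/

section BCHGrowth

variable {𝔤 : Type*} [RealNormedLieAlgebra 𝔤]

section Growth

variable [FiniteDimensional ℝ 𝔤] {V : Type*} [NormedAddCommGroup V] [NormedSpace ℝ V]

theorem hasTemperateGrowth_lie {f g : V → 𝔤} (hf : f.HasTemperateGrowth)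
    (hg : g.HasTemperateGrowth) : (fun v => ⁅f v, g v⁆).HasTemperateGrowth := by
  let B : 𝔤 →L[ℝ] 𝔤 →L[ℝ] 𝔤 := LinearMap.toContinuousLinearMap
    (LinearMap.toContinuousLinearMap.toLinearMap ∘ₗ LinearMap.mk₂ ℝ (fun x y : 𝔤 => ⁅x, y⁆)
      add_lie smul_lie lie_add lie_smul)
  exact B.bilinear_hasTemperateGrowth hf hg

theorem hasTemperateGrowth_nestedBracket : ∀ l : List (V → 𝔤),
    (∀ f ∈ l, f.HasTemperateGrowth) →
    (fun v => nestedBracket (l.map fun f => f v)).HasTemperateGrowth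
  | [], _ => Function.HasTemperateGrowth.const _
  | [f], h => h f (by simp)
  | f :: g :: l, h => by
    have := hasTemperateGrowth_nestedBracket (g :: l) fun f hf => h f (List.mem_cons_of_mem _ hf)
    exact hasTemperateGrowth_lie (h f (by simp)) this

theorem hasTemperateGrowth_bch {f g : V → 𝔤} (hf : f.HasTemperateGrowth)
    (hg : g.HasTemperateGrowth) : (fun v => bch (f v) (g v)).HasTemperateGrowth := by
  unfold bch
  refine Function.HasTemperateGrowth.sum fun k _ => Function.HasTemperateGrowth.sum fun p _ => ?_
  refine (Function.HasTemperateGrowth.const _).smul ?_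
  have := hasTemperateGrowth_nestedBracket (dynkinWord f g p) (fun a ha => by
    rcases eq_or_eq_of_mem_dynkinWord ha with rfl | rfl <;> assumption)
  convert this using 3 with v
  exact (map_dynkinWord (fun f : V → 𝔤 => f v) f g p).symm

theorem continuous_bch : Continuous fun p : 𝔤 × 𝔤 => bch p.1 p.2 :=
  (hasTemperateGrowth_bch (ContinuousLinearMap.fst ℝ 𝔤 𝔤).hasTemperateGrowth
    (ContinuousLinearMap.snd ℝ 𝔤 𝔤).hasTemperateGrowth).1.continuous

theorem continuous_bch_comp {V : Type*} [TopologicalSpace V] {f g : V → 𝔤} (hf : Continuous f)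
    (hg : Continuous g) : Continuous fun v => bch (f v) (g v) := by
  have := continuous_bch.comp (hf.prodMk hg)
  exact this

end Growth

/-- Brackets of at least two letters change by elements of the next step of the lower central
series. -/
theorem lieWord_sub_lieWord_mem (k : ℕ) : ∀ l : List (𝔤 × 𝔤),
    (∀ p ∈ l, p.1 - p.2 ∈ LieModule.lowerCentralSeries ℝ 𝔤 𝔤 k) →
    (lieWord (l.map Prod.fst) - lieWord (l.map Prod.snd) ∈
        LieModule.lowerCentralSeries ℝ 𝔤 𝔤 k) ∧
    (2 ≤ l.length → lieWord (l.map Prod.fst) - lieWord (l.map Prod.snd) ∈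
        LieModule.lowerCentralSeries ℝ 𝔤 𝔤 (k + 1))
  | [], _ => by simp [lieWord]
  | [p], h => by simpa [lieWord] using h p (by simp)
  | p :: q :: l, h => by
    have ih := (lieWord_sub_lieWord_mem k (q :: l)
      fun p hp => h p (List.mem_cons_of_mem _ hp)).1
    have key : lieWord ((p :: q :: l).map Prod.fst) - lieWord ((p :: q :: l).map Prod.snd) ∈
        LieModule.lowerCentralSeries ℝ 𝔤 𝔤 (k + 1) := by
      have h1 : lieWord ((p :: q :: l).map Prod.fst) - lieWord ((p :: q :: l).map Prod.snd) =
          ⁅p.1, lieWord ((q :: l).map Prod.fst) - lieWord ((q :: l).map Prod.snd)⁆ -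
            ⁅lieWord ((q :: l).map Prod.snd), p.1 - p.2⁆ := by
        rw [← lie_skew _ (p.1 - p.2), lie_sub, sub_lie]
        simp only [List.map_cons, lieWord]
        abel
      rw [h1]
      exact sub_mem (lie_mem_lowerCentralSeries _ _ _ ih)
        (lie_mem_lowerCentralSeries _ _ _ (h p (by simp)))
    exact ⟨LieModule.antitone_lowerCentralSeries ℝ 𝔤 𝔤 (Nat.le_succ k) key, fun _ => key⟩

/-- For words of at least two letters both differences lie in the next step of the series; for
shorter words the two differences are equal. -/
theorem dynkinWord_sub_mem (k : ℕ) (x y v : 𝔤)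
    (hv : v ∈ LieModule.lowerCentralSeries ℝ 𝔤 𝔤 k) {n : ℕ} (p : Fin n → ℕ × ℕ) :
    lieWord (dynkinWord x (y + v) p) - lieWord (dynkinWord x y p) -
      (lieWord (dynkinWord 0 v p) - lieWord (dynkinWord 0 0 p)) ∈
        LieModule.lowerCentralSeries ℝ 𝔤 𝔤 (k + 1) := by
  have key (a b : 𝔤) : 2 ≤ (dynkinWord a b p).length →
      lieWord (dynkinWord a (b + v) p) - lieWord (dynkinWord a b p) ∈
        LieModule.lowerCentralSeries ℝ 𝔤 𝔤 (k + 1) := by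
    intro h
    have := (lieWord_sub_lieWord_mem k (dynkinWord (a, a) (b + v, b) p) (fun q hq => by
      rcases eq_or_eq_of_mem_dynkinWord hq with rfl | rfl
      · simp
      · simpa using hv)).2 (by rw [length_dynkinWord] at h ⊢; exact h)
    rwa [map_dynkinWord, map_dynkinWord] at this
  by_cases h : 2 ≤ (dynkinWord x y p).length
  · have h0 := key 0 0 (by rw [length_dynkinWord] at h ⊢; exact h)
    rw [zero_add] at h0
    exact sub_mem (key x y h) h0
  · obtain ⟨l, hl⟩ : ∃ l : List Bool, dynkinWord false true p = l := ⟨_, rfl⟩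
    have hw (a b : 𝔤) : dynkinWord a b p = l.map (fun t => bif t then b else a) := by
      rw [← hl, map_dynkinWord]; rfl
    have hlen : l.length < 2 := by
      rw [hw, List.length_map] at h; omega
    rw [hw, hw, hw, hw]
    match l, hlen with
    | [], _ => simp [lieWord]
    | [true], _ => simp [lieWord]
    | [false], _ => simp [lieWord]

theorem bch_add_sub_mem [LieRing.IsNilpotent 𝔤] (k : ℕ) (x y v : 𝔤)
    (hv : v ∈ LieModule.lowerCentralSeries ℝ 𝔤 𝔤 k) :
    bch x (y + v) - bch x y - v ∈ LieModule.lowerCentralSeries ℝ 𝔤 𝔤 (k + 1) := by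
  -- Writing v as 0 • v - 0 • 0 allows a comparison of the two Dynkin sums term by term.
  have h : bch x (y + v) - bch x y - v =
      bch x (y + v) - bch x y - (bch 0 v - bch 0 0) := by simp
  rw [h]
  simp only [bch, ← Finset.sum_sub_distrib, ← smul_sub, nestedBracket_eq_lieWord]
  exact sum_mem fun n _ => sum_mem fun p _ =>
    (LieModule.lowerCentralSeries ℝ 𝔤 𝔤 (k + 1)).smul_mem _ (dynkinWord_sub_mem k x y v hv p)

/-- The characteristic polynomial of -A is a power of X; its value at 1 is the determinant. -/
theorem det_one_add_of_isNilpotent {V : Type*} [AddCommGroup V] [Module ℝ V]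
    [FiniteDimensional ℝ V] {A : V →ₗ[ℝ] V} (hA : IsNilpotent A) : (1 + A).det = 1 := by
  have h := hA.neg.charpoly_eq_X_pow_finrank
  have h2 := congrArg (Polynomial.eval 1) h
  rw [LinearMap.eval_charpoly] at h2
  simpa using h2

variable [FiniteDimensional ℝ 𝔤] [LieRing.IsNilpotent 𝔤]

omit [LieRing.IsNilpotent 𝔤] in
theorem hasFDerivAt_bch (x y : 𝔤) : HasFDerivAt (bch x) (fderiv ℝ (bch x) y) y := by
  have := (hasTemperateGrowth_bch (𝔤 := 𝔤) (Function.HasTemperateGrowth.const x)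
    (.id' : (fun y : 𝔤 => y).HasTemperateGrowth)).1.differentiable (by simp)
  exact (this y).hasFDerivAt

/-- The difference quotients satisfy the relation by `bch_add_sub_mem`, and subspaces of a
finite-dimensional space are closed. -/
theorem fderiv_bch_sub_mem (k : ℕ) (x y v : 𝔤)
    (hv : v ∈ LieModule.lowerCentralSeries ℝ 𝔤 𝔤 k) :
    fderiv ℝ (bch x) y v - v ∈ LieModule.lowerCentralSeries ℝ 𝔤 𝔤 (k + 1) := by
  have h := (hasFDerivAt_bch x y).hasLineDerivAt v
  have h1 := h.tendsto_slope_zero.sub_const v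
  have hc : IsClosed (LieModule.lowerCentralSeries ℝ 𝔤 𝔤 (k + 1) : Set 𝔤) :=
    (LieModule.lowerCentralSeries ℝ 𝔤 𝔤 (k + 1)).toSubmodule.closed_of_finiteDimensional
  refine hc.mem_of_tendsto h1 ?_
  filter_upwards [self_mem_nhdsWithin] with t ht
  have := (LieModule.lowerCentralSeries ℝ 𝔤 𝔤 (k + 1)).smul_mem t⁻¹
    (bch_add_sub_mem k x y (t • v) ((LieModule.lowerCentralSeries ℝ 𝔤 𝔤 k).smul_mem t hv))
  rw [smul_sub, inv_smul_smul₀ ht] at this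
  simpa using this

/-- The derivative minus the identity pushes each step of the lower central series into the next
one, hence is nilpotent. -/
theorem det_fderiv_bch (x y : 𝔤) : (fderiv ℝ (bch x) y).det = 1 := by
  have h : IsNilpotent ((fderiv ℝ (bch x) y : 𝔤 →ₗ[ℝ] 𝔤) - 1) := by
    refine ⟨LieModule.nilpotencyLength 𝔤 𝔤, LinearMap.ext fun v => ?_⟩
    have key (n : ℕ) : (((fderiv ℝ (bch x) y : 𝔤 →ₗ[ℝ] 𝔤) - 1) ^ n) v ∈
        LieModule.lowerCentralSeries ℝ 𝔤 𝔤 n := by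
      induction n with
      | zero => simp
      | succ n ih =>
        rw [pow_succ', Module.End.mul_apply]
        exact fderiv_bch_sub_mem n x y _ ih
    have := key (LieModule.nilpotencyLength 𝔤 𝔤)
    rw [lowerCentralSeries_nilpotencyLength] at this
    simpa using this
  have := det_one_add_of_isNilpotent h
  rwa [add_sub_cancel] at this

variable [MeasurableSpace 𝔤] [BorelSpace 𝔤] (μ : Measure 𝔤) [μ.IsAddHaarMeasure]

/-- Left translations preserve Lebesgue measure. -/
theorem measurePreserving_bch_left (x : 𝔤) : MeasurePreserving (bch x) μ μ := by
  have hc : Continuous (bch x) := continuous_bch_comp continuous_const continuous_id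
  refine ⟨hc.measurable, ?_⟩
  have hinj : Function.Injective (bch x) := fun y z h => by
    rw [← neg_bch_bch x y, h, neg_bch_bch]
  have hr : Set.range (bch x) = Set.univ := by
    refine Set.range_eq_univ.mpr fun y => ⟨bch (-x) y, bch_neg_bch x y⟩
  have := map_withDensity_abs_det_fderiv_eq_addHaar μ MeasurableSet.univ.nullMeasurableSet
    (fun y _ => (hasFDerivAt_bch x y).hasFDerivWithinAt) hinj.injOn
  simp only [det_fderiv_bch, Set.image_univ, hr, Measure.restrict_univ, abs_one,
    ENNReal.ofReal_one] at this
  exact (congrArg (Measure.map (bch x)) withDensity_one).symm.trans this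

/-- Right translations preserve Lebesgue measure. -/
theorem measurePreserving_bch_right (y : 𝔤) : MeasurePreserving (fun x => bch x y) μ μ := by
  -- Right translation by y is left translation by -y conjugated with the group inversion X ↦ -X.
  have h1 := Measure.measurePreserving_neg μ
  have h := (h1.comp (measurePreserving_bch_left μ (-y))).comp h1
  convert h using 1
  ext x
  simp [neg_bch]

end BCHGrowth

/-! ### The character e^{it} -/

section Phase

/-- The character `t ↦ e^{it}`. -/
noncomputable def expI (t : ℝ) : ℂ := Complex.exp (Complex.I * t)

@[simp] theorem norm_expI (t : ℝ) : ‖expI t‖ = 1 := by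
  rw [expI, mul_comm, Complex.norm_exp_ofReal_mul_I]

@[simp] theorem expI_zero : expI 0 = 1 := by simp [expI]

@[simp] theorem conj_expI (t : ℝ) : conj (expI t) = expI (-t) := by
  simp [expI, ← Complex.exp_conj]

theorem hasDerivAt_expI (t : ℝ) : HasDerivAt expI (Complex.I * expI t) t := by
  have h := ((Complex.ofRealCLM.hasDerivAt (x := t)).const_mul Complex.I).cexp
  have h2 : HasDerivAt expI (Complex.exp (Complex.I * t) * (Complex.I * 1)) t := h
  exact h2.congr_deriv (by rw [expI]; ring)

theorem hasTemperateGrowth_expI : expI.HasTemperateGrowth := by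
  have hd (n : ℕ) : iteratedDeriv n expI = fun t => Complex.I ^ n * expI t := by
    induction n with
    | zero => simp
    | succ n ih =>
      rw [iteratedDeriv_succ, ih]
      funext t
      rw [((hasDerivAt_expI t).const_mul _).deriv]
      ring
  refine ⟨?_, fun n => ⟨0, 1, fun t => ?_⟩⟩
  · unfold expI
    exact (contDiff_const.mul Complex.ofRealCLM.contDiff).cexp
  · rw [norm_iteratedFDeriv_eq_norm_iteratedDeriv, hd]
    simp

variable {V : Type*} [NormedAddCommGroup V] [NormedSpace ℝ V]

theorem hasTemperateGrowth_expI_comp {f : V → ℝ} (hf : f.HasTemperateGrowth) :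
    (fun v => expI (f v)).HasTemperateGrowth :=
  hasTemperateGrowth_expI.comp hf

end Phase

/-! ### Slices of Schwartz functions on a product -/

section Slices

variable {A E F : Type*} [NormedAddCommGroup A] [NormedSpace ℝ A] [NormedAddCommGroup E]
  [NormedSpace ℝ E] [NormedAddCommGroup F] [NormedSpace ℝ F]

theorem hasTemperateGrowth_prodMk {V : Type*} [NormedAddCommGroup V] [NormedSpace ℝ V]
    {f : V → A} {g : V → E} (hf : f.HasTemperateGrowth) (hg : g.HasTemperateGrowth) :
    (fun v => (f v, g v)).HasTemperateGrowth := by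
  have h := ((ContinuousLinearMap.inl ℝ A E).hasTemperateGrowth.comp hf).add
    ((ContinuousLinearMap.inr ℝ A E).hasTemperateGrowth.comp hg)
  convert h using 1
  ext v <;> simp

theorem hasTemperateGrowth_fst {V : Type*} [NormedAddCommGroup V] [NormedSpace ℝ V]
    {f : V → A × E} (hf : f.HasTemperateGrowth) : (fun v => (f v).1).HasTemperateGrowth :=
  (ContinuousLinearMap.fst ℝ A E).hasTemperateGrowth.comp hf

theorem hasTemperateGrowth_snd {V : Type*} [NormedAddCommGroup V] [NormedSpace ℝ V]
    {f : V → A × E} (hf : f.HasTemperateGrowth) : (fun v => (f v).2).HasTemperateGrowth :=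
  (ContinuousLinearMap.snd ℝ A E).hasTemperateGrowth.comp hf

/-- The Schwartz function `ψ(a, ·)`. -/
noncomputable def sliceRight (a : A) : 𝓢(A × E, F) →L[ℝ] 𝓢(E, F) :=
  SchwartzMap.compCLM ℝ (g := fun y : E => (a, y))
    (hasTemperateGrowth_prodMk (.const a) .id')
    ⟨1, 1, fun y => by
      have : ‖y‖ ≤ ‖(a, y)‖ := le_max_right _ _
      linarith⟩

@[simp] theorem sliceRight_apply (a : A) (ψ : 𝓢(A × E, F)) (y : E) :
    sliceRight a ψ y = ψ (a, y) := rfl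

/-- The Schwartz function `ψ(·, y)`. -/
noncomputable def sliceLeft (y : E) : 𝓢(A × E, F) →L[ℝ] 𝓢(A, F) :=
  SchwartzMap.compCLM ℝ (g := fun a : A => (a, y))
    (hasTemperateGrowth_prodMk .id' (.const y))
    ⟨1, 1, fun a => by
      have : ‖a‖ ≤ ‖(a, y)‖ := le_max_left _ _
      linarith⟩

@[simp] theorem sliceLeft_apply (y : E) (ψ : 𝓢(A × E, F)) (a : A) :
    sliceLeft y ψ a = ψ (a, y) := rfl

/-- The weight of order k + r is split into k powers for a and r powers for y. The decay in y is
uniform in a, which gives the dominating functions for integrals over y. -/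
theorem pow_mul_norm_slice_le (ψ : 𝓢(A × E, F)) (k r n : ℕ) (a : A) (y : E) :
    ‖a‖ ^ k * ‖iteratedFDeriv ℝ n ψ (a, y)‖ ≤ 2 ^ (k + r) *
      (Finset.Iic (k + r, n)).sup (schwartzSeminormFamily ℝ (A × E) F) ψ *
        (1 + ‖y‖) ^ (-(r : ℝ)) := by
  have h := SchwartzMap.one_add_le_sup_seminorm_apply (𝕜 := ℝ) (m := (k + r, n)) le_rfl le_rfl
    ψ (a, y)
  have ha : ‖a‖ ≤ 1 + ‖(a, y)‖ := (le_max_left _ _).trans (le_add_of_nonneg_left zero_le_one)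
  have hy : 1 + ‖y‖ ≤ 1 + ‖(a, y)‖ := add_le_add_right (le_max_right _ _) _
  rw [Real.rpow_neg (by positivity), Real.rpow_natCast, ← div_eq_mul_inv,
    le_div_iff₀ (by positivity)]
  calc ‖a‖ ^ k * ‖iteratedFDeriv ℝ n ψ (a, y)‖ * (1 + ‖y‖) ^ r
      = (‖a‖ ^ k * (1 + ‖y‖) ^ r) * ‖iteratedFDeriv ℝ n ψ (a, y)‖ := by ring
    _ ≤ ((1 + ‖(a, y)‖) ^ k * (1 + ‖(a, y)‖) ^ r) * ‖iteratedFDeriv ℝ n ψ (a, y)‖ := by gcongr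
    _ ≤ _ := by rw [← pow_add]; exact h

theorem norm_slice_le (ψ : 𝓢(A × E, F)) (k r : ℕ) (a : A) (y : E) :
    ‖a‖ ^ k * ‖ψ (a, y)‖ ≤ 2 ^ (k + r) *
      (Finset.Iic (k + r, 0)).sup (schwartzSeminormFamily ℝ (A × E) F) ψ *
        (1 + ‖y‖) ^ (-(r : ℝ)) := by
  simpa using pow_mul_norm_slice_le ψ k r 0 a y

end Slices

/-! ### Partial Fourier integrals and their derivatives -/

section PartialFourier

variable {A E W F : Type*} [NormedAddCommGroup A] [NormedSpace ℝ A] [NormedAddCommGroup E]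
  [NormedSpace ℝ E] [NormedAddCommGroup W] [NormedSpace ℝ W] [NormedAddCommGroup F]
  [NormedSpace ℝ F] [NormedSpace ℂ F] [IsScalarTower ℝ ℂ F] [SMulCommClass ℝ ℂ F]
  [MeasurableSpace E] (μ : Measure E) (β : E →L[ℝ] W →L[ℝ] ℝ)

/-- The partial Fourier integral with phase `β`. -/
noncomputable def fourierFun (ψ : 𝓢(A × E, F)) (p : A × W) : F :=
  ∫ y, expI (β y p.2) • ψ (p.1, y) ∂μ

/-- The integrand of the derivative of the partial Fourier integral. -/
noncomputable def fourierDeriv : 𝓢(A × E, F) →L[ℝ] 𝓢(A × E, (A × W) →L[ℝ] F) :=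
  SchwartzMap.postcompCLM ((ContinuousLinearMap.compL ℝ (A × W) (A × E) F).flip
      ((ContinuousLinearMap.inl ℝ A E).comp (ContinuousLinearMap.fst ℝ A W))) ∘L
    SchwartzMap.fderivCLM ℝ (A × E) F +
  (SchwartzMap.bilinLeftCLM
    (ContinuousLinearMap.smulRightL ℝ (A × W) F).flip
    ((((ContinuousLinearMap.compL ℝ (A × W) W ℝ).flip
      (ContinuousLinearMap.snd ℝ A W)).comp
        (β.comp (ContinuousLinearMap.snd ℝ A E))).hasTemperateGrowth)) ∘L
  SchwartzMap.postcompCLM (Complex.I • ContinuousLinearMap.id ℝ F)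

theorem fourierDeriv_apply (ψ : 𝓢(A × E, F)) (p : A × E) :
    fourierDeriv β ψ p = (fderiv ℝ ψ p).comp
      ((ContinuousLinearMap.inl ℝ A E).comp (ContinuousLinearMap.fst ℝ A W)) +
        ((β p.2).comp (ContinuousLinearMap.snd ℝ A W)).smulRight (Complex.I • ψ p) := by
  refine ContinuousLinearMap.ext fun v => ?_
  simp [fourierDeriv]

theorem hasFDerivAt_fourier_integrand (ψ : 𝓢(A × E, F)) (y : E) (p : A × W) :
    HasFDerivAt (fun p : A × W => expI (β y p.2) • ψ (p.1, y))
      (expI (β y p.2) • fourierDeriv β ψ (p.1, y)) p := by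
  have h1 : HasFDerivAt (fun p : A × W => ψ (p.1, y)) ((fderiv ℝ ψ (p.1, y)).comp
      ((ContinuousLinearMap.inl ℝ A E).comp (ContinuousLinearMap.fst ℝ A W))) p := by
    have h0 : HasFDerivAt (fun p : A × W => (p.1, y))
        ((ContinuousLinearMap.inl ℝ A E).comp (ContinuousLinearMap.fst ℝ A W)) p := by
      refine ((hasFDerivAt_fst (𝕜 := ℝ) (p := p)).prodMk (hasFDerivAt_const y p)).congr_fderiv ?_
      exact ContinuousLinearMap.ext fun v => by simp
    exact (ψ.hasFDerivAt (p.1, y)).comp p h0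
  have h2 : HasFDerivAt (fun p : A × W => expI (β y p.2))
      (((β y).comp (ContinuousLinearMap.snd ℝ A W)).smulRight
        (Complex.I * expI (β y p.2))) p := by
    refine ((hasDerivAt_expI (β y p.2)).hasFDerivAt.comp p
      ((β y).comp (ContinuousLinearMap.snd ℝ A W)).hasFDerivAt).congr_fderiv ?_
    exact ContinuousLinearMap.ext fun v => by simp
  refine (h2.smul h1).congr_fderiv (ContinuousLinearMap.ext fun v => ?_)
  rw [fourierDeriv_apply]
  simp only [smul_apply, add_apply, smul_add,
    ContinuousLinearMap.smulRight_apply]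
  rw [← algebraMap_smul ℂ (((β y).comp (ContinuousLinearMap.snd ℝ A W)) v) (Complex.I • _),
    smul_smul, smul_smul]
  congr 2
  simp only [Complex.real_smul, Complex.coe_algebraMap]
  ring

variable [FiniteDimensional ℝ E] [BorelSpace E] [μ.IsAddHaarMeasure]

omit [NormedSpace ℂ F] [IsScalarTower ℝ ℂ F] [SMulCommClass ℝ ℂ F] in
theorem integrable_slice (ψ : 𝓢(A × E, F)) (a : A) : Integrable (fun y => ψ (a, y)) μ :=
  (sliceRight a ψ).integrable

omit [IsScalarTower ℝ ℂ F] [SMulCommClass ℝ ℂ F] in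
theorem integrable_fourier (ψ : 𝓢(A × E, F)) (p : A × W) :
    Integrable (fun y => expI (β y p.2) • ψ (p.1, y)) μ := by
  refine (integrable_slice μ ψ p.1).bdd_smul 1 ?_ ?_
  · exact (hasTemperateGrowth_expI.1.continuous.comp (by fun_prop)).aestronglyMeasurable
  · exact Filter.Eventually.of_forall fun y => by simp

/-- The derivative is again a partial Fourier integral of a Schwartz function, with values in a
larger space. Admitting general values F makes the step repeatable. -/
theorem hasFDerivAt_fourierFun (ψ : 𝓢(A × E, F)) (p : A × W) :
    HasFDerivAt (fourierFun μ β ψ) (fourierFun μ β (fourierDeriv β ψ) p) p := by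
  refine hasFDerivAt_integral_of_dominated_of_fderiv_le (Filter.univ_mem)
    (Filter.Eventually.of_forall fun p => (integrable_fourier μ β ψ p).aestronglyMeasurable)
    (integrable_fourier μ β ψ p) (integrable_fourier μ β (fourierDeriv β ψ) p).aestronglyMeasurable
    (Filter.Eventually.of_forall fun y q _ => ?_)
    ((Measure.integrable_pow_neg_integrablePower μ).const_mul (2 ^ (0 + μ.integrablePower) *
      (Finset.Iic (0 + μ.integrablePower, 0)).sup (schwartzSeminormFamily ℝ (A × E) _)
        (fourierDeriv β ψ)))
    (Filter.Eventually.of_forall fun y q _ => hasFDerivAt_fourier_integrand β ψ y q)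
  rw [norm_smul, norm_expI, one_mul]
  simpa using norm_slice_le (fourierDeriv β ψ) 0 μ.integrablePower q.1 y

end PartialFourier

/-! ### Decay of partial Fourier integrals -/

section PartialFourierDecay

theorem continuous_finset_sup_seminorm {V F : Type*} [NormedAddCommGroup V] [NormedSpace ℝ V]
    [NormedAddCommGroup F] [NormedSpace ℝ F] (s : Finset (ℕ × ℕ)) :
    Continuous fun ψ : 𝓢(V, F) => s.sup (schwartzSeminormFamily ℝ V F) ψ := by
  induction s using Finset.induction_on with
  | empty => simpa using continuous_const
  | insert i s _ ih =>
    rw [Finset.sup_insert]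
    exact ((schwartz_withSeminorms ℝ V F).continuous_seminorm i).max ih

variable {A E W F : Type*} [NormedAddCommGroup A] [NormedSpace ℝ A] [NormedAddCommGroup E]
  [NormedSpace ℝ E] [NormedAddCommGroup W] [NormedSpace ℝ W] [NormedAddCommGroup F]
  [NormedSpace ℝ F] [NormedSpace ℂ F] [IsScalarTower ℝ ℂ F] [SMulCommClass ℝ ℂ F]
  [MeasurableSpace E] (μ : Measure E) (β : E →L[ℝ] W →L[ℝ] ℝ)
  [FiniteDimensional ℝ E] [BorelSpace E] [μ.IsAddHaarMeasure]

theorem norm_fourierFun_le_integral (ψ : 𝓢(A × E, F)) (p : A × W) :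
    ‖fourierFun μ β ψ p‖ ≤ ∫ y, ‖ψ (p.1, y)‖ ∂μ := by
  refine (norm_integral_le_integral_norm _).trans (le_of_eq ?_)
  simp [norm_smul]

variable (A F) in
/-- The constant of the decay estimates of partial Fourier integrals. -/
theorem exists_pow_mul_norm_fourierFun_le_left (k : ℕ) : ∃ (s : Finset (ℕ × ℕ)) (C : ℝ), 0 ≤ C ∧
    ∀ (ψ : 𝓢(A × E, F)) (p : A × W), ‖p.1‖ ^ k * ‖fourierFun μ β ψ p‖ ≤
      C * s.sup (schwartzSeminormFamily ℝ (A × E) F) ψ := by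
  refine ⟨Finset.Iic (k + μ.integrablePower, 0), 2 ^ (k + μ.integrablePower) *
    ∫ y, (1 + ‖y‖) ^ (-(μ.integrablePower : ℝ)) ∂μ, ?_, fun ψ p => ?_⟩
  · exact mul_nonneg (by positivity) (integral_nonneg fun y => by positivity)
  calc ‖p.1‖ ^ k * ‖fourierFun μ β ψ p‖ ≤ ‖p.1‖ ^ k * ∫ y, ‖ψ (p.1, y)‖ ∂μ := by
        gcongr; exact norm_fourierFun_le_integral μ β ψ p
    _ = ∫ y, ‖p.1‖ ^ k * ‖ψ (p.1, y)‖ ∂μ := (integral_const_mul _ _).symm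
    _ ≤ ∫ y, 2 ^ (k + μ.integrablePower) *
      (Finset.Iic (k + μ.integrablePower, 0)).sup (schwartzSeminormFamily ℝ (A × E) F) ψ *
        (1 + ‖y‖) ^ (-(μ.integrablePower : ℝ)) ∂μ := by
      refine integral_mono_of_nonneg (Filter.Eventually.of_forall fun y => by positivity)
        ((Measure.integrable_pow_neg_integrablePower μ).const_mul _)
        (Filter.Eventually.of_forall fun y => norm_slice_le ψ k μ.integrablePower p.1 y)
    _ = _ := by rw [integral_const_mul]; ring

/-- Integration by parts in the direction v. -/
theorem phase_mul_fourierFun (ψ : 𝓢(A × E, F)) (v : E) (p : A × W) :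
    ((β v p.2 : ℝ) : ℂ) • fourierFun μ β ψ p =
      Complex.I • fourierFun μ β (LineDeriv.lineDerivOp ((0, v) : A × E) ψ) p := by
  have hint := integrable_fourier μ β ψ p
  have hsl (y : E) : HasLineDerivAt ℝ (fun y => ψ (p.1, y))
      (LineDeriv.lineDerivOp ((0, v) : A × E) ψ (p.1, y)) y v := by
    have h1 := (sliceRight p.1 ψ).hasFDerivAt y
    have h2 : HasFDerivAt (fun y => ψ (p.1, y))
        ((fderiv ℝ ψ (p.1, y)).comp (ContinuousLinearMap.inr ℝ A E)) y := by
      refine (ψ.hasFDerivAt (p.1, y)).comp y ?_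
      exact hasFDerivAt_prodMk_right p.1 y
    have h3 := h2.hasLineDerivAt v
    simpa [SchwartzMap.lineDerivOp_apply_eq_fderiv] using h3
  have hph (y : E) : HasLineDerivAt ℝ (fun y => expI (β y p.2))
      (((β v p.2 : ℝ) : ℂ) * (Complex.I * expI (β y p.2))) y v := by
    have h := (hasDerivAt_expI (β y p.2)).hasFDerivAt.comp y (β.flip p.2).hasFDerivAt
    have h2 : HasFDerivAt (fun y => expI (β y p.2)) _ y := h
    have h3 := h2.hasLineDerivAt v
    simpa [mul_comm, mul_assoc] using h3
  have key := integral_bilinear_hasLineDerivAt_right_eq_neg_left_of_integrable (μ := μ)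
    (f := fun y => expI (β y p.2))
    (f' := fun y => ((β v p.2 : ℝ) : ℂ) * (Complex.I * expI (β y p.2)))
    (g := fun y => ψ (p.1, y)) (g' := fun y => LineDeriv.lineDerivOp ((0, v) : A × E) ψ (p.1, y))
    (v := v) (B := ContinuousLinearMap.lsmul ℝ ℂ)
    (by
      have := (hint.smul Complex.I).smul (((β v p.2 : ℝ) : ℂ))
      simpa [smul_smul, Pi.smul_def, mul_assoc] using this)
    (by simpa using integrable_fourier μ β (LineDeriv.lineDerivOp ((0, v) : A × E) ψ) p)
    (by simpa using hint) (fun y _ => hph y) (fun y _ => hsl y)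
  simp only [ContinuousLinearMap.lsmul_apply] at key
  unfold fourierFun
  rw [key, ← integral_smul, smul_neg, ← integral_smul, ← integral_neg]
  congr 1
  funext y
  rw [smul_smul, smul_smul, ← neg_smul]
  congr 1
  linear_combination ((β v p.2 : ℝ) : ℂ) * expI (β y p.2) * Complex.I_sq

theorem abs_phase_mul_norm_fourierFun (ψ : 𝓢(A × E, F)) (v : E) (p : A × W) :
    |β v p.2| * ‖fourierFun μ β ψ p‖ =
      ‖fourierFun μ β (LineDeriv.lineDerivOp ((0, v) : A × E) ψ) p‖ := by
  have h := congrArg norm (phase_mul_fourierFun μ β ψ v p)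
  rwa [norm_smul, norm_smul, Complex.norm_I, one_mul, Complex.norm_real, Real.norm_eq_abs] at h

-- By nondegeneracy ‖w‖ is bounded by the pairings of w with the finitely many basis vectors of E,
-- and each such pairing is traded for a derivative of ψ. Thus every power of ‖w‖ costs one
-- derivative.
variable (A F) in
theorem exists_pow_mul_norm_fourierFun_le_right [FiniteDimensional ℝ W]
    (hβ : ∀ w, (∀ v, β v w = 0) → w = 0) (k : ℕ) : ∃ (s : Finset (ℕ × ℕ)) (C : ℝ), 0 ≤ C ∧
    ∀ (ψ : 𝓢(A × E, F)) (p : A × W), ‖p.2‖ ^ k * ‖fourierFun μ β ψ p‖ ≤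
      C * s.sup (schwartzSeminormFamily ℝ (A × E) F) ψ := by
  let b := Module.finBasis ℝ E
  obtain ⟨K, hK0, hK⟩ : ∃ K : ℝ, 0 ≤ K ∧ ∀ w, ‖w‖ ≤ K * ∑ j, |β (b j) w| := by
    let T : W →ₗ[ℝ] (Fin (Module.finrank ℝ E) → ℝ) := LinearMap.pi fun j => (β (b j)).toLinearMap
    have hT : LinearMap.ker T = ⊥ := by
      refine LinearMap.ker_eq_bot'.mpr fun w hw => hβ w fun v => ?_
      have h0 : (β.flip w).toLinearMap = 0 := b.ext fun j => congrFun hw j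
      exact LinearMap.congr_fun h0 v
    obtain ⟨K, _, hK⟩ := T.exists_antilipschitzWith hT
    refine ⟨K, K.2, fun w => ?_⟩
    have h := hK.le_mul_dist w 0
    rw [dist_zero_right, map_zero, dist_zero_right] at h
    refine h.trans ?_
    gcongr
    refine (pi_norm_le_iff_of_nonneg (Finset.sum_nonneg fun _ _ => abs_nonneg _)).mpr fun j => ?_
    exact Finset.single_le_sum (f := fun j => |β (b j) w|) (fun _ _ => abs_nonneg _)
      (Finset.mem_univ j)
  induction k with
  | zero => simpa using exists_pow_mul_norm_fourierFun_le_left A F μ β 0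
  | succ k ih =>
    obtain ⟨s, C, hC, h⟩ := ih
    let D (j : Fin (Module.finrank ℝ E)) : 𝓢(A × E, F) →L[ℝ] 𝓢(A × E, F) :=
      LineDeriv.lineDerivOpCLM ℝ 𝓢(A × E, F) ((0, b j) : A × E)
    let q : Seminorm ℝ 𝓢(A × E, F) :=
      ∑ j, (s.sup (schwartzSeminormFamily ℝ (A × E) F)).comp (D j).toLinearMap
    have hq (ψ : 𝓢(A × E, F)) : q ψ = ∑ j, s.sup (schwartzSeminormFamily ℝ (A × E) F) (D j ψ) := by
      simp only [q, sum_apply]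
      rfl
    have hcont : Continuous q := by
      have : ⇑q = fun ψ => ∑ j, s.sup (schwartzSeminormFamily ℝ (A × E) F) (D j ψ) := funext hq
      rw [this]
      exact continuous_finsetSum _ fun j _ =>
        (continuous_finset_sup_seminorm s).comp (D j).continuous
    obtain ⟨s', C', _, h'⟩ := Seminorm.bound_of_continuous (schwartz_withSeminorms ℝ (A × E) F)
      _ hcont
    refine ⟨s', K * C * C', by positivity, fun ψ p => ?_⟩
    calc ‖p.2‖ ^ (k + 1) * ‖fourierFun μ β ψ p‖
        ≤ ‖p.2‖ ^ k * (K * ∑ j, |β (b j) p.2|) * ‖fourierFun μ β ψ p‖ := by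
          rw [pow_succ]; gcongr; exact hK _
      _ = K * ∑ j, ‖p.2‖ ^ k * (|β (b j) p.2| * ‖fourierFun μ β ψ p‖) := by
          simp only [Finset.mul_sum, Finset.sum_mul]
          exact Finset.sum_congr rfl fun j _ => by ring
      _ ≤ K * ∑ j, C * s.sup (schwartzSeminormFamily ℝ (A × E) F) (D j ψ) := by
          refine mul_le_mul_of_nonneg_left (Finset.sum_le_sum fun j _ => ?_) hK0
          rw [abs_phase_mul_norm_fourierFun]
          exact h _ p
      _ = K * C * q ψ := by rw [← Finset.mul_sum, hq]; ring
      _ ≤ K * C * (C' * s'.sup (schwartzSeminormFamily ℝ (A × E) F) ψ) := by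
          gcongr; exact h' ψ
      _ = _ := by ring

variable (A F) in
theorem exists_pow_mul_norm_fourierFun_le [FiniteDimensional ℝ W]
    (hβ : ∀ w, (∀ v, β v w = 0) → w = 0) (k : ℕ) : ∃ (s : Finset (ℕ × ℕ)) (C : ℝ), 0 ≤ C ∧
    ∀ (ψ : 𝓢(A × E, F)) (p : A × W), ‖p‖ ^ k * ‖fourierFun μ β ψ p‖ ≤
      C * s.sup (schwartzSeminormFamily ℝ (A × E) F) ψ := by
  obtain ⟨s, C, hC, h⟩ := exists_pow_mul_norm_fourierFun_le_left A F μ β k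
  obtain ⟨s', C', hC', h'⟩ := exists_pow_mul_norm_fourierFun_le_right A F μ β hβ k
  refine ⟨s ∪ s', C + C', by positivity, fun ψ p => ?_⟩
  have h1 : s.sup (schwartzSeminormFamily ℝ (A × E) F) ψ ≤
      (s ∪ s').sup (schwartzSeminormFamily ℝ (A × E) F) ψ :=
    Finset.sup_mono (f := schwartzSeminormFamily ℝ (A × E) F) Finset.subset_union_left ψ
  have h2 : s'.sup (schwartzSeminormFamily ℝ (A × E) F) ψ ≤
      (s ∪ s').sup (schwartzSeminormFamily ℝ (A × E) F) ψ :=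
    Finset.sup_mono (f := schwartzSeminormFamily ℝ (A × E) F) Finset.subset_union_right ψ
  have h0 : 0 ≤ (s ∪ s').sup (schwartzSeminormFamily ℝ (A × E) F) ψ := apply_nonneg _ _
  rcases le_total ‖p.1‖ ‖p.2‖ with hp | hp
  · rw [Prod.norm_def, max_eq_right hp]
    refine (h' ψ p).trans ?_
    nlinarith
  · rw [Prod.norm_def, max_eq_left hp]
    refine (h ψ p).trans ?_
    nlinarith

end PartialFourierDecay

/-! ### Partial Fourier transforms and fibre integrals as continuous maps -/

section PartialFourierCLM

variable {A E W F G : Type*} [NormedAddCommGroup A] [NormedSpace ℝ A] [NormedAddCommGroup E]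
  [NormedSpace ℝ E] [NormedAddCommGroup W] [NormedSpace ℝ W] [NormedAddCommGroup F]
  [NormedSpace ℝ F] [NormedSpace ℂ F] [IsScalarTower ℝ ℂ F] [SMulCommClass ℝ ℂ F]
  [NormedAddCommGroup G]
  [NormedSpace ℝ G] [NormedSpace ℂ G] [IsScalarTower ℝ ℂ G] [SMulCommClass ℝ ℂ G]
  [MeasurableSpace E] (μ : Measure E) (β : E →L[ℝ] W →L[ℝ] ℝ)
  [FiniteDimensional ℝ E] [BorelSpace E] [μ.IsAddHaarMeasure]

theorem fourierFun_postcompCLM [CompleteSpace F] [CompleteSpace G] (L : F →L[ℝ] G)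
    (hL : ∀ (c : ℂ) (x : F), L (c • x) = c • L x) (ψ : 𝓢(A × E, F)) (p : A × W) :
    fourierFun μ β (SchwartzMap.postcompCLM L ψ) p = L (fourierFun μ β ψ p) := by
  rw [fourierFun, fourierFun, ← L.integral_comp_comm (integrable_fourier μ β ψ p)]
  simp [hL]

/-- The integrands of the iterated derivatives of the partial Fourier integral. -/
noncomputable def fourierDerivs : (n : ℕ) →
    𝓢(A × E, ℂ) →L[ℝ] 𝓢(A × E, ContinuousMultilinearMap ℝ (fun _ : Fin n => A × W) ℂ)
  | 0 => SchwartzMap.postcompCLM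
      ((continuousMultilinearCurryFin0 ℝ (A × W) ℂ).symm.toContinuousLinearEquiv :
        ℂ →L[ℝ] ContinuousMultilinearMap ℝ (fun _ : Fin 0 => A × W) ℂ)
  | n + 1 => SchwartzMap.postcompCLM
      ((continuousMultilinearCurryLeftEquiv ℝ
        (fun _ : Fin (n + 1) => A × W) ℂ).symm.toContinuousLinearEquiv :
        ((A × W) →L[ℝ] ContinuousMultilinearMap ℝ (fun _ : Fin n => A × W) ℂ) →L[ℝ]
          ContinuousMultilinearMap ℝ (fun _ : Fin (n + 1) => A × W) ℂ) ∘L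
      fourierDeriv β ∘L fourierDerivs n

theorem iteratedFDeriv_fourierFun (n : ℕ) (ψ : 𝓢(A × E, ℂ)) :
    iteratedFDeriv ℝ n (fourierFun μ β ψ) = fourierFun μ β (fourierDerivs β n ψ) := by
  induction n with
  | zero =>
    funext p
    rw [fourierDerivs, fourierFun_postcompCLM]
    · rfl
    · intro c x; ext; rfl
  | succ n ih =>
    funext p
    rw [iteratedFDeriv_succ_eq_comp_left, Function.comp_apply, ih,
      (hasFDerivAt_fourierFun μ β _ p).fderiv, fourierDerivs, ContinuousLinearMap.comp_apply,
      ContinuousLinearMap.comp_apply, fourierFun_postcompCLM]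
    · rfl
    · intro c x; ext; rfl

theorem contDiff_fourierFun (ψ : 𝓢(A × E, ℂ)) : ContDiff ℝ (⊤ : ℕ∞) (fourierFun μ β ψ) := by
  refine contDiff_of_differentiable_iteratedFDeriv fun m _ p => ?_
  rw [iteratedFDeriv_fourierFun]
  exact (hasFDerivAt_fourierFun μ β _ p).differentiableAt

variable (A) in
/-- The partial Fourier integral as a continuous linear map between Schwartz spaces. -/
noncomputable def partialFourier [FiniteDimensional ℝ W] (hβ : ∀ w, (∀ v, β v w = 0) → w = 0) :
    𝓢(A × E, ℂ) →L[ℂ] 𝓢(A × W, ℂ) :=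
  -- The integrands of the derivatives depend real-linearly on the function, so continuity is proved
  -- over ℝ; complex homogeneity is added to the same map afterwards.
  let T : 𝓢(A × E, ℂ) →L[ℝ] 𝓢(A × W, ℂ) := SchwartzMap.mkCLM (fourierFun μ β)
    (fun f g p => by
      have := integral_add (integrable_fourier μ β f p) (integrable_fourier μ β g p)
      simpa [fourierFun, mul_add] using this)
    (fun c f p => by
      have := integral_const_mul (μ := μ) (c : ℂ) (fun y => expI (β y p.2) • f (p.1, y))
      simpa [fourierFun, mul_left_comm] using this)
    (contDiff_fourierFun μ β)
    (fun n => by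
      obtain ⟨s, C, hC, h⟩ := exists_pow_mul_norm_fourierFun_le A
        (ContinuousMultilinearMap ℝ (fun _ : Fin n.2 => A × W) ℂ) μ β hβ n.1
      obtain ⟨s', C', _, h'⟩ := Seminorm.bound_of_continuous (schwartz_withSeminorms ℝ (A × E) ℂ)
        ((s.sup (schwartzSeminormFamily ℝ (A × E) _)).comp (fourierDerivs β n.2).toLinearMap)
        ((continuous_finset_sup_seminorm s).comp (fourierDerivs β n.2).continuous)
      refine ⟨s', C * C', by positivity, fun f p => ?_⟩
      rw [iteratedFDeriv_fourierFun, mul_assoc]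
      refine (h _ p).trans ?_
      gcongr
      exact h' f)
  { toFun := T
    map_add' := T.map_add
    map_smul' := fun c f => SchwartzMap.ext fun p => by
      have := integral_const_mul (μ := μ) (c : ℂ) (fun y => expI (β y p.2) • f (p.1, y))
      simp only [smul_eq_mul, mul_left_comm c] at this
      exact this
    cont := T.continuous }

variable (A) in
/-- Integration over the second variable as a map between Schwartz spaces. -/
noncomputable def fibreIntegral : 𝓢(A × E, ℂ) →L[ℂ] 𝓢(A, ℂ) :=
  -- With a zero-dimensional frequency space the phase is 1 and nondegeneracy is vacuous, so the
  -- partial Fourier transform is plain integration.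
  SchwartzMap.compCLM ℂ (g := fun a : A => (a, (0 : Fin 0 → ℝ)))
    (hasTemperateGrowth_prodMk .id' (.const _))
    ⟨1, 1, fun a => by
      have : ‖a‖ ≤ ‖(a, (0 : Fin 0 → ℝ))‖ := le_max_left _ _
      linarith⟩ ∘L
  partialFourier A μ (0 : E →L[ℝ] (Fin 0 → ℝ) →L[ℝ] ℝ) (fun _ _ => Subsingleton.elim _ _)

theorem fibreIntegral_apply (ψ : 𝓢(A × E, ℂ)) (a : A) :
    fibreIntegral A μ ψ a = ∫ y, ψ (a, y) ∂μ := by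
  have : fibreIntegral A μ ψ a = ∫ y, expI 0 * ψ (a, y) ∂μ := rfl
  simpa using this

theorem hasFDerivAt_fibreIntegral (ψ : 𝓢(A × E, ℂ)) (a v : A) :
    fderiv ℝ (fibreIntegral A μ ψ) a v = ∫ y, fderiv ℝ ψ (a, y) (v, 0) ∂μ := by
  let β : E →L[ℝ] (Fin 0 → ℝ) →L[ℝ] ℝ := 0
  have h := hasFDerivAt_fourierFun μ β ψ (a, 0)
  have h2 : HasFDerivAt (fun a : A => (a, (0 : Fin 0 → ℝ))) (ContinuousLinearMap.inl ℝ A _) a :=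
    hasFDerivAt_prodMk_left a 0
  have h3 := h.comp a h2
  have h4 : HasFDerivAt (fibreIntegral A μ ψ) _ a := h3
  rw [h4.fderiv, ContinuousLinearMap.comp_apply, fourierFun,
    ContinuousLinearMap.integral_apply (integrable_fourier μ β (fourierDeriv β ψ) _)]
  congr 1
  funext y
  simp [fourierDeriv_apply, β]

end PartialFourierCLM

/-! ### Tensor products, substitutions and conjugation of Schwartz functions -/

section Tensor

variable {A B : Type*} [NormedAddCommGroup A] [NormedSpace ℝ A] [NormedAddCommGroup B]
  [NormedSpace ℝ B]

theorem norm_iteratedFDeriv_comp_fst_le (f : 𝓢(A, ℂ)) (n : ℕ) (p : A × B) :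
    ‖iteratedFDeriv ℝ n (fun p : A × B => f p.1) p‖ ≤ ‖iteratedFDeriv ℝ n f p.1‖ := by
  have h := (ContinuousLinearMap.fst ℝ A B).iteratedFDeriv_comp_right (f.smooth n) p le_rfl
  have h1 : iteratedFDeriv ℝ n (fun p : A × B => f p.1) p =
      (iteratedFDeriv ℝ n f p.1).compContinuousLinearMap
        fun _ => ContinuousLinearMap.fst ℝ A B := h
  rw [h1]
  refine (ContinuousMultilinearMap.norm_compContinuousLinearMap_le _ _).trans ?_
  refine mul_le_of_le_one_right (norm_nonneg _) ?_
  exact Finset.prod_le_one (fun _ _ => norm_nonneg _)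
    fun _ _ => ContinuousLinearMap.norm_fst_le ℝ A B

theorem norm_iteratedFDeriv_comp_snd_le (f : 𝓢(B, ℂ)) (n : ℕ) (p : A × B) :
    ‖iteratedFDeriv ℝ n (fun p : A × B => f p.2) p‖ ≤ ‖iteratedFDeriv ℝ n f p.2‖ := by
  have h := (ContinuousLinearMap.snd ℝ A B).iteratedFDeriv_comp_right (f.smooth n) p le_rfl
  have h1 : iteratedFDeriv ℝ n (fun p : A × B => f p.2) p =
      (iteratedFDeriv ℝ n f p.2).compContinuousLinearMap
        fun _ => ContinuousLinearMap.snd ℝ A B := h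
  rw [h1]
  refine (ContinuousMultilinearMap.norm_compContinuousLinearMap_le _ _).trans ?_
  refine mul_le_of_le_one_right (norm_nonneg _) ?_
  exact Finset.prod_le_one (fun _ _ => norm_nonneg _)
    fun _ _ => ContinuousLinearMap.norm_snd_le ℝ A B

variable (A) in
/-- The tensor product `Φ ⊗ e` of Schwartz functions as a continuous linear map in `Φ`. -/
noncomputable def tensorCLM (e : 𝓢(B, ℂ)) : 𝓢(A, ℂ) →L[ℂ] 𝓢(A × B, ℂ) :=
  SchwartzMap.mkCLM (fun f p => f p.1 * e p.2)
    (fun f g p => by simp [add_mul]) (fun c f p => by simp [mul_assoc])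
    (fun f => ((f.smooth ⊤).comp contDiff_fst).mul ((e.smooth ⊤).comp contDiff_snd))
    (fun n => by
      obtain ⟨k, n⟩ := n
      set S := (Finset.Iic (k, n)).sup (schwartzSeminormFamily ℂ B ℂ) e
      have hS : 0 ≤ S := apply_nonneg _ _
      refine ⟨Finset.Iic (k, n), 2 ^ n * (2 ^ k * (2 ^ k * S)), by positivity, fun f p => ?_⟩
      set R := (Finset.Iic (k, n)).sup (schwartzSeminormFamily ℂ A ℂ) f
      have hR : 0 ≤ R := apply_nonneg _ _
      have h1 := norm_iteratedFDeriv_mul_le (n := n) (N := ((⊤ : ℕ∞) : WithTop ℕ∞)) (𝕜 := ℝ)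
        ((f.smooth ⊤).comp (contDiff_fst (F := B))) ((e.smooth ⊤).comp (contDiff_snd (E := A)))
        p (mod_cast le_top)
      have hp : ‖p‖ ^ k ≤ (1 + ‖p.1‖) ^ k * (1 + ‖p.2‖) ^ k := by
        rw [← mul_pow]
        gcongr
        rw [Prod.norm_def]
        have := norm_nonneg p.1
        have := norm_nonneg p.2
        exact max_le (by nlinarith) (by nlinarith)
      calc ‖p‖ ^ k * ‖iteratedFDeriv ℝ n (fun p : A × B => f p.1 * e p.2) p‖
          ≤ ‖p‖ ^ k * ∑ i ∈ Finset.range (n + 1), (n.choose i : ℝ) *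
            ‖iteratedFDeriv ℝ i (fun p : A × B => f p.1) p‖ *
              ‖iteratedFDeriv ℝ (n - i) (fun p : A × B => e p.2) p‖ := by
            gcongr; exact h1
        _ = ∑ i ∈ Finset.range (n + 1), (n.choose i : ℝ) * (‖p‖ ^ k *
            (‖iteratedFDeriv ℝ i (fun p : A × B => f p.1) p‖ *
              ‖iteratedFDeriv ℝ (n - i) (fun p : A × B => e p.2) p‖)) := by
            rw [Finset.mul_sum]
            exact Finset.sum_congr rfl fun i _ => by ring
        _ ≤ ∑ i ∈ Finset.range (n + 1), (n.choose i : ℝ) * ((2 ^ k * R) * (2 ^ k * S)) := by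
            refine Finset.sum_le_sum fun i hi => ?_
            have hi' : i ≤ n := Nat.lt_succ_iff.mp (Finset.mem_range.mp hi)
            refine mul_le_mul_of_nonneg_left ?_ (Nat.cast_nonneg _)
            calc ‖p‖ ^ k * (‖iteratedFDeriv ℝ i (fun p : A × B => f p.1) p‖ *
                  ‖iteratedFDeriv ℝ (n - i) (fun p : A × B => e p.2) p‖)
                ≤ ((1 + ‖p.1‖) ^ k * (1 + ‖p.2‖) ^ k) * (‖iteratedFDeriv ℝ i f p.1‖ *
                  ‖iteratedFDeriv ℝ (n - i) e p.2‖) := by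
                  gcongr
                  · exact norm_iteratedFDeriv_comp_fst_le f i p
                  · exact norm_iteratedFDeriv_comp_snd_le e (n - i) p
              _ = ((1 + ‖p.1‖) ^ k * ‖iteratedFDeriv ℝ i f p.1‖) *
                  ((1 + ‖p.2‖) ^ k * ‖iteratedFDeriv ℝ (n - i) e p.2‖) := by ring
              _ ≤ _ := by
                  refine mul_le_mul ?_ ?_ (by positivity) (by positivity)
                  · exact SchwartzMap.one_add_le_sup_seminorm_apply (𝕜 := ℂ) (m := (k, n)) le_rfl
                      hi' f p.1
                  · exact SchwartzMap.one_add_le_sup_seminorm_apply (𝕜 := ℂ) (m := (k, n)) le_rfl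
                      (Nat.sub_le n i) e p.2
        _ = 2 ^ n * (2 ^ k * (2 ^ k * S)) * R := by
            rw [← Finset.sum_mul, ← Nat.cast_sum, Nat.sum_range_choose]
            push_cast
            ring)

@[simp] theorem tensorCLM_apply (e : 𝓢(B, ℂ)) (f : 𝓢(A, ℂ)) (p : A × B) :
    tensorCLM A e f p = f p.1 * e p.2 := rfl

/-- Composition of Schwartz functions with a map `g` which has, together with a left inverse `r`,
temperate growth. -/
noncomputable def pullback (g : A → B) (r : B → A) (hg : g.HasTemperateGrowth)
    (hr : r.HasTemperateGrowth) (hrg : ∀ x, r (g x) = x) : 𝓢(B, ℂ) →L[ℂ] 𝓢(A, ℂ) :=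
  SchwartzMap.compCLM ℂ hg (by
    obtain ⟨k, C, h⟩ := hr.2 0
    exact ⟨k, C, fun x => by simpa [hrg] using h (g x)⟩)

@[simp] theorem pullback_apply (g : A → B) (r : B → A) (hg : g.HasTemperateGrowth)
    (hr : r.HasTemperateGrowth) (hrg : ∀ x, r (g x) = x) (f : 𝓢(B, ℂ)) (x : A) :
    pullback g r hg hr hrg f x = f (g x) := rfl

@[simp] theorem conjS_apply (f : 𝓢(A, ℂ)) (x : A) : conjS f x = conj (f x) := rfl

@[simp] theorem conjS_conjS (f : 𝓢(A, ℂ)) : conjS (conjS f) = f := by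
  ext x; simp

@[simp] theorem conjS_add (f g : 𝓢(A, ℂ)) : conjS (f + g) = conjS f + conjS g := by
  ext x; simp

@[simp] theorem conjS_smul (c : ℂ) (f : 𝓢(A, ℂ)) : conjS (c • f) = conj c • conjS f := by
  ext x; simp

theorem continuous_conjS : Continuous (conjS : 𝓢(A, ℂ) → 𝓢(A, ℂ)) :=
  (SchwartzMap.postcompCLM (𝕜 := ℝ) (Complex.conjCLE : ℂ →L[ℝ] ℂ)).continuous

/-- The complex-linear map `f ↦ conj (T (conj f))`. -/
noncomputable def conjCLM (T : 𝓢(A, ℂ) →L[ℂ] 𝓢(B, ℂ)) : 𝓢(A, ℂ) →L[ℂ] 𝓢(B, ℂ) where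
  toFun f := conjS (T (conjS f))
  map_add' f g := by simp
  map_smul' c f := by simp
  cont := continuous_conjS.comp (T.continuous.comp continuous_conjS)

@[simp] theorem conjCLM_apply (T : 𝓢(A, ℂ) →L[ℂ] 𝓢(B, ℂ)) (f : 𝓢(A, ℂ)) :
    conjCLM T f = conjS (T (conjS f)) := rfl

end Tensor

/-! ### Injectivity of the Fourier transform on the dual space -/

section Inversion

variable {E : Type*} [NormedAddCommGroup E] [NormedSpace ℝ E] [FiniteDimensional ℝ E]
  [MeasurableSpace E] [BorelSpace E]

theorem exists_eval_eq (φ : (E →L[ℝ] ℝ) →ₗ[ℝ] ℝ) : ∃ x : E, ∀ ξ : E →L[ℝ] ℝ, ξ x = φ ξ := by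
  let ψ : Module.Dual ℝ (Module.Dual ℝ E) := φ ∘ₗ LinearMap.toContinuousLinearMap.toLinearMap
  refine ⟨(Module.evalEquiv ℝ E).symm ψ, fun ξ => ?_⟩
  have h := LinearMap.congr_fun ((Module.evalEquiv ℝ E).apply_symm_apply ψ) (ξ : E →ₗ[ℝ] ℝ)
  exact h

theorem integral_compl_equiv {E' : Type*} [NormedAddCommGroup E'] [NormedSpace ℝ E']
    [FiniteDimensional ℝ E'] [MeasurableSpace E'] [BorelSpace E'] (ν : Measure E')
    [ν.IsAddHaarMeasure] (L : E ≃L[ℝ] E') (μ : Measure E) [μ.IsAddHaarMeasure] (f : E' → ℂ) :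
    ∃ c : ℝ, ∫ x, f (L x) ∂μ = c • ∫ y, f y ∂ν := by
  have h1 : (μ.map L).IsAddHaarMeasure := L.isAddHaarMeasure_map μ
  have h2 := Measure.isAddLeftInvariant_eq_smul (μ.map L) ν
  refine ⟨((μ.map L).addHaarScalarFactor ν : ℝ), ?_⟩
  have h3 : ∫ x, f (L x) ∂μ = ∫ y, f y ∂(μ.map L) :=
    (L.toHomeomorph.measurableEmbedding.integral_map f).symm
  rw [h3]
  conv_lhs => rw [h2]
  rw [integral_smul_nnreal_measure]
  rfl

/-- Injectivity of the Fourier transform on the dual space. -/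
theorem eq_zero_of_fourier_dual_eq_zero (ν : Measure (E →L[ℝ] ℝ)) [ν.IsAddHaarMeasure]
    (g : 𝓢(E →L[ℝ] ℝ, ℂ)) (hg : ∀ x, ∫ ξ, expI (ξ x) * g ξ ∂ν = 0) : g = 0 := by
  let V := EuclideanSpace ℝ (Fin (Module.finrank ℝ (E →L[ℝ] ℝ)))
  let L : V ≃L[ℝ] (E →L[ℝ] ℝ) := ContinuousLinearEquiv.ofFinrankEq (by simp [V])
  let G : 𝓢(V, ℂ) := SchwartzMap.compCLMOfContinuousLinearEquiv ℂ L g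
  have hG : FourierTransform.fourier G = 0 := by
    ext w
    -- By reflexivity the frequency w, rescaled by -2π, is evaluation at a vector x of E; the
    -- hypothesis at x makes the Euclidean transform vanish at w.
    obtain ⟨x, hx⟩ := exists_eval_eq (E := E)
      ((-(2 * Real.pi)) • ((innerSL ℝ w).toLinearMap ∘ₗ L.symm.toLinearMap))
    obtain ⟨c, hc⟩ := integral_compl_equiv ν L volume (fun ξ => expI (ξ x) * g ξ)
    rw [hg, smul_zero] at hc
    rw [SchwartzMap.fourier_coe, Real.fourier_eq']
    rw [zero_apply, ← hc]
    congr 1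
    funext v
    rw [hx, expI, smul_eq_mul]
    congr 2
    simp [real_inner_comm]
    ring
  have h0 : G = 0 := by
    have := congrArg FourierTransformInv.fourierInv hG
    simpa using this
  ext ξ
  have := congrArg (fun f : 𝓢(V, ℂ) => f (L.symm ξ)) h0
  simpa [G] using this

end Inversion

/-! ### Tempered distributions commute with integration over a parameter -/

section Interchange

open BoundedContinuousFunction

/-- Bounded continuous functions with values in a normed group. -/
abbrev BddFun (X M : Type*) [TopologicalSpace X] [NormedAddCommGroup M] := X →ᵇ M

variable {A B : Type*} [NormedAddCommGroup A] [NormedSpace ℝ A] [NormedAddCommGroup B]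
  [NormedSpace ℝ B] {F : Type*} [NormedAddCommGroup F] [NormedSpace ℝ F] [NormedSpace ℂ F]
  [SMulCommClass ℝ ℂ F] [SMulCommClass ℂ ℝ F]

theorem iteratedFDeriv_sliceLeft (Φ : 𝓢(A × B, F)) (b : B) (n : ℕ) (a : A) :
    iteratedFDeriv ℝ n (sliceLeft b Φ) a = (iteratedFDeriv ℝ n Φ (a, b)).compContinuousLinearMap
      fun _ => ContinuousLinearMap.inl ℝ A B := by
  have hs : ContDiff ℝ n (fun p : A × B => Φ (p + (0, b))) :=
    (Φ.smooth n).comp (contDiff_id.add contDiff_const)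
  have h := (ContinuousLinearMap.inl ℝ A B).iteratedFDeriv_comp_right hs a le_rfl
  rw [iteratedFDeriv_comp_add_right] at h
  have h1 : (fun p : A × B => Φ (p + (0, b))) ∘ (ContinuousLinearMap.inl ℝ A B) =
      sliceLeft b Φ := by
    funext a; simp
  rw [h1] at h
  simpa using h

theorem norm_compContinuousLinearMap_inl_le {n : ℕ}
    (M : ContinuousMultilinearMap ℝ (fun _ : Fin n => A × B) F) :
    ‖M.compContinuousLinearMap fun _ => ContinuousLinearMap.inl ℝ A B‖ ≤ ‖M‖ := by
  refine (ContinuousMultilinearMap.norm_compContinuousLinearMap_le _ _).trans ?_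
  exact mul_le_of_le_one_right (norm_nonneg _) (Finset.prod_le_one (fun _ _ => norm_nonneg _)
    fun _ _ => ContinuousLinearMap.norm_inl_le_one ℝ A B)

theorem norm_smul_comp_inr_le {M : Type*} [NormedAddCommGroup M] [NormedSpace ℝ M] (c : ℝ)
    (L : A × B →L[ℝ] M) : ‖c • L.comp (ContinuousLinearMap.inr ℝ A B)‖ ≤ |c| * ‖L‖ := by
  rw [norm_smul, Real.norm_eq_abs]
  gcongr
  refine (ContinuousLinearMap.opNorm_comp_le _ _).trans ?_
  exact mul_le_of_le_one_right (norm_nonneg _) (ContinuousLinearMap.norm_inr_le_one ℝ A B)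

/-- The weighted derivative of a Schwartz function as a bounded continuous function. -/
noncomputable def weightedDeriv (i : ℕ × ℕ) :
    𝓢(A, F) →ₗ[ℂ] BddFun A (ContinuousMultilinearMap ℝ (fun _ : Fin i.2 => A) F) where
  toFun φ := BoundedContinuousFunction.ofNormedAddCommGroup
    (fun x => ‖x‖ ^ i.1 • iteratedFDeriv ℝ i.2 φ x)
    ((continuous_norm.pow _).smul ((φ.smooth i.2).continuous_iteratedFDeriv le_rfl))
    (SchwartzMap.seminorm ℝ i.1 i.2 φ)
    (fun x => by
      rw [norm_smul, norm_pow, norm_norm]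
      exact SchwartzMap.le_seminorm ℝ i.1 i.2 φ x)
  map_add' φ ψ := by
    ext x : 1
    have h : iteratedFDeriv ℝ i.2 (φ + ψ : 𝓢(A, F)) x = _ :=
      iteratedFDeriv_add_apply (φ.smooth i.2).contDiffAt (ψ.smooth i.2).contDiffAt
    exact (congrArg (‖x‖ ^ i.1 • ·) h).trans (smul_add _ _ _)
  map_smul' c φ := by
    ext x : 1
    have h : iteratedFDeriv ℝ i.2 (c • φ : 𝓢(A, F)) x = _ :=
      iteratedFDeriv_const_smul_apply (a := c) (φ.smooth i.2).contDiffAt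
    exact (congrArg (‖x‖ ^ i.1 • ·) h).trans (smul_comm _ _ _)

theorem weightedDeriv_apply (i : ℕ × ℕ) (φ : 𝓢(A, F)) (x : A) :
    weightedDeriv i φ x = ‖x‖ ^ i.1 • iteratedFDeriv ℝ i.2 φ x := rfl

theorem seminorm_le_norm_weightedDeriv (i : ℕ × ℕ) (φ : 𝓢(A, F)) :
    SchwartzMap.seminorm ℂ i.1 i.2 φ ≤ ‖weightedDeriv i φ‖ := by
  refine SchwartzMap.seminorm_le_bound ℂ _ _ _ (norm_nonneg _) fun x => ?_
  have := (weightedDeriv i φ).norm_coe_le_norm x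
  rwa [weightedDeriv_apply, norm_smul, norm_pow, norm_norm] at this

/-- A tempered distribution factors through finitely many weighted derivatives. -/
theorem exists_extension_weightedDeriv (T : 𝓢(A, F) →L[ℂ] ℂ) : ∃ (s : Finset (ℕ × ℕ))
    (g : ((i : s) → BddFun A (ContinuousMultilinearMap ℝ (fun _ : Fin i.1.2 => A) F)) →L[ℂ] ℂ),
    ∀ φ, T φ = g fun i => weightedDeriv i.1 φ := by
  obtain ⟨s, C, _, hC⟩ := Seminorm.bound_of_continuous (schwartz_withSeminorms ℂ A F)
    ((normSeminorm ℂ ℂ).comp T.toLinearMap) (continuous_norm.comp T.continuous)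
  let J : 𝓢(A, F) →ₗ[ℂ] ((i : s) → BddFun A (ContinuousMultilinearMap ℝ (fun _ : Fin i.1.2 => A) F)) :=
    LinearMap.pi fun i => weightedDeriv i.1
  have hb (φ : 𝓢(A, F)) : ‖T φ‖ ≤ C * ‖J φ‖ := by
    refine (hC φ).trans ?_
    change (C : ℝ) * s.sup (schwartzSeminormFamily ℂ A F) φ ≤ _
    gcongr
    refine Seminorm.finset_sup_apply_le (norm_nonneg _) fun i hi => ?_
    exact (seminorm_le_norm_weightedDeriv i φ).trans (norm_le_pi_norm (J φ) ⟨i, hi⟩)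
  have hker : LinearMap.ker J ≤ LinearMap.ker T.toLinearMap := fun φ hφ => by
    have := hb φ
    rw [LinearMap.mem_ker.mp hφ, norm_zero, mul_zero] at this
    exact norm_le_zero_iff.mp this
  let f : LinearMap.range J →ₗ[ℂ] ℂ :=
    (LinearMap.ker J).liftQ T.toLinearMap hker ∘ₗ J.quotKerEquivRange.symm.toLinearMap
  have hf (φ : 𝓢(A, F)) : f ⟨J φ, LinearMap.mem_range_self J φ⟩ = T φ := by
    have := J.quotKerEquivRange_symm_apply_image φ (LinearMap.mem_range_self J φ)
    simp only [f, LinearMap.comp_apply, LinearEquiv.coe_coe]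
    rw [this]
    rfl
  let f' : LinearMap.range J →L[ℂ] ℂ := f.mkContinuous C (by
    rintro ⟨_, φ, rfl⟩
    rw [hf]
    exact hb φ)
  -- Hahn-Banach moves the functional to a Banach space, where it commutes with Bochner integrals.
  obtain ⟨g, hg, _⟩ := exists_extension_norm_eq (LinearMap.range J) f'
  refine ⟨s, g, fun φ => ?_⟩
  rw [← hf]
  exact (hg ⟨J φ, LinearMap.mem_range_self J φ⟩).symm

theorem norm_weightedDeriv_sliceLeft_le (i : ℕ × ℕ) (r : ℕ) (Φ : 𝓢(A × B, F)) (b : B) :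
    ‖weightedDeriv i (sliceLeft b Φ)‖ ≤ 2 ^ (i.1 + r) *
      (Finset.Iic (i.1 + r, i.2)).sup (schwartzSeminormFamily ℝ (A × B) F) Φ *
        (1 + ‖b‖) ^ (-(r : ℝ)) := by
  refine (BoundedContinuousFunction.norm_le ?_).mpr fun a => ?_
  · have : 0 ≤ (Finset.Iic (i.1 + r, i.2)).sup (schwartzSeminormFamily ℝ (A × B) F) Φ :=
      apply_nonneg _ _
    positivity
  rw [weightedDeriv_apply, norm_smul, norm_pow, norm_norm, iteratedFDeriv_sliceLeft]
  refine le_trans ?_ (pow_mul_norm_slice_le Φ i.1 r i.2 a b)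
  gcongr
  exact norm_compContinuousLinearMap_inl_le _

/-- By the mean value inequality the slices are Lipschitz in b, with the Schwartz seminorm of one
derivative more as constant. -/
theorem continuous_weightedDeriv_sliceLeft (i : ℕ × ℕ) (Φ : 𝓢(A × B, F)) :
    Continuous fun b => weightedDeriv i (sliceLeft b Φ) := by
  have hC : 0 ≤ SchwartzMap.seminorm ℝ i.1 (i.2 + 1) Φ := apply_nonneg _ _
  refine (LipschitzWith.of_dist_le_mul (K := Real.toNNReal (SchwartzMap.seminorm ℝ i.1 (i.2 + 1) Φ))
    fun b b' => ?_).continuous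
  rw [Real.coe_toNNReal _ hC, dist_eq_norm, dist_eq_norm]
  refine (BoundedContinuousFunction.norm_le (by positivity)).mpr fun a => ?_
  have hd (b : B) : HasFDerivAt (fun b => ‖a‖ ^ i.1 • iteratedFDeriv ℝ i.2 Φ (a, b))
      (‖a‖ ^ i.1 • (fderiv ℝ (iteratedFDeriv ℝ i.2 Φ) (a, b)).comp
        (ContinuousLinearMap.inr ℝ A B)) b := by
    have h1 : DifferentiableAt ℝ (iteratedFDeriv ℝ i.2 Φ) (a, b) :=
      ((Φ.smooth (i.2 + 1 : ℕ)).differentiable_iteratedFDeriv (mod_cast Nat.lt_succ_self _)) _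
    exact (h1.hasFDerivAt.comp b (hasFDerivAt_prodMk_right a b)).const_smul (‖a‖ ^ i.1)
  have hbound (b : B) : ‖‖a‖ ^ i.1 • (fderiv ℝ (iteratedFDeriv ℝ i.2 Φ) (a, b)).comp
        (ContinuousLinearMap.inr ℝ A B)‖ ≤ SchwartzMap.seminorm ℝ i.1 (i.2 + 1) Φ := by
    refine (norm_smul_comp_inr_le _ _).trans ?_
    refine le_trans ?_ (SchwartzMap.le_seminorm ℝ i.1 (i.2 + 1) Φ (a, b))
    rw [norm_fderiv_iteratedFDeriv, abs_of_nonneg (by positivity)]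
    gcongr
    exact le_max_left _ _
  have key := (convex_univ (𝕜 := ℝ)).norm_image_sub_le_of_norm_hasFDerivWithin_le
    (fun b _ => (hd b).hasFDerivWithinAt) (fun b _ => hbound b) (Set.mem_univ b') (Set.mem_univ b)
  refine le_trans ?_ key
  have he : (weightedDeriv i (sliceLeft b Φ) - weightedDeriv i (sliceLeft b' Φ)) a =
      (‖a‖ ^ i.1 • iteratedFDeriv ℝ i.2 Φ (a, b) -
        ‖a‖ ^ i.1 • iteratedFDeriv ℝ i.2 Φ (a, b')).compContinuousLinearMap
          fun _ => ContinuousLinearMap.inl ℝ A B := by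
    rw [BoundedContinuousFunction.sub_apply, weightedDeriv_apply, weightedDeriv_apply,
      iteratedFDeriv_sliceLeft, iteratedFDeriv_sliceLeft]
    rfl
  rw [he]
  exact norm_compContinuousLinearMap_inl_le _

theorem lineDerivOp_fibreIntegral [FiniteDimensional ℝ B] [MeasurableSpace B] [BorelSpace B]
    (μ : Measure B) [μ.IsAddHaarMeasure] (Φ : 𝓢(A × B, ℂ)) (v : A) :
    LineDeriv.lineDerivOp v (fibreIntegral A μ Φ) =
      fibreIntegral A μ (LineDeriv.lineDerivOp ((v, 0) : A × B) Φ) := by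
  ext a
  rw [SchwartzMap.lineDerivOp_apply_eq_fderiv, hasFDerivAt_fibreIntegral, fibreIntegral_apply]
  simp only [SchwartzMap.lineDerivOp_apply_eq_fderiv]

theorem iteratedLineDerivOp_fibreIntegral [FiniteDimensional ℝ B] [MeasurableSpace B]
    [BorelSpace B] (μ : Measure B) [μ.IsAddHaarMeasure] (Φ : 𝓢(A × B, ℂ)) {n : ℕ}
    (m : Fin n → A) :
    LineDeriv.iteratedLineDerivOp m (fibreIntegral A μ Φ) =
      fibreIntegral A μ (LineDeriv.iteratedLineDerivOp (fun i => ((m i, 0) : A × B)) Φ) := by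
  induction n with
  | zero => rfl
  | succ n ih =>
    rw [LineDeriv.iteratedLineDerivOp_succ_left, ih, lineDerivOp_fibreIntegral,
      LineDeriv.iteratedLineDerivOp_succ_left]
    rfl

/-- A continuous linear functional commutes with integration over a parameter. -/
theorem integrable_and_apply_fibreIntegral [FiniteDimensional ℝ B] [MeasurableSpace B]
    [BorelSpace B] (μ : Measure B) [μ.IsAddHaarMeasure] (T : 𝓢(A, ℂ) →L[ℂ] ℂ)
    (Φ : 𝓢(A × B, ℂ)) : Integrable (fun b => T (sliceLeft b Φ)) μ ∧
      T (fibreIntegral A μ Φ) = ∫ b, T (sliceLeft b Φ) ∂μ := by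
  obtain ⟨s, g, hg⟩ := exists_extension_weightedDeriv T
  have hcont : Continuous fun b => fun i : s => weightedDeriv i.1 (sliceLeft b Φ) :=
    continuous_pi fun i => continuous_weightedDeriv_sliceLeft i.1 Φ
  have := FiniteDimensional.proper ℝ B
  have hsc : SecondCountableTopologyEither B
      ((i : s) → BddFun A (ContinuousMultilinearMap ℝ (fun _ : Fin i.1.2 => A) ℂ)) :=
    secondCountableTopologyEither_of_left _ _
  have hint : Integrable (fun b => fun i : s => weightedDeriv i.1 (sliceLeft b Φ)) μ := by
    refine Integrable.mono' ((Measure.integrable_pow_neg_integrablePower μ).const_mul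
      (∑ i : s, 2 ^ (i.1.1 + μ.integrablePower) *
      (Finset.Iic (i.1.1 + μ.integrablePower, i.1.2)).sup (schwartzSeminormFamily ℝ (A × B) ℂ) Φ))
      hcont.aestronglyMeasurable (Filter.Eventually.of_forall fun b => ?_)
    have hnn (i : s) : 0 ≤ 2 ^ (i.1.1 + μ.integrablePower) *
      (Finset.Iic (i.1.1 + μ.integrablePower, i.1.2)).sup
        (schwartzSeminormFamily ℝ (A × B) ℂ) Φ := mul_nonneg (by positivity) (apply_nonneg _ _)
    refine (pi_norm_le_iff_of_nonneg (mul_nonneg (Finset.sum_nonneg fun i _ => hnn i)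
      (by positivity))).mpr fun i => ?_
    refine (norm_weightedDeriv_sliceLeft_le i.1 μ.integrablePower Φ b).trans ?_
    gcongr
    exact Finset.single_le_sum (f := fun i : s => 2 ^ (i.1.1 + μ.integrablePower) *
      (Finset.Iic (i.1.1 + μ.integrablePower, i.1.2)).sup (schwartzSeminormFamily ℝ (A × B) ℂ) Φ)
      (fun i _ => hnn i) (Finset.mem_univ i)
  refine ⟨?_, ?_⟩
  · simp only [hg]
    exact g.integrable_comp hint
  · simp only [hg]
    rw [g.integral_comp_comm hint]
    congr 1
    funext i
    ext x : 1
    ext m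
    -- The Banach-valued integral is identified by point evaluations. These are weighted iterated
    -- line derivatives, which commute with the fibre integral.
    let ev : ((i : s) → BddFun A (ContinuousMultilinearMap ℝ (fun _ : Fin i.1.2 => A) ℂ)) →L[ℝ] ℂ :=
      (ContinuousMultilinearMap.apply ℝ (fun _ : Fin i.1.2 => A) ℂ m).comp
        ((BoundedContinuousFunction.evalCLM ℝ x).comp (ContinuousLinearMap.proj i))
    have h1 := ev.integral_comp_comm hint
    refine Eq.trans ?_ h1
    have h2 (φ : 𝓢(A, ℂ)) (x : A) : (weightedDeriv i.1 φ x) m =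
        (‖x‖ ^ i.1.1 : ℝ) * LineDeriv.iteratedLineDerivOp m φ x := by
      rw [SchwartzMap.iteratedLineDerivOp_eq_iteratedFDeriv, weightedDeriv_apply]
      simp
    have h3 (b : B) : ev (fun i : s => weightedDeriv i.1 (sliceLeft b Φ)) =
        (‖x‖ ^ i.1.1 : ℝ) *
          LineDeriv.iteratedLineDerivOp (fun j => ((m j, 0) : A × B)) Φ (x, b) := by
      refine (h2 _ _).trans ?_
      rw [SchwartzMap.iteratedLineDerivOp_eq_iteratedFDeriv, iteratedFDeriv_sliceLeft,
        SchwartzMap.iteratedLineDerivOp_eq_iteratedFDeriv]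
      rfl
    simp only [h3]
    rw [h2, iteratedLineDerivOp_fibreIntegral, fibreIntegral_apply, integral_const_mul]

end Interchange

/-! ### Uniqueness behind the definitions by choice -/

section Uniqueness

variable {V : Type*} [NormedAddCommGroup V] [NormedSpace ℝ V]

/-- To exclude the default value 0 it suffices to exhibit one candidate, since a candidate is
unique. `distOf_eq` and `schwartzRep_eq` follow the same pattern. -/
theorem toSchwartz_eq {φ : V → ℂ} (s : 𝓢(V, ℂ)) (h : ∀ x, s x = φ x) : toSchwartz φ = s := by
  have hex : ∃ s : 𝓢(V, ℂ), ∀ x, s x = φ x := ⟨s, h⟩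
  rw [toSchwartz, dif_pos hex]
  ext x
  rw [hex.choose_spec x, h x]

theorem apply_eq_pair (F : 𝓢'(V, ℂ)) (φ : 𝓢(V, ℂ)) : F φ = pair F (conjS φ) := by
  rw [pair, conjS_conjS]

theorem ext_pair {F G : 𝓢'(V, ℂ)} (h : ∀ φ, pair F φ = pair G φ) : F = G := by
  refine ContinuousLinearMap.ext fun φ => ?_
  have := h (conjS φ)
  rwa [← apply_eq_pair, ← apply_eq_pair] at this

theorem distOf_eq {Φ : 𝓢(V, ℂ) → ℂ} (F : 𝓢'(V, ℂ)) (h : ∀ φ, pair F φ = Φ φ) :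
    distOf Φ = F := by
  have hex : ∃ F : 𝓢'(V, ℂ), ∀ φ, pair F φ = Φ φ := ⟨F, h⟩
  rw [distOf, dif_pos hex]
  exact ext_pair fun φ => by rw [hex.choose_spec φ, h φ]

@[simp] theorem pair_add_left (F G : 𝓢'(V, ℂ)) (φ : 𝓢(V, ℂ)) :
    pair (F + G) φ = pair F φ + pair G φ := rfl

@[simp] theorem pair_smul_left (c : ℂ) (F : 𝓢'(V, ℂ)) (φ : 𝓢(V, ℂ)) :
    pair (c • F) φ = c * pair F φ := rfl

@[simp] theorem pair_zero_left (φ : 𝓢(V, ℂ)) : pair (0 : 𝓢'(V, ℂ)) φ = 0 := rfl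

/-- A continuous linear functional as a tempered distribution. -/
noncomputable def toDist (T : 𝓢(V, ℂ) →L[ℂ] ℂ) : 𝓢'(V, ℂ) :=
  ContinuousLinearMap.toPointwiseConvergenceCLM ℂ (RingHom.id ℂ) 𝓢(V, ℂ) ℂ T

@[simp] theorem toDist_apply (T : 𝓢(V, ℂ) →L[ℂ] ℂ) (φ : 𝓢(V, ℂ)) : toDist T φ = T φ := rfl

/-- A tempered distribution as a continuous linear functional. -/
noncomputable def ofDist (F : 𝓢'(V, ℂ)) : 𝓢(V, ℂ) →L[ℂ] ℂ := F

@[simp] theorem ofDist_apply (F : 𝓢'(V, ℂ)) (φ : 𝓢(V, ℂ)) : ofDist F φ = F φ := rfl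

variable [FiniteDimensional ℝ V] [MeasurableSpace V] [BorelSpace V] (m : Measure V)
  [m.IsAddHaarMeasure]

theorem integrable_schwartz_mul (f g : 𝓢(V, ℂ)) : Integrable (fun x => f x * g x) m := by
  exact f.integrable.mul_bdd g.continuous.aestronglyMeasurable
    (Filter.Eventually.of_forall fun x => SchwartzMap.norm_le_seminorm ℝ g x)

theorem integrable_schwartz_mul_conj (f g : 𝓢(V, ℂ)) : Integrable (fun x => f x * conj (g x)) m :=
  integrable_schwartz_mul m f (conjS g)

theorem eq_zero_of_integral_mul_conj_self {f : 𝓢(V, ℂ)} (h : ∫ x, f x * conj (f x) ∂m = 0) :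
    f = 0 := by
  have h1 : ∫ x, ‖f x‖ ^ 2 ∂m = 0 := by
    have h2 : ∫ x, f x * conj (f x) ∂m = ((∫ x, ‖f x‖ ^ 2 ∂m : ℝ) : ℂ) := by
      refine Eq.trans ?_ (integral_complex_ofReal (f := fun x => ‖f x‖ ^ 2))
      congr 1
      funext x
      rw [Complex.mul_conj, Complex.normSq_eq_norm_sq]
    rw [h2] at h
    exact_mod_cast h
  have hi : Integrable (fun x => ‖f x‖ ^ 2) m := by
    have := (integrable_schwartz_mul_conj m f f).norm
    simpa [pow_two] using this
  rw [integral_eq_zero_iff_of_nonneg (fun x => by positivity) hi] at h1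
  have h3 := (Continuous.ae_eq_iff_eq m (by fun_prop) continuous_const).mp h1
  ext x
  have h4 : ‖f x‖ ^ 2 = 0 := congrFun h3 x
  exact norm_eq_zero.mp (pow_eq_zero_iff two_ne_zero |>.mp h4)

theorem schwartzRep_eq {F : 𝓢'(V, ℂ)} (s : 𝓢(V, ℂ))
    (h : ∀ φ, pair F φ = ∫ x, s x * conj (φ x) ∂m) : schwartzRep m F = s := by
  have hs : ∀ φ : 𝓢(V, ℂ), F φ = ∫ x, s x * φ x ∂m := fun φ => by
    rw [apply_eq_pair, h]
    simp
  have hex : ∃ s : 𝓢(V, ℂ), ∀ φ : 𝓢(V, ℂ), F φ = ∫ x, s x * φ x ∂m := ⟨s, hs⟩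
  rw [schwartzRep, dif_pos hex]
  set t := hex.choose
  have ht : ∀ φ : 𝓢(V, ℂ), F φ = ∫ x, t x * φ x ∂m := hex.choose_spec
  refine sub_eq_zero.mp (eq_zero_of_integral_mul_conj_self m ?_)
  have h1 := (ht (conjS (t - s))).symm.trans (hs (conjS (t - s)))
  have h2 := integral_sub (integrable_schwartz_mul m t (conjS (t - s)))
    (integrable_schwartz_mul m s (conjS (t - s)))
  rw [h1, sub_self] at h2
  rw [← h2]
  congr 1
  funext x
  simp [sub_mul]

/-- The tempered distribution given by integration against a Schwartz function. -/
noncomputable def schwartzDist (s : 𝓢(V, ℂ)) : 𝓢'(V, ℂ) :=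
  toDist (SchwartzMap.integralCLM ℂ m ∘L SchwartzMap.smulLeftCLM ℂ s)

theorem pair_schwartzDist (s φ : 𝓢(V, ℂ)) :
    pair (schwartzDist m s) φ = ∫ x, s x * conj (φ x) ∂m := by
  rw [pair, schwartzDist, toDist_apply, ContinuousLinearMap.comp_apply,
    SchwartzMap.integralCLM_apply]
  simp [SchwartzMap.smulLeftCLM_apply_apply s.hasTemperateGrowth]

end Uniqueness

/-! ### Partial Fourier transforms between the Lie algebra and its dual -/

section FourierPair

variable {𝔤 : Type*} [RealNormedLieAlgebra 𝔤] [FiniteDimensional ℝ 𝔤]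
  [MeasurableSpace 𝔤] [BorelSpace 𝔤] (μ : Measure 𝔤) [μ.IsAddHaarMeasure]
  (ν : Measure (𝔤 →L[ℝ] ℝ)) [ν.IsAddHaarMeasure]
  {A : Type*} [NormedAddCommGroup A] [NormedSpace ℝ A]

theorem exp_neg_I_mul (t : ℝ) : Complex.exp (-(Complex.I * t)) = expI (-t) := by
  simp [expI]

theorem exp_I_mul (t : ℝ) : Complex.exp (Complex.I * t) = expI t := rfl

variable (A) in
/-- The partial Fourier transform with phase `e^{iξ(Y)}`. -/
noncomputable def fourierPos : 𝓢(A × 𝔤, ℂ) →L[ℂ] 𝓢(A × (𝔤 →L[ℝ] ℝ), ℂ) :=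
  partialFourier A μ (ContinuousLinearMap.apply ℝ ℝ)
    (fun _ h => ContinuousLinearMap.ext fun v => h v)

variable (A) in
/-- The partial Fourier transform with phase `e^{-iξ(Y)}`. -/
noncomputable def fourierNeg : 𝓢(A × 𝔤, ℂ) →L[ℂ] 𝓢(A × (𝔤 →L[ℝ] ℝ), ℂ) :=
  partialFourier A μ (-(ContinuousLinearMap.apply ℝ ℝ))
    (fun _ h => ContinuousLinearMap.ext fun v => by simpa using h v)

variable (A) in
/-- The partial inverse Fourier transform with phase `e^{iξ(X)}`. -/
noncomputable def fourierInv : 𝓢(A × (𝔤 →L[ℝ] ℝ), ℂ) →L[ℂ] 𝓢(A × 𝔤, ℂ) :=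
  partialFourier A ν (ContinuousLinearMap.id ℝ (𝔤 →L[ℝ] ℝ))
    (fun X h => by
      by_contra hX
      obtain ⟨f, _, hf⟩ := exists_dual_vector ℝ X (norm_ne_zero_iff.mpr hX)
      rw [show f X = 0 from h f] at hf
      exact hX (norm_eq_zero.mp hf.symm))

theorem fourierNeg_apply (f : 𝓢(A × 𝔤, ℂ)) (p : A × (𝔤 →L[ℝ] ℝ)) :
    fourierNeg μ A f p = ∫ Y, expI (-(p.2 Y)) * f (p.1, Y) ∂μ := rfl

theorem fourierInv_apply (f : 𝓢(A × (𝔤 →L[ℝ] ℝ), ℂ)) (p : A × 𝔤) :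
    fourierInv ν A f p = ∫ ξ, expI (ξ p.2) * f (p.1, ξ) ∂ν := rfl

variable {μ ν}

theorem IsDualMeasure.inversion (hμν : IsDualMeasure μ ν) (u : 𝓢(𝔤, ℂ)) (X : 𝔤) :
    ∫ ξ, expI (ξ X) * ∫ Y, expI (-(ξ Y)) * u Y ∂μ ∂ν = u X := by
  rw [hμν u X]
  simp only [exp_neg_I_mul, exp_I_mul]

theorem IsDualMeasure.inversion_conj (hμν : IsDualMeasure μ ν) (u : 𝓢(𝔤, ℂ)) (X : 𝔤) :
    ∫ ξ, expI (-(ξ X)) * ∫ Y, expI (ξ Y) * u Y ∂μ ∂ν = u X := by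
  have h := congrArg conj (hμν.inversion (conjS u) X)
  rw [← integral_conj] at h
  simpa [← integral_conj] using h

theorem IsDualMeasure.fourierInv_fourierNeg (hμν : IsDualMeasure μ ν) (f : 𝓢(A × 𝔤, ℂ)) :
    fourierInv ν A (fourierNeg μ A f) = f := by
  ext p
  rw [fourierInv_apply]
  simp only [fourierNeg_apply]
  exact hμν.inversion (sliceRight p.1 f) p.2

variable (ν) in
theorem fourierInv_injective {f : 𝓢(A × (𝔤 →L[ℝ] ℝ), ℂ)} (h : fourierInv ν A f = 0) : f = 0 := by
  ext ⟨a, ξ⟩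
  have h1 := eq_zero_of_fourier_dual_eq_zero ν (sliceRight a f) fun x => by
    have := congrArg (fun g : 𝓢(A × 𝔤, ℂ) => g (a, x)) h
    exact this
  exact congrArg (fun g : 𝓢(𝔤 →L[ℝ] ℝ, ℂ) => g ξ) h1

/-- The normalisation of ν yields one order of composition only; the other order follows from the
injectivity of `fourierInv`. -/
theorem IsDualMeasure.fourierNeg_fourierInv (hμν : IsDualMeasure μ ν)
    (f : 𝓢(A × (𝔤 →L[ℝ] ℝ), ℂ)) : fourierNeg μ A (fourierInv ν A f) = f := by
  refine sub_eq_zero.mp (fourierInv_injective ν ?_)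
  rw [map_sub, hμν.fourierInv_fourierNeg, sub_self]

end FourierPair

/-! ### Flips, adjoint kernels and pulled-back distributions -/

section Functionals

variable {V W : Type*} [NormedAddCommGroup V] [NormedSpace ℝ V] [NormedAddCommGroup W]
  [NormedSpace ℝ W]

/-- The flip `(x, y) ↦ (y, x)` on Schwartz functions. -/
noncomputable def swapCLM : 𝓢(V × W, ℂ) →L[ℂ] 𝓢(W × V, ℂ) :=
  SchwartzMap.compCLMOfContinuousLinearEquiv ℂ (ContinuousLinearEquiv.prodComm ℝ W V)

@[simp] theorem swapCLM_apply (K : 𝓢(V × W, ℂ)) (p : W × V) : swapCLM K p = K (p.2, p.1) := rfl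

/-- The adjoint `conj (K(Y, X))` of an integral kernel. -/
noncomputable def starK (K : 𝓢(V × W, ℂ)) : 𝓢(W × V, ℂ) := conjS (swapCLM K)

@[simp] theorem starK_apply (K : 𝓢(V × W, ℂ)) (p : W × V) : starK K p = conj (K (p.2, p.1)) := rfl

@[simp] theorem starK_starK (K : 𝓢(V × W, ℂ)) : starK (starK K) = K := by
  ext p; simp

/-- The functional `φ ↦ conj (T (conj φ))`. -/
noncomputable def conjFun (T : 𝓢(V, ℂ) →L[ℂ] ℂ) : 𝓢(V, ℂ) →L[ℂ] ℂ where
  toFun f := conj (T (conjS f))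
  map_add' f g := by simp
  map_smul' c f := by simp
  cont := Complex.continuous_conj.comp (T.continuous.comp continuous_conjS)

@[simp] theorem conjFun_apply (T : 𝓢(V, ℂ) →L[ℂ] ℂ) (f : 𝓢(V, ℂ)) :
    conjFun T f = conj (T (conjS f)) := rfl

/-- The distribution `k ↦ ⟨F, T k⟩`. -/
noncomputable def pullDist (F : 𝓢'(W, ℂ)) (T : 𝓢(V, ℂ) →L[ℂ] 𝓢(W, ℂ)) : 𝓢'(V, ℂ) :=
  toDist (ofDist F ∘L conjCLM T)

@[simp] theorem pair_pullDist (F : 𝓢'(W, ℂ)) (T : 𝓢(V, ℂ) →L[ℂ] 𝓢(W, ℂ)) (k : 𝓢(V, ℂ)) :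
    pair (pullDist F T) k = pair F (T k) := by
  simp [pair, pullDist]

end Functionals

/-! ### Invariant integration on the group -/

section Translations

variable {𝔤 : Type*} [RealNormedLieAlgebra 𝔤] [FiniteDimensional ℝ 𝔤] [LieRing.IsNilpotent 𝔤]
  [MeasurableSpace 𝔤] [BorelSpace 𝔤] (μ : Measure 𝔤) [μ.IsAddHaarMeasure]

theorem integral_bch_left {g : 𝔤 → ℂ} (hg : Continuous g) (x : 𝔤) :
    ∫ y, g (bch x y) ∂μ = ∫ y, g y ∂μ := by
  have h := measurePreserving_bch_left μ x
  rw [← integral_map h.aemeasurable hg.aestronglyMeasurable, h.map_eq]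

theorem integral_bch_right {g : 𝔤 → ℂ} (hg : Continuous g) (y : 𝔤) :
    ∫ x, g (bch x y) ∂μ = ∫ y, g y ∂μ := by
  have h := measurePreserving_bch_right μ y
  have h2 := integral_map (f := g) h.aemeasurable hg.aestronglyMeasurable
  rw [h.map_eq] at h2
  exact h2.symm

theorem integral_bch_neg {g : 𝔤 → ℂ} (hg : Continuous g) (x : 𝔤) :
    ∫ y, g (bch x (-y)) ∂μ = ∫ y, g y ∂μ := by
  rw [integral_neg_eq_self (fun y => g (bch x y)) μ, integral_bch_left μ hg]

end Translations

/-! ### Symbols and integral kernels of Schwartz class -/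

section Kernels

variable {𝔤 : Type*} [RealNormedLieAlgebra 𝔤] [FiniteDimensional ℝ 𝔤] [LieRing.IsNilpotent 𝔤]
  [MeasurableSpace 𝔤] [BorelSpace 𝔤] (μ : Measure 𝔤) [μ.IsAddHaarMeasure]
  (ν : Measure (𝔤 →L[ℝ] ℝ)) [ν.IsAddHaarMeasure]

theorem hasTemperateGrowth_fst_bch_neg :
    (fun p : 𝔤 × 𝔤 => (p.1, bch p.1 (-p.2))).HasTemperateGrowth :=
  hasTemperateGrowth_prodMk (hasTemperateGrowth_fst .id')
    (hasTemperateGrowth_bch (hasTemperateGrowth_fst .id') (hasTemperateGrowth_snd .id').neg)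

theorem hasTemperateGrowth_fst_neg_bch :
    (fun p : 𝔤 × 𝔤 => (p.1, bch (-p.2) p.1)).HasTemperateGrowth :=
  hasTemperateGrowth_prodMk (hasTemperateGrowth_fst .id')
    (hasTemperateGrowth_bch (hasTemperateGrowth_snd .id').neg (hasTemperateGrowth_fst .id'))

/-- Together with the next lemma: the substitutions (X, Y) ↦ (X, X • (-Y)) and (X, Y) ↦ (X, (-Y) •
X), which link symbols and kernels, are inverse to each other. -/
theorem neg_bch_neg_bch (x y : 𝔤) : bch (-(bch x (-y))) x = y := by
  rw [neg_bch, neg_neg, bch_neg_bch_self]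

theorem bch_neg_neg_bch (x y : 𝔤) : bch x (-(bch (-y) x)) = y := by
  rw [neg_bch, neg_neg, bch_neg_bch]

/-- The integral kernel of `Op(f)` as a Schwartz function. -/
noncomputable def kernelOf : 𝓢(Phase 𝔤, ℂ) →L[ℂ] 𝓢(𝔤 × 𝔤, ℂ) :=
  pullback (fun p : 𝔤 × 𝔤 => (p.1, bch p.1 (-p.2))) (fun p => (p.1, bch (-p.2) p.1))
    hasTemperateGrowth_fst_bch_neg hasTemperateGrowth_fst_neg_bch
    (fun p => Prod.ext rfl (neg_bch_neg_bch p.1 p.2)) ∘L fourierInv ν 𝔤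

/-- The symbol of the integral operator with the Schwartz kernel `K` as a Schwartz function. -/
noncomputable def symbolOf : 𝓢(𝔤 × 𝔤, ℂ) →L[ℂ] 𝓢(Phase 𝔤, ℂ) :=
  fourierNeg μ 𝔤 ∘L pullback (fun p : 𝔤 × 𝔤 => (p.1, bch (-p.2) p.1))
    (fun p => (p.1, bch p.1 (-p.2)))
    hasTemperateGrowth_fst_neg_bch hasTemperateGrowth_fst_bch_neg
    (fun p => Prod.ext rfl (bch_neg_neg_bch p.1 p.2))

theorem kernelOf_eq_fourierInv (f : 𝓢(Phase 𝔤, ℂ)) (X Y : 𝔤) :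
    kernelOf ν f (X, Y) = fourierInv ν 𝔤 f (X, bch X (-Y)) := rfl

theorem symbolOf_apply (K : 𝓢(𝔤 × 𝔤, ℂ)) (p : Phase 𝔤) :
    symbolOf μ K p = symbolOfKer μ (fun X Y => K (X, Y)) p := by
  have h : symbolOf μ K p = ∫ Y, expI (-(p.2 Y)) * K (p.1, bch (-Y) p.1) ∂μ := rfl
  rw [h, symbolOfKer]
  simp only [exp_neg_I_mul]

variable {μ ν}

theorem IsDualMeasure.kernelOf_symbolOf (hμν : IsDualMeasure μ ν) (K : 𝓢(𝔤 × 𝔤, ℂ)) :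
    kernelOf ν (symbolOf μ K) = K := by
  ext ⟨X, Y⟩
  rw [kernelOf_eq_fourierInv, symbolOf, ContinuousLinearMap.comp_apply, hμν.fourierInv_fourierNeg,
    pullback_apply]
  exact congrArg (fun y => K (X, y)) (neg_bch_neg_bch X Y)

theorem IsDualMeasure.symbolOf_kernelOf (hμν : IsDualMeasure μ ν) (f : 𝓢(Phase 𝔤, ℂ)) :
    symbolOf μ (kernelOf ν f) = f := by
  rw [symbolOf, ContinuousLinearMap.comp_apply]
  refine Eq.trans (congrArg _ ?_) (hμν.fourierNeg_fourierInv f)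
  ext ⟨X, Y⟩
  rw [pullback_apply, kernelOf_eq_fourierInv]
  exact congrArg (fun y => fourierInv ν 𝔤 f (X, y)) (bch_neg_neg_bch X Y)

theorem adj_eq (f : 𝓢(Phase 𝔤, ℂ)) : adj μ ν f = symbolOf μ (starK (kernelOf ν f)) :=
  toSchwartz_eq _ fun p => symbolOf_apply μ _ p

theorem hasTemperateGrowth_compGraph : (fun p : (𝔤 × 𝔤) × 𝔤 =>
    ((p.1.1, p.2), (p.2, p.1.2))).HasTemperateGrowth :=
  hasTemperateGrowth_prodMk
    (hasTemperateGrowth_prodMk (hasTemperateGrowth_fst (hasTemperateGrowth_fst .id'))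
      (hasTemperateGrowth_snd .id'))
    (hasTemperateGrowth_prodMk (hasTemperateGrowth_snd .id')
      (hasTemperateGrowth_snd (hasTemperateGrowth_fst .id')))

theorem hasTemperateGrowth_compRetract : (fun q : (𝔤 × 𝔤) × (𝔤 × 𝔤) =>
    ((q.1.1, q.2.2), q.1.2)).HasTemperateGrowth :=
  hasTemperateGrowth_prodMk
    (hasTemperateGrowth_prodMk (hasTemperateGrowth_fst (hasTemperateGrowth_fst .id'))
      (hasTemperateGrowth_snd (hasTemperateGrowth_snd .id')))
    (hasTemperateGrowth_snd (hasTemperateGrowth_fst .id'))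

variable (μ) in
/-- The composition `∫ K(X, Z) L(Z, Y) dZ` of Schwartz kernels. -/
noncomputable def compK (K L : 𝓢(𝔤 × 𝔤, ℂ)) : 𝓢(𝔤 × 𝔤, ℂ) :=
  fibreIntegral (𝔤 × 𝔤) μ (pullback _ _ hasTemperateGrowth_compGraph
    hasTemperateGrowth_compRetract (fun _ => rfl) (tensorCLM (𝔤 × 𝔤) L K))

theorem compK_apply (K L : 𝓢(𝔤 × 𝔤, ℂ)) (p : 𝔤 × 𝔤) :
    compK μ K L p = ∫ Z, K (p.1, Z) * L (Z, p.2) ∂μ := by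
  rw [compK, fibreIntegral_apply]
  rfl

theorem sharp_eq (f g : 𝓢(Phase 𝔤, ℂ)) :
    sharp μ ν f g = symbolOf μ (compK μ (kernelOf ν f) (kernelOf ν g)) := by
  refine toSchwartz_eq _ fun p => ?_
  rw [symbolOf_apply]
  simp only [compK_apply]
  rfl

theorem starK_compK (K L : 𝓢(𝔤 × 𝔤, ℂ)) : starK (compK μ K L) = compK μ (starK L) (starK K) := by
  ext p
  simp only [starK_apply, compK_apply, ← integral_conj, map_mul]
  simp only [mul_comm]

/-- Parseval's relation between symbols and kernels: exchange the integrals over ξ and Y, then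
substitute Y ↦ X • (-Y), which preserves the measure. -/
theorem integral_symbolOf_mul_conj (K : 𝓢(𝔤 × 𝔤, ℂ)) (k : 𝓢(Phase 𝔤, ℂ)) :
    ∫ p, symbolOf μ K p * conj (k p) ∂(μ.prod ν) =
      ∫ X, ∫ Y, K (X, Y) * conj (kernelOf ν k (X, Y)) ∂μ ∂μ := by
  rw [integral_prod _ (integrable_schwartz_mul_conj (μ.prod ν) (symbolOf μ K) k)]
  congr 1
  funext X
  set K' := pullback (fun p : 𝔤 × 𝔤 => (p.1, bch (-p.2) p.1))
    (fun p => (p.1, bch p.1 (-p.2)))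
    hasTemperateGrowth_fst_neg_bch hasTemperateGrowth_fst_bch_neg
    (fun p => Prod.ext rfl (bch_neg_neg_bch p.1 p.2)) K with hK'
  have h1 : ∀ ξ, symbolOf μ K (X, ξ) * conj (k (X, ξ)) =
      ∫ Y, conj (k (X, ξ)) * (expI (-(ξ Y)) * K' (X, Y)) ∂μ := fun ξ => by
    rw [integral_const_mul, mul_comm]
    rfl
  have hmeas : Continuous (fun q : (𝔤 →L[ℝ] ℝ) × 𝔤 => expI (-(q.1 q.2))) := by
    unfold expI
    fun_prop
  have hint : Integrable (Function.uncurry fun (ξ : 𝔤 →L[ℝ] ℝ) (Y : 𝔤) =>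
      conj (k (X, ξ)) * (expI (-(ξ Y)) * K' (X, Y))) (ν.prod μ) := by
    have h2 := (integrable_slice (μ := ν) (conjS k) X).mul_prod (integrable_slice (μ := μ) K' X)
    refine (h2.bdd_mul (c := 1) hmeas.aestronglyMeasurable
      (Filter.Eventually.of_forall fun q => (norm_expI _).le)).congr
      (Filter.Eventually.of_forall fun q => ?_)
    simp only [Function.uncurry, conjS_apply]
    ring
  simp only [h1]
  rw [integral_integral_swap hint]
  have h3 : ∀ Y, ∫ ξ, conj (k (X, ξ)) * (expI (-(ξ Y)) * K' (X, Y)) ∂ν =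
      K' (X, Y) * conj (fourierInv ν 𝔤 k (X, Y)) := fun Y => by
    rw [fourierInv_apply, ← integral_conj, ← integral_const_mul]
    congr 1
    funext ξ
    rw [map_mul, conj_expI]
    ring
  simp only [h3]
  have h4 : Continuous fun Y => K' (X, Y) * conj (fourierInv ν 𝔤 k (X, Y)) :=
    ((sliceRight X K').continuous).mul
      (Complex.continuous_conj.comp (sliceRight X (fourierInv ν 𝔤 k)).continuous)
  rw [← integral_bch_neg μ h4 X]
  congr 1
  funext Y
  rw [kernelOf_eq_fourierInv]
  congr 1
  exact congrArg (fun y => K (X, y)) (neg_bch_neg_bch X Y)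

end Kernels

/-! ### Distributional operator kernels -/

section OperatorKernel

variable {𝔤 : Type*} [RealNormedLieAlgebra 𝔤] [FiniteDimensional ℝ 𝔤] [LieRing.IsNilpotent 𝔤]
  [MeasurableSpace 𝔤] [BorelSpace 𝔤] (μ : Measure 𝔤) [μ.IsAddHaarMeasure]
  (ν : Measure (𝔤 →L[ℝ] ℝ)) [ν.IsAddHaarMeasure]

/-- The distributional integral kernel of `Op(F)`. -/
noncomputable def opKernel (F : 𝓢'(Phase 𝔤, ℂ)) : 𝓢(𝔤 × 𝔤, ℂ) →L[ℂ] ℂ :=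
  ofDist F ∘L conjCLM (symbolOf μ)

/-- The symbol with a given distributional integral kernel. -/
noncomputable def ofKernel (T : 𝓢(𝔤 × 𝔤, ℂ) →L[ℂ] ℂ) : 𝓢'(Phase 𝔤, ℂ) :=
  toDist (T ∘L conjCLM (kernelOf ν))

theorem pair_symbolOf (F : 𝓢'(Phase 𝔤, ℂ)) (K : 𝓢(𝔤 × 𝔤, ℂ)) :
    pair F (symbolOf μ K) = opKernel μ F (conjS K) := by
  simp [pair, opKernel]

theorem pair_ofKernel (T : 𝓢(𝔤 × 𝔤, ℂ) →L[ℂ] ℂ) (k : 𝓢(Phase 𝔤, ℂ)) :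
    pair (ofKernel ν T) k = T (conjS (kernelOf ν k)) := by
  simp [pair, ofKernel]

theorem opKernel_apply (F : 𝓢'(Phase 𝔤, ℂ)) (K : 𝓢(𝔤 × 𝔤, ℂ)) :
    opKernel μ F K = pair F (symbolOf μ (conjS K)) := by
  rw [pair_symbolOf, conjS_conjS]

variable {μ ν}

theorem IsDualMeasure.opKernel_ofKernel (hμν : IsDualMeasure μ ν) (T : 𝓢(𝔤 × 𝔤, ℂ) →L[ℂ] ℂ) :
    opKernel μ (ofKernel ν T) = T := by
  ext K
  rw [opKernel_apply, pair_ofKernel, hμν.kernelOf_symbolOf, conjS_conjS]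

theorem IsDualMeasure.opKernel_injective (hμν : IsDualMeasure μ ν) {F G : 𝓢'(Phase 𝔤, ℂ)}
    (h : opKernel μ F = opKernel μ G) : F = G := by
  refine ext_pair fun k => ?_
  rw [← hμν.symbolOf_kernelOf k, pair_symbolOf, pair_symbolOf, h]

/-- After a measure-preserving substitution the Wigner transform is the symbol of the rank-one
kernel v(X) conj (u(Y)). -/
theorem opForm_eq (F : 𝓢'(Phase 𝔤, ℂ)) (u v : 𝓢(𝔤, ℂ)) :
    opForm μ F u v = opKernel μ F (tensorCLM 𝔤 u (conjS v)) := by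
  have h : wigner μ u v = symbolOf μ (conjS (tensorCLM 𝔤 u (conjS v))) := by
    refine toSchwartz_eq _ fun p => ?_
    rw [symbolOf_apply, symbolOfKer, ← integral_const_mul]
    have hc : Continuous fun Y => Complex.exp (-(Complex.I * (p.2 Y : ℝ))) *
        conjS (tensorCLM 𝔤 u (conjS v)) (p.1, bch (-Y) p.1) := by
      have h1 : Continuous fun Y : 𝔤 => bch (-Y) p.1 :=
        continuous_bch_comp continuous_neg continuous_const
      have h2 := (conjS (tensorCLM 𝔤 u (conjS v))).continuous.comp
        ((continuous_const (y := p.1)).prodMk h1)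
      have h3 : Continuous fun Y : 𝔤 => Complex.exp (-(Complex.I * (p.2 Y : ℝ))) := by fun_prop
      exact h3.mul h2
    rw [← integral_bch_neg μ hc p.1]
    congr 1
    funext Y
    have h5 : conjS (tensorCLM 𝔤 u (conjS v)) (p.1, bch (-bch p.1 (-Y)) p.1) =
        v p.1 * conj (u Y) := by
      have h6 := congrArg (fun y => conjS (tensorCLM 𝔤 u (conjS v)) (p.1, y))
        (neg_bch_neg_bch p.1 Y)
      refine Eq.trans h6 ?_
      simp
    rw [h5]
    ring
  rw [opForm, h, pair_symbolOf, conjS_conjS]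

theorem pair_adjD (F : 𝓢'(Phase 𝔤, ℂ))
    (k : 𝓢(Phase 𝔤, ℂ)) : pair (adjD μ ν F) k = conj (pair F (adj μ ν k)) := by
  have hF : adjD μ ν F = ofKernel ν (conjFun (opKernel μ F ∘L swapCLM)) := by
    refine distOf_eq _ fun k => ?_
    rw [pair_ofKernel, adj_eq, pair_symbolOf, conjFun_apply, conjS_conjS, starK, conjS_conjS]
    rfl
  rw [hF, pair_ofKernel, adj_eq, pair_symbolOf, conjFun_apply, conjS_conjS, starK, conjS_conjS]
  rfl

theorem IsDualMeasure.opKernel_adjD (hμν : IsDualMeasure μ ν) (F : 𝓢'(Phase 𝔤, ℂ))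
    (K : 𝓢(𝔤 × 𝔤, ℂ)) : opKernel μ (adjD μ ν F) K = conj (opKernel μ F (starK K)) := by
  rw [opKernel_apply, pair_adjD, adj_eq, hμν.kernelOf_symbolOf, opKernel_apply]
  rfl

theorem IsDualMeasure.adjD_adjD (hμν : IsDualMeasure μ ν) (F : 𝓢'(Phase 𝔤, ℂ)) :
    adjD μ ν (adjD μ ν F) = F := by
  refine hμν.opKernel_injective ?_
  ext K
  rw [hμν.opKernel_adjD, hμν.opKernel_adjD, starK_starK, Complex.conj_conj]

end OperatorKernel

/-! ### Phase-space shifts of kernels -/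

section Shifts

variable {𝔤 : Type*} [RealNormedLieAlgebra 𝔤] [FiniteDimensional ℝ 𝔤] [LieRing.IsNilpotent 𝔤]
  {M : Type*} [NormedAddCommGroup M] [NormedSpace ℝ M]

theorem hasTemperateGrowth_bch_fst (Y : 𝔤) :
    (fun p : 𝔤 × M => (bch Y p.1, p.2)).HasTemperateGrowth :=
  hasTemperateGrowth_prodMk (hasTemperateGrowth_bch (.const Y) (hasTemperateGrowth_fst .id'))
    (hasTemperateGrowth_snd .id')

theorem hasTemperateGrowth_phase (η : 𝔤 →L[ℝ] ℝ) :
    (fun p : 𝔤 × M => expI (-(η p.1))).HasTemperateGrowth :=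
  hasTemperateGrowth_expI_comp
    (η.hasTemperateGrowth.comp (hasTemperateGrowth_fst .id')).neg

/-- The phase-space shift `e^{-iη(Y • X)} K(Y • X, W)` in the first variable. -/
noncomputable def leftShift (y : Phase 𝔤) : 𝓢(𝔤 × M, ℂ) →L[ℂ] 𝓢(𝔤 × M, ℂ) :=
  pullback (fun p : 𝔤 × M => (bch y.1 p.1, p.2)) (fun p => (bch (-y.1) p.1, p.2))
    (hasTemperateGrowth_bch_fst _) (hasTemperateGrowth_bch_fst _)
    (fun p => Prod.ext (neg_bch_bch y.1 p.1) rfl) ∘L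
  SchwartzMap.smulLeftCLM ℂ (fun p : 𝔤 × M => expI (-(y.2 p.1)))

theorem leftShift_apply (y : Phase 𝔤) (K : 𝓢(𝔤 × M, ℂ)) (p : 𝔤 × M) :
    leftShift y K p = expI (-(y.2 (bch y.1 p.1))) * K (bch y.1 p.1, p.2) := by
  rw [leftShift, ContinuousLinearMap.comp_apply, pullback_apply,
    SchwartzMap.smulLeftCLM_apply_apply (hasTemperateGrowth_phase y.2)]
  rfl

end Shifts

/-! ### The transform 𝔈_h in terms of operator kernels -/

section Transform

variable {𝔤 : Type*} [RealNormedLieAlgebra 𝔤] [FiniteDimensional ℝ 𝔤] [LieRing.IsNilpotent 𝔤]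
  [MeasurableSpace 𝔤] [BorelSpace 𝔤] {μ : Measure 𝔤} [μ.IsAddHaarMeasure]
  {ν : Measure (𝔤 →L[ℝ] ℝ)} [ν.IsAddHaarMeasure]

theorem hasTemperateGrowth_epsFun (z : Phase 𝔤) :
    (fun x : Phase 𝔤 => expI (z.2 x.1) * expI (-(x.2 z.1))).HasTemperateGrowth :=
  (hasTemperateGrowth_expI_comp
      (z.2.hasTemperateGrowth.comp (hasTemperateGrowth_fst .id'))).mul
    (hasTemperateGrowth_expI_comp
      ((ContinuousLinearMap.apply ℝ ℝ z.1).hasTemperateGrowth.comp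
        (hasTemperateGrowth_snd .id')).neg)

/-- Integrating out ξ evaluates the kernel of k on the graph Y = (-Z) • X: the operator of ε_z is a
translation by Z followed by a modulation. -/
theorem pair_eps (z : Phase 𝔤) (k : 𝓢(Phase 𝔤, ℂ)) :
    pair (eps μ ν z) k = ∫ X, expI (z.2 X) * conj (kernelOf ν k (X, bch (-z.1) X)) ∂μ := by
  have hF : eps μ ν z = toDist (SchwartzMap.integralCLM ℂ (μ.prod ν) ∘L
      SchwartzMap.smulLeftCLM ℂ (fun x : Phase 𝔤 => expI (z.2 x.1) * expI (-(x.2 z.1)))) := by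
    refine distOf_eq _ fun k => ?_
    simp only [pair, toDist_apply, ContinuousLinearMap.comp_apply, SchwartzMap.integralCLM_apply,
      SchwartzMap.smulLeftCLM_apply_apply (hasTemperateGrowth_epsFun z), exp_neg_I_mul,
      exp_I_mul, smul_eq_mul, conjS_apply]
  have h1 : pair (eps μ ν z) k =
      ∫ x, (SchwartzMap.smulLeftCLM ℂ
        (fun x : Phase 𝔤 => expI (z.2 x.1) * expI (-(x.2 z.1))) (conjS k)) x ∂(μ.prod ν) := by
    rw [hF, pair, toDist_apply, ContinuousLinearMap.comp_apply, SchwartzMap.integralCLM_apply]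
  rw [h1, integral_prod _ (SchwartzMap.integrable _)]
  congr 1
  funext X
  simp only [SchwartzMap.smulLeftCLM_apply_apply (hasTemperateGrowth_epsFun z), smul_eq_mul,
    conjS_apply, mul_assoc]
  have h2 : kernelOf ν k (X, bch (-z.1) X) = fourierInv ν 𝔤 k (X, z.1) := by
    rw [kernelOf_eq_fourierInv]
    exact congrArg (fun y => fourierInv ν 𝔤 k (X, y)) (bch_neg_neg_bch X z.1)
  rw [integral_const_mul, h2, fourierInv_apply, ← integral_conj]
  simp only [map_mul, conj_expI]

theorem continuous_comp_neg_bch (K : 𝓢(𝔤 × 𝔤, ℂ)) (Z : 𝔤) :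
    Continuous fun X => K (X, bch (-Z) X) :=
  K.continuous.comp (continuous_id.prodMk (continuous_bch_comp continuous_const continuous_id))

theorem continuous_expI_comp (ζ : 𝔤 →L[ℝ] ℝ) : Continuous fun X => expI (ζ X) := by
  unfold expI
  fun_prop

/-- `leftShift z` is Op(ε_z)* acting on the first kernel variable, and Op(h) Op(ε_z) is the adjoint
of Op(ε_z)* Op(h)*. That h # ε_z is a Schwartz function ensures that `schwartzRep` does not take its
default value. -/
theorem IsDualMeasure.sharpSD_eps (hμν : IsDualMeasure μ ν) (h : 𝓢(Phase 𝔤, ℂ)) (z : Phase 𝔤) :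
    sharpSD μ ν h (eps μ ν z) =
      schwartzDist (μ.prod ν) (symbolOf μ (starK (leftShift z (starK (kernelOf ν h))))) := by
  refine distOf_eq _ fun k => ?_
  set L := starK (leftShift z (starK (kernelOf ν h))) with hL
  rw [pair_schwartzDist, integral_symbolOf_mul_conj, pair_eps, sharp_eq, adj_eq,
    hμν.kernelOf_symbolOf, hμν.kernelOf_symbolOf]
  have hc : Continuous fun X => expI (z.2 X) *
      conj (compK μ (starK (kernelOf ν h)) (kernelOf ν k) (X, bch (-z.1) X)) :=
    (continuous_expI_comp z.2).mul
      (Complex.continuous_conj.comp (continuous_comp_neg_bch _ z.1))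
  have hi := integrable_schwartz_mul_conj (μ.prod μ) L (kernelOf ν k)
  rw [← integral_bch_left μ hc z.1, integral_integral_swap hi]
  congr 1
  funext Y
  have h1 : compK μ (starK (kernelOf ν h)) (kernelOf ν k) (bch z.1 Y, bch (-z.1) (bch z.1 Y)) =
      compK μ (starK (kernelOf ν h)) (kernelOf ν k) (bch z.1 Y, Y) :=
    congrArg (fun y => compK μ (starK (kernelOf ν h)) (kernelOf ν k) (bch z.1 Y, y))
      (neg_bch_bch z.1 Y)
  refine Eq.trans ?_ (congrArg (fun c => expI (z.2 (bch z.1 Y)) * conj c) h1).symm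
  simp only [compK_apply, ← integral_conj, ← integral_const_mul]
  congr 1
  funext V
  rw [hL, starK_apply, leftShift_apply]
  simp only [starK_apply, map_mul, conj_expI, neg_neg, Complex.conj_conj]
  ring

theorem IsDualMeasure.sharpDS_adjD_eps (hμν : IsDualMeasure μ ν) (k₀ : 𝓢(Phase 𝔤, ℂ))
    (y : Phase 𝔤) : sharpDS μ ν (adjD μ ν (eps μ ν y)) k₀ =
      schwartzDist (μ.prod ν) (symbolOf μ (leftShift y (kernelOf ν k₀))) := by
  refine distOf_eq _ fun k => ?_
  set L := leftShift y (kernelOf ν k₀) with hL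
  rw [pair_schwartzDist, integral_symbolOf_mul_conj, pair_adjD, pair_eps, sharp_eq, adj_eq,
    adj_eq, hμν.kernelOf_symbolOf, hμν.kernelOf_symbolOf, hμν.kernelOf_symbolOf, starK_compK,
    starK_starK, ← integral_conj]
  simp only [map_mul, conj_expI, Complex.conj_conj]
  have hc : Continuous fun X => expI (-(y.2 X)) *
      compK μ (kernelOf ν k₀) (starK (kernelOf ν k)) (X, bch (-y.1) X) :=
    (continuous_expI_comp (-y.2)).mul (continuous_comp_neg_bch _ y.1)
  rw [← integral_bch_left μ hc y.1]
  congr 1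
  funext V
  have h1 : compK μ (kernelOf ν k₀) (starK (kernelOf ν k)) (bch y.1 V, bch (-y.1) (bch y.1 V)) =
      compK μ (kernelOf ν k₀) (starK (kernelOf ν k)) (bch y.1 V, V) :=
    congrArg (fun v => compK μ (kernelOf ν k₀) (starK (kernelOf ν k)) (bch y.1 V, v))
      (neg_bch_bch y.1 V)
  refine Eq.trans ?_ (congrArg (fun c => expI (-(y.2 (bch y.1 V))) * c) h1).symm
  rw [compK_apply, ← integral_const_mul]
  congr 1
  funext Z
  rw [hL, leftShift_apply]
  simp only [starK_apply]
  ring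

/-- Both shifts are moved to the other side of the pairing, where ε_y^# # (h # ε_z) is a Schwartz
symbol with an explicit kernel. -/
theorem IsDualMeasure.frakE_eq (hμν : IsDualMeasure μ ν) (h : 𝓢(Phase 𝔤, ℂ))
    (f : 𝓢'(Phase 𝔤, ℂ)) (y z : Phase 𝔤) : frakE μ ν h f (y, z) =
      opKernel μ f (conjS (leftShift y (starK (leftShift z (starK (kernelOf ν h)))))) := by
  have hMD : ∀ k, pair (sharpMD μ ν (eps μ ν y) f) k =
      opKernel μ f (conjS (leftShift y (kernelOf ν k))) := fun k => by
    have h1 : ∀ k, schwartzRep (μ.prod ν) (sharpDS μ ν (adjD μ ν (eps μ ν y)) k) =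
        symbolOf μ (leftShift y (kernelOf ν k)) := fun k =>
      schwartzRep_eq _ _ fun φ => by rw [hμν.sharpDS_adjD_eps, pair_schwartzDist]
    have h2 : sharpMD μ ν (eps μ ν y) f =
        pullDist f (symbolOf μ ∘L leftShift y ∘L kernelOf ν) :=
      distOf_eq _ fun k => by rw [h1, pair_pullDist]; rfl
    rw [h2, pair_pullDist, ContinuousLinearMap.comp_apply, pair_symbolOf]
    rfl
  have h3 : ∀ k, schwartzRep (μ.prod ν) (sharpSD μ ν k (adjD μ ν (adjD μ ν (eps μ ν z)))) =
      symbolOf μ (starK (leftShift z (starK (kernelOf ν k)))) := fun k =>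
    schwartzRep_eq _ _ fun φ => by rw [hμν.adjD_adjD, hμν.sharpSD_eps, pair_schwartzDist]
  have h4 : theta μ ν y z f = pullDist (sharpMD μ ν (eps μ ν y) f)
      (symbolOf μ ∘L swapCLM ∘L conjCLM (leftShift z) ∘L swapCLM ∘L kernelOf ν) :=
    distOf_eq _ fun k => by rw [h3, pair_pullDist]; rfl
  have h5 : (symbolOf μ ∘L swapCLM ∘L conjCLM (leftShift z) ∘L swapCLM ∘L kernelOf ν) h =
      symbolOf μ (starK (leftShift z (starK (kernelOf ν h)))) := rfl
  rw [frakE, h4, pair_pullDist, h5, hMD, hμν.kernelOf_symbolOf]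

end Transform

/-! ### Projections with Schwartz kernel have finite rank -/

section Projection

variable {E : Type*} [NormedAddCommGroup E] [NormedSpace ℝ E] [FiniteDimensional ℝ E]
  [MeasurableSpace E] [BorelSpace E] {μ : Measure E} [μ.IsAddHaarMeasure]

/-- A Schwartz kernel which is idempotent and self-adjoint. -/
structure IsProjection (μ : Measure E) (P : 𝓢(E × E, ℂ)) : Prop where
  idem : ∀ X Y, ∫ Z, P (X, Z) * P (Z, Y) ∂μ = P (X, Y)
  symm : ∀ X Y, conj (P (Y, X)) = P (X, Y)

theorem integral_mul_conj_self (f : 𝓢(E, ℂ)) :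
    ∫ x, f x * conj (f x) ∂μ = ((∫ x, ‖f x‖ ^ 2 ∂μ : ℝ) : ℂ) := by
  refine Eq.trans ?_ (integral_complex_ofReal (f := fun x => ‖f x‖ ^ 2))
  congr 1
  funext x
  rw [Complex.mul_conj, Complex.normSq_eq_norm_sq]

/-- Restriction of a kernel to the diagonal. -/
noncomputable def diagonalCLM : 𝓢(E × E, ℂ) →L[ℂ] 𝓢(E, ℂ) :=
  pullback (fun x => (x, x)) Prod.fst (hasTemperateGrowth_prodMk .id' .id')
    (hasTemperateGrowth_fst .id') (fun _ => rfl)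

/-- By idempotency and symmetry the diagonal value P(X, X) is ∫ |P(X, Z)|² dZ. -/
theorem IsProjection.trace_nonneg {P : 𝓢(E × E, ℂ)} (hP : IsProjection μ P) :
    0 ≤ (∫ X, P (X, X) ∂μ).re := by
  have h : ∀ X, P (X, X) = ((∫ Z, ‖P (X, Z)‖ ^ 2 ∂μ : ℝ) : ℂ) := fun X => by
    rw [← hP.idem X X]
    refine Eq.trans ?_ (integral_mul_conj_self (sliceRight X P))
    congr 1
    funext Z
    rw [← hP.symm Z X]
    rfl
  simp only [h]
  rw [integral_complex_ofReal, Complex.ofReal_re]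
  exact integral_nonneg fun X => integral_nonneg fun Z => by positivity

/-- Idempotency says that every column P(·, Y₀) is fixed by P; a nonzero column is normalised. -/
theorem IsProjection.exists_fixed {P : 𝓢(E × E, ℂ)} (hP : IsProjection μ P) (h0 : P ≠ 0) :
    ∃ e : 𝓢(E, ℂ), (∀ X, ∫ Z, P (X, Z) * e Z ∂μ = e X) ∧ ∫ X, e X * conj (e X) ∂μ = 1 := by
  obtain ⟨⟨X₀, Y₀⟩, hXY⟩ : ∃ p, P p ≠ 0 := by
    by_contra! h
    exact h0 (by ext p; simpa using h p)
  set f := sliceLeft Y₀ P with hf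
  have hf0 : f ≠ 0 := fun h => hXY (by
    have := congrArg (fun g : 𝓢(E, ℂ) => g X₀) h
    simpa [hf] using this)
  set r : ℝ := ∫ x, ‖f x‖ ^ 2 ∂μ with hr
  have hr0 : 0 < r := by
    refine lt_of_le_of_ne (integral_nonneg fun x => by positivity) fun h => hf0 ?_
    refine eq_zero_of_integral_mul_conj_self μ ?_
    rw [integral_mul_conj_self, ← hr, ← h, Complex.ofReal_zero]
  obtain ⟨c, hc⟩ : ∃ c : ℝ, c * c * r = 1 := ⟨(Real.sqrt r)⁻¹, by
    rw [← mul_inv, Real.mul_self_sqrt hr0.le, inv_mul_cancel₀ hr0.ne']⟩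
  refine ⟨(c : ℂ) • f, fun X => ?_, ?_⟩
  · have h1 : ∀ Z, P (X, Z) * ((c : ℂ) • f) Z =
        (c : ℂ) * (P (X, Z) * P (Z, Y₀)) := fun Z => by
      simp only [smul_apply, hf, sliceLeft_apply, smul_eq_mul]
      ring
    simp only [h1]
    rw [integral_const_mul, hP.idem]
    simp [hf]
  · have h1 : ∀ x, ((c : ℂ) • f) x * conj (((c : ℂ) • f) x) =
        (c * c : ℂ) * (f x * conj (f x)) := fun x => by
      simp only [smul_apply, smul_eq_mul, map_mul, Complex.conj_ofReal]
      ring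
    simp only [h1]
    rw [integral_const_mul, integral_mul_conj_self, ← hr]
    exact_mod_cast hc

theorem IsProjection.sub_rankOne {P : 𝓢(E × E, ℂ)} (hP : IsProjection μ P) {e : 𝓢(E, ℂ)}
    (he : ∀ X, ∫ Z, P (X, Z) * e Z ∂μ = e X) (he1 : ∫ X, e X * conj (e X) ∂μ = 1) :
    IsProjection μ (P - tensorCLM E (conjS e) e) where
  idem X Y := by
    have h1 : ∀ Z, (P - tensorCLM E (conjS e) e) (X, Z) * (P - tensorCLM E (conjS e) e) (Z, Y) =
        (P (X, Z) * P (Z, Y) - e X * conj (P (Y, Z) * e Z)) -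
          (P (X, Z) * e Z * conj (e Y) - e X * conj (e Y) * (e Z * conj (e Z))) := fun Z => by
      simp only [sub_apply, tensorCLM_apply, conjS_apply, map_mul, hP.symm]
      ring
    have i1 : Integrable (fun Z => P (X, Z) * P (Z, Y)) μ :=
      integrable_schwartz_mul μ (sliceRight X P) (sliceLeft Y P)
    have i2 : Integrable (fun Z => e X * conj (P (Y, Z) * e Z)) μ :=
      (integrable_schwartz_mul μ (conjS (sliceRight Y P)) (conjS e)).const_mul (e X) |>.congr
        (Filter.Eventually.of_forall fun Z => by simp)
    have i3 : Integrable (fun Z => P (X, Z) * e Z * conj (e Y)) μ :=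
      (integrable_schwartz_mul μ (sliceRight X P) e).mul_const _
    have i4 : Integrable (fun Z => e X * conj (e Y) * (e Z * conj (e Z))) μ :=
      (integrable_schwartz_mul_conj μ e e).const_mul _
    have i12 : Integrable (fun Z => P (X, Z) * P (Z, Y) - e X * conj (P (Y, Z) * e Z)) μ :=
      i1.sub i2
    have i34 : Integrable (fun Z => P (X, Z) * e Z * conj (e Y) -
      e X * conj (e Y) * (e Z * conj (e Z))) μ := i3.sub i4
    simp only [h1]
    rw [integral_sub i12 i34, integral_sub i1 i2, integral_sub i3 i4, hP.idem,
      integral_const_mul, integral_conj, he, integral_mul_const, he, integral_const_mul, he1]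
    simp
  symm X Y := by
    simp only [sub_apply, tensorCLM_apply, conjS_apply, map_sub, map_mul, hP.symm,
      Complex.conj_conj, mul_comm]

/-- Splitting off a fixed unit vector leaves a projection whose trace is smaller by one. Since
traces are nonnegative, the process stops. -/
theorem IsProjection.exists_orthonormal_of_trace_lt (n : ℕ) : ∀ {P : 𝓢(E × E, ℂ)},
    IsProjection μ P → (∫ X, P (X, X) ∂μ).re < n → ∃ (m : ℕ) (e : Fin m → 𝓢(E, ℂ)),
      (∀ i X, ∫ Z, P (X, Z) * e i Z ∂μ = e i X) ∧
      (∀ i j, ∫ X, e i X * conj (e j X) ∂μ = if i = j then 1 else 0) ∧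
      ∀ X Y, P (X, Y) = ∑ i, e i X * conj (e i Y) := by
  induction n with
  | zero =>
    intro P hP h
    exact absurd h (by simpa using hP.trace_nonneg)
  | succ n ih =>
    intro P hP h
    by_cases h0 : P = 0
    · exact ⟨0, fun i => i.elim0, fun i => i.elim0, fun i => i.elim0, fun X Y => by simp [h0]⟩
    obtain ⟨e, he, he1⟩ := hP.exists_fixed h0
    set P' := P - tensorCLM E (conjS e) e with hP'
    have hproj : IsProjection μ P' := hP.sub_rankOne he he1
    have htr : ∫ X, P' (X, X) ∂μ = ∫ X, P (X, X) ∂μ - 1 := by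
      have hd : Integrable (fun X => P (X, X)) μ := (diagonalCLM P).integrable
      rw [← he1, ← integral_sub hd (integrable_schwartz_mul_conj μ e e)]
      rfl
    obtain ⟨m, f, hf, hfo, hfs⟩ := ih hproj (by
      rw [htr, Complex.sub_re, Complex.one_re]
      push_cast at h
      linarith)
    have happ : ∀ g : 𝓢(E, ℂ), ∀ X, ∫ Z, P' (X, Z) * g Z ∂μ =
        ∫ Z, P (X, Z) * g Z ∂μ - e X * ∫ Z, g Z * conj (e Z) ∂μ := fun g X => by
      have hi : Integrable (fun Z => P (X, Z) * g Z) μ :=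
        integrable_schwartz_mul μ (sliceRight X P) g
      rw [← integral_const_mul, ← integral_sub hi
        ((integrable_schwartz_mul_conj μ g e).const_mul _)]
      congr 1
      funext Z
      simp only [hP', sub_apply, tensorCLM_apply, conjS_apply]
      ring
    -- f i lies in the range of the self-adjoint P', and P' annihilates e.
    have hort : ∀ i, ∫ X, f i X * conj (e X) ∂μ = 0 := fun i => by
      have h1 : ∀ X, f i X * conj (e X) = ∫ Z, P' (X, Z) * f i Z * conj (e X) ∂μ := fun X => by
        rw [integral_mul_const, hf]
      simp only [h1]
      have hint : Integrable (Function.uncurry fun X Z => P' (X, Z) * f i Z * conj (e X))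
          (μ.prod μ) := by
        refine (integrable_schwartz_mul_conj (μ.prod μ) P'
          (tensorCLM E (conjS (f i)) e)).congr (Filter.Eventually.of_forall fun p => ?_)
        simp [Function.uncurry]
        ring
      rw [integral_integral_swap hint]
      have h2 : ∀ Z, ∫ X, P' (X, Z) * f i Z * conj (e X) ∂μ = 0 := fun Z => by
        have h3 : ∀ X, P' (X, Z) * f i Z * conj (e X) = f i Z * conj (P' (Z, X) * e X) :=
          fun X => by
            rw [map_mul, hproj.symm]
            ring
        simp only [h3]
        rw [integral_const_mul, integral_conj, happ, he, he1]
        simp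
      simp [h2]
    have hort' : ∀ i, ∫ X, e X * conj (f i X) ∂μ = 0 := fun i => by
      have := congrArg conj (hort i)
      rw [← integral_conj] at this
      simpa [mul_comm] using this
    refine ⟨m + 1, Fin.cons e f, fun i => ?_, fun i j => ?_, fun X Y => ?_⟩
    · refine Fin.cases ?_ (fun i => ?_) i
      · exact he
      · intro X
        have := happ (f i) X
        rw [hf, hort, mul_zero, sub_zero] at this
        exact this.symm
    · refine Fin.cases ?_ (fun i => ?_) i <;> refine Fin.cases ?_ (fun j => ?_) j
      · simpa using he1
      · simpa [(Fin.succ_ne_zero j).symm] using hort' j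
      · simpa [Fin.succ_ne_zero i] using hort i
      · simpa using hfo i j
    · rw [Fin.sum_univ_succ]
      simp only [Fin.cons_zero, Fin.cons_succ]
      rw [← hfs X Y]
      simp [hP']

theorem IsProjection.exists_orthonormal {P : 𝓢(E × E, ℂ)} (hP : IsProjection μ P) :
    ∃ (m : ℕ) (e : Fin m → 𝓢(E, ℂ)),
      (∀ i X, ∫ Z, P (X, Z) * e i Z ∂μ = e i X) ∧
      (∀ i j, ∫ X, e i X * conj (e j X) ∂μ = if i = j then 1 else 0) ∧
      ∀ X Y, P (X, Y) = ∑ i, e i X * conj (e i Y) := by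
  obtain ⟨n, hn⟩ := exists_nat_gt (∫ X, P (X, X) ∂μ).re
  exact IsProjection.exists_orthonormal_of_trace_lt n hP hn

end Projection

/-! ### Coefficients with respect to shifted windows and reconstruction -/

section Coefficients

variable {𝔤 : Type*} [RealNormedLieAlgebra 𝔤] [FiniteDimensional ℝ 𝔤] [LieRing.IsNilpotent 𝔤]
  [MeasurableSpace 𝔤] [BorelSpace 𝔤] {μ : Measure 𝔤} [μ.IsAddHaarMeasure]
  {ν : Measure (𝔤 →L[ℝ] ℝ)} [ν.IsAddHaarMeasure]
  {M : Type*} [NormedAddCommGroup M] [NormedSpace ℝ M]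

/-- The phase-space shift `e^{-iζ(Z • X)} e(Z • X)`. -/
noncomputable def shiftCLM (x : Phase 𝔤) : 𝓢(𝔤, ℂ) →L[ℂ] 𝓢(𝔤, ℂ) :=
  pullback (bch x.1) (bch (-x.1)) (hasTemperateGrowth_bch (.const _) .id')
    (hasTemperateGrowth_bch (.const _) .id') (neg_bch_bch x.1) ∘L
  SchwartzMap.smulLeftCLM ℂ (fun X => expI (-(x.2 X)))

theorem shiftCLM_apply (x : Phase 𝔤) (e : 𝓢(𝔤, ℂ)) (X : 𝔤) :
    shiftCLM x e X = expI (-(x.2 (bch x.1 X))) * e (bch x.1 X) := by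
  rw [shiftCLM, ContinuousLinearMap.comp_apply, pullback_apply,
    SchwartzMap.smulLeftCLM_apply_apply
      (show (fun X : 𝔤 => expI (-(x.2 X))).HasTemperateGrowth from
        hasTemperateGrowth_expI_comp x.2.hasTemperateGrowth.neg)]
  rfl

theorem hasTemperateGrowth_coeffGraph : (fun p : (𝔤 × M) × 𝔤 =>
    ((bch (-p.1.1) p.2, p.1.2), p.2)).HasTemperateGrowth :=
  hasTemperateGrowth_prodMk
    (hasTemperateGrowth_prodMk (hasTemperateGrowth_bch
      (hasTemperateGrowth_fst (hasTemperateGrowth_fst .id')).neg (hasTemperateGrowth_snd .id'))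
      (hasTemperateGrowth_snd (hasTemperateGrowth_fst .id')))
    (hasTemperateGrowth_snd .id')

theorem hasTemperateGrowth_coeffRetract : (fun p : (𝔤 × M) × 𝔤 =>
    ((bch p.2 (-p.1.1), p.1.2), p.2)).HasTemperateGrowth :=
  hasTemperateGrowth_prodMk
    (hasTemperateGrowth_prodMk (hasTemperateGrowth_bch
      (hasTemperateGrowth_snd .id') (hasTemperateGrowth_fst (hasTemperateGrowth_fst .id')).neg)
      (hasTemperateGrowth_snd (hasTemperateGrowth_fst .id')))
    (hasTemperateGrowth_snd .id')

theorem hasTemperateGrowth_phaseGraph : (fun q : Phase 𝔤 × M =>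
    ((q.1.1, q.2), q.1.2)).HasTemperateGrowth :=
  hasTemperateGrowth_prodMk
    (hasTemperateGrowth_prodMk (hasTemperateGrowth_fst (hasTemperateGrowth_fst .id'))
      (hasTemperateGrowth_snd .id'))
    (hasTemperateGrowth_snd (hasTemperateGrowth_fst .id'))

theorem hasTemperateGrowth_phaseRetract : (fun q : (𝔤 × M) × (𝔤 →L[ℝ] ℝ) =>
    (((q.1.1, q.2), q.1.2) : Phase 𝔤 × M)).HasTemperateGrowth :=
  hasTemperateGrowth_prodMk
    (hasTemperateGrowth_prodMk (hasTemperateGrowth_fst (hasTemperateGrowth_fst .id'))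
      (hasTemperateGrowth_snd .id'))
    (hasTemperateGrowth_snd (hasTemperateGrowth_fst .id'))

variable (μ M) in
/-- The coefficients `∫ Φ(V, m) conj (U_x e)(V) dV` of `Φ` with respect to the shifts `U_x e`
of the window `e`. -/
noncomputable def coeff (e : 𝓢(𝔤, ℂ)) : 𝓢(𝔤 × M, ℂ) →L[ℂ] 𝓢(Phase 𝔤 × M, ℂ) :=
  pullback _ _ hasTemperateGrowth_phaseGraph hasTemperateGrowth_phaseRetract (fun _ => rfl) ∘L
    fourierPos μ (𝔤 × M) ∘L
    pullback _ _ hasTemperateGrowth_coeffGraph hasTemperateGrowth_coeffRetract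
      (fun p => by
        refine Prod.ext (Prod.ext ?_ rfl) rfl
        exact bch_neg_neg_bch p.2 p.1.1) ∘L
    tensorCLM (𝔤 × M) (conjS e)

theorem coeff_apply_fourier (e : 𝓢(𝔤, ℂ)) (Φ : 𝓢(𝔤 × M, ℂ)) (x : Phase 𝔤) (m : M) :
    coeff μ M e Φ (x, m) =
      ∫ X, expI (x.2 X) * (Φ (bch (-x.1) X, m) * conj (e X)) ∂μ := rfl

/-- The Fourier form of the definition shows that the coefficients are Schwartz functions of x; a
left translation turns it into the pairing with U_x e. -/
theorem coeff_apply (e : 𝓢(𝔤, ℂ)) (Φ : 𝓢(𝔤 × M, ℂ)) (x : Phase 𝔤) (m : M) :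
    coeff μ M e Φ (x, m) = ∫ V, Φ (V, m) * conj (shiftCLM x e V) ∂μ := by
  have hc : Continuous fun X => expI (x.2 X) * (Φ (bch (-x.1) X, m) * conj (e X)) := by
    have h1 : Continuous fun X : 𝔤 => (bch (-x.1) X, m) :=
      (continuous_bch_comp continuous_const continuous_id).prodMk continuous_const
    exact (continuous_expI_comp x.2).mul ((Φ.continuous.comp h1).mul
      (Complex.continuous_conj.comp e.continuous))
  rw [coeff_apply_fourier, ← integral_bch_left μ hc x.1]
  congr 1
  funext V
  have h2 := congrArg (fun y => Φ (y, m)) (neg_bch_bch x.1 V)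
  have h3 : ∀ c : ℂ, expI (x.2 (bch x.1 V)) * (c * conj (e (bch x.1 V))) =
      c * conj (shiftCLM x e V) := fun c => by
    rw [shiftCLM_apply, map_mul, conj_expI, neg_neg]
    ring
  rw [h3]
  exact congrArg (fun c => c * conj (shiftCLM x e V)) h2

theorem hasTemperateGrowth_synthGraph : (fun p : (𝔤 × M) × Phase 𝔤 =>
    (((p.2, p.1.2), bch p.2.1 p.1.1) : (Phase 𝔤 × M) × 𝔤)).HasTemperateGrowth :=
  hasTemperateGrowth_prodMk
    (hasTemperateGrowth_prodMk (hasTemperateGrowth_snd .id')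
      (hasTemperateGrowth_snd (hasTemperateGrowth_fst .id')))
    (hasTemperateGrowth_bch (hasTemperateGrowth_fst (hasTemperateGrowth_snd .id'))
      (hasTemperateGrowth_fst (hasTemperateGrowth_fst .id')))

theorem hasTemperateGrowth_synthRetract : (fun q : (Phase 𝔤 × M) × 𝔤 =>
    (((bch (-q.1.1.1) q.2, q.1.2), q.1.1) : (𝔤 × M) × Phase 𝔤)).HasTemperateGrowth :=
  hasTemperateGrowth_prodMk
    (hasTemperateGrowth_prodMk
      (hasTemperateGrowth_bch
        (hasTemperateGrowth_fst (hasTemperateGrowth_fst (hasTemperateGrowth_fst .id'))).neg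
        (hasTemperateGrowth_snd .id'))
      (hasTemperateGrowth_snd (hasTemperateGrowth_fst .id')))
    (hasTemperateGrowth_fst (hasTemperateGrowth_fst .id'))

theorem hasTemperateGrowth_synthPhase : (fun q : (Phase 𝔤 × M) × 𝔤 =>
    expI (-(q.1.1.2 q.2))).HasTemperateGrowth :=
  hasTemperateGrowth_expI_comp
    (((ContinuousLinearMap.id ℝ (𝔤 →L[ℝ] ℝ)).bilinear_hasTemperateGrowth
      (hasTemperateGrowth_snd (hasTemperateGrowth_fst (hasTemperateGrowth_fst .id')))
      (hasTemperateGrowth_snd .id')).neg)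

variable (M) in
/-- The function `Ψ(x, m) (U_x e)(X)` of `((X, m), x)`. -/
noncomputable def synth (e : 𝓢(𝔤, ℂ)) : 𝓢(Phase 𝔤 × M, ℂ) →L[ℂ] 𝓢((𝔤 × M) × Phase 𝔤, ℂ) :=
  pullback _ _ hasTemperateGrowth_synthGraph hasTemperateGrowth_synthRetract
      (fun p => by
        refine Prod.ext (Prod.ext ?_ rfl) rfl
        exact neg_bch_bch p.2.1 p.1.1) ∘L
    SchwartzMap.smulLeftCLM ℂ (fun q : (Phase 𝔤 × M) × 𝔤 => expI (-(q.1.1.2 q.2))) ∘L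
    tensorCLM (Phase 𝔤 × M) e

theorem synth_apply (e : 𝓢(𝔤, ℂ)) (Ψ : 𝓢(Phase 𝔤 × M, ℂ)) (X : 𝔤) (m : M) (x : Phase 𝔤) :
    synth M e Ψ ((X, m), x) = Ψ (x, m) * shiftCLM x e X := by
  rw [synth, ContinuousLinearMap.comp_apply, pullback_apply, ContinuousLinearMap.comp_apply,
    SchwartzMap.smulLeftCLM_apply_apply hasTemperateGrowth_synthPhase, shiftCLM_apply,
    tensorCLM_apply, smul_eq_mul]
  ring

theorem sliceLeft_synth (e : 𝓢(𝔤, ℂ)) (Ψ : 𝓢(Phase 𝔤 × M, ℂ)) (x : Phase 𝔤) :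
    sliceLeft x (synth M e Ψ) = swapCLM (tensorCLM M (shiftCLM x e) (sliceRight x Ψ)) := by
  ext ⟨X, m⟩
  rw [sliceLeft_apply, synth_apply]
  rfl

/-- The resolution of the identity. The integral over η is a Fourier inversion at Y • X and leaves
Φ(X, m) e'(Y • X) conj (e(Y • X)); the integral over Y is then ⟨e', e⟩ by invariance under right
translation. -/
theorem IsDualMeasure.fibreIntegral_synth_coeff (hμν : IsDualMeasure μ ν) (e e' : 𝓢(𝔤, ℂ))
    (Φ : 𝓢(𝔤 × M, ℂ)) : fibreIntegral (𝔤 × M) (μ.prod ν) (synth M e' (coeff μ M e Φ)) =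
      (∫ X, e' X * conj (e X) ∂μ) • Φ := by
  ext ⟨X, m⟩
  have hint : Integrable (fun x => synth M e' (coeff μ M e Φ) ((X, m), x)) (μ.prod ν) :=
    integrable_slice _ (synth M e' (coeff μ M e Φ)) (X, m)
  rw [fibreIntegral_apply, integral_prod _ hint]
  have h1 : ∀ Y, ∫ η, synth M e' (coeff μ M e Φ) ((X, m), (Y, η)) ∂ν =
      Φ (X, m) * (e' (bch Y X) * conj (e (bch Y X))) := fun Y => by
    set Θ := pullback _ _ (hasTemperateGrowth_coeffGraph (𝔤 := 𝔤) (M := M))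
      hasTemperateGrowth_coeffRetract
      (fun p => by
        refine Prod.ext (Prod.ext ?_ rfl) rfl
        exact bch_neg_neg_bch p.2 p.1.1) (tensorCLM (𝔤 × M) (conjS e) Φ) with hΘ
    have h2 : ∀ η, synth M e' (coeff μ M e Φ) ((X, m), (Y, η)) =
        e' (bch Y X) * (expI (-(η (bch Y X))) *
          ∫ V, expI (η V) * sliceRight (Y, m) Θ V ∂μ) := fun η => by
      rw [synth_apply, shiftCLM_apply]
      have h3 : coeff μ M e Φ ((Y, η), m) = ∫ V, expI (η V) * sliceRight (Y, m) Θ V ∂μ := rfl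
      rw [h3]
      ring
    simp only [h2]
    rw [integral_const_mul, hμν.inversion_conj]
    have h4 : sliceRight (Y, m) Θ (bch Y X) = Φ (bch (-Y) (bch Y X), m) * conj (e (bch Y X)) :=
      rfl
    rw [h4]
    have h5 := congrArg (fun y => Φ (y, m)) (neg_bch_bch Y X)
    have h6 : Φ (bch (-Y) (bch Y X), m) = Φ (X, m) := h5
    rw [h6]
    ring
  simp only [h1]
  rw [integral_const_mul]
  have hc : Continuous fun Y => e' Y * conj (e Y) :=
    e'.continuous.mul (Complex.continuous_conj.comp e.continuous)
  rw [integral_bch_right μ hc X, mul_comm]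
  rfl

/-- Reconstruction of a functional from its values on shifts of the window. -/
theorem IsDualMeasure.integrable_and_apply_eq (hμν : IsDualMeasure μ ν) (e e' : 𝓢(𝔤, ℂ))
    (T : 𝓢(𝔤 × M, ℂ) →L[ℂ] ℂ) (Φ : 𝓢(𝔤 × M, ℂ)) :
    Integrable (fun x => T (swapCLM (tensorCLM M (shiftCLM x e')
      (sliceRight x (coeff μ M e Φ))))) (μ.prod ν) ∧
    (∫ X, e' X * conj (e X) ∂μ) * T Φ = ∫ x, T (swapCLM (tensorCLM M (shiftCLM x e')
      (sliceRight x (coeff μ M e Φ)))) ∂(μ.prod ν) := by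
  have h := integrable_and_apply_fibreIntegral (μ.prod ν) T (synth M e' (coeff μ M e Φ))
  rw [hμν.fibreIntegral_synth_coeff, map_smul, smul_eq_mul] at h
  simpa only [sliceLeft_synth] using h

end Coefficients

/-! ### Sesquilinear forms of operators and their reconstruction -/

section Forms

variable {𝔤 : Type*} [RealNormedLieAlgebra 𝔤] [FiniteDimensional ℝ 𝔤] [LieRing.IsNilpotent 𝔤]
  [MeasurableSpace 𝔤] [BorelSpace 𝔤] {μ : Measure 𝔤} [μ.IsAddHaarMeasure]
  {ν : Measure (𝔤 →L[ℝ] ℝ)} [ν.IsAddHaarMeasure]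

variable (μ) in
/-- The coefficients `∫ u(V) conj (U_x e)(V) dV` of a Schwartz function. -/
noncomputable def wav (e : 𝓢(𝔤, ℂ)) : 𝓢(𝔤, ℂ) →L[ℂ] 𝓢(Phase 𝔤, ℂ) :=
  pullback (fun x : Phase 𝔤 => (x, (0 : Fin 0 → ℝ))) Prod.fst
    (hasTemperateGrowth_prodMk .id' (.const _)) (hasTemperateGrowth_fst .id') (fun _ => rfl) ∘L
  coeff μ (Fin 0 → ℝ) e ∘L
  pullback Prod.fst (fun X : 𝔤 => (X, (0 : Fin 0 → ℝ)))
    (hasTemperateGrowth_fst .id') (hasTemperateGrowth_prodMk .id' (.const _))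
    (fun _ => Prod.ext rfl (Subsingleton.elim _ _))

theorem wav_apply (e u : 𝓢(𝔤, ℂ)) (x : Phase 𝔤) :
    wav μ e u x = ∫ V, u V * conj (shiftCLM x e V) ∂μ :=
  coeff_apply (M := Fin 0 → ℝ) e _ x 0

theorem sliceRight_coeff_tensor {M : Type*} [NormedAddCommGroup M] [NormedSpace ℝ M]
    (e u : 𝓢(𝔤, ℂ)) (w : 𝓢(M, ℂ)) (x : Phase 𝔤) :
    sliceRight x (coeff μ M e (tensorCLM 𝔤 w u)) = wav μ e u x • w := by
  ext m
  rw [sliceRight_apply, coeff_apply, smul_apply, wav_apply, smul_eq_mul, ← integral_mul_const]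
  congr 1
  funext V
  rw [tensorCLM_apply]
  ring

theorem swapCLM_tensorCLM {V W : Type*} [NormedAddCommGroup V] [NormedSpace ℝ V]
    [NormedAddCommGroup W] [NormedSpace ℝ W] (f : 𝓢(V, ℂ)) (g : 𝓢(W, ℂ)) :
    swapCLM (tensorCLM W f g) = tensorCLM V g f := by
  ext p
  simp [mul_comm]

theorem IsDualMeasure.opForm_adjD (hμν : IsDualMeasure μ ν) (F : 𝓢'(Phase 𝔤, ℂ))
    (u v : 𝓢(𝔤, ℂ)) : opForm μ (adjD μ ν F) u v = conj (opForm μ F v u) := by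
  rw [opForm_eq, opForm_eq, hμν.opKernel_adjD]
  congr 2
  ext p
  simp [mul_comm]

theorem IsDualMeasure.opForm_reconstruct (hμν : IsDualMeasure μ ν) (F : 𝓢'(Phase 𝔤, ℂ))
    (e e' u v : 𝓢(𝔤, ℂ)) :
    Integrable (fun x => wav μ e u x * opForm μ F (shiftCLM x e') v) (μ.prod ν) ∧
    (∫ X, e' X * conj (e X) ∂μ) * opForm μ F u v =
      ∫ x, wav μ e u x * opForm μ F (shiftCLM x e') v ∂(μ.prod ν) := by
  have h := hμν.integrable_and_apply_eq e e' (opKernel μ F ∘L swapCLM)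
    (tensorCLM 𝔤 (conjS v) u)
  have h1 : ∀ x, (opKernel μ F ∘L swapCLM) (swapCLM (tensorCLM 𝔤 (shiftCLM x e')
      (sliceRight x (coeff μ 𝔤 e (tensorCLM 𝔤 (conjS v) u))))) =
      wav μ e u x * opForm μ F (shiftCLM x e') v := fun x => by
    rw [sliceRight_coeff_tensor, swapCLM_tensorCLM, ContinuousLinearMap.comp_apply,
      swapCLM_tensorCLM, map_smul, map_smul, opForm_eq, smul_eq_mul]
  have h2 : (opKernel μ F ∘L swapCLM) (tensorCLM 𝔤 (conjS v) u) = opForm μ F u v := by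
    rw [ContinuousLinearMap.comp_apply, swapCLM_tensorCLM, opForm_eq]
  simpa only [h1, h2] using h

theorem IsDualMeasure.opForm_reconstruct_conj (hμν : IsDualMeasure μ ν) (F : 𝓢'(Phase 𝔤, ℂ))
    (e e' u v : 𝓢(𝔤, ℂ)) :
    Integrable (fun x => conj (wav μ e v x) * opForm μ F u (shiftCLM x e')) (μ.prod ν) ∧
    conj (∫ X, e' X * conj (e X) ∂μ) * opForm μ F u v =
      ∫ x, conj (wav μ e v x) * opForm μ F u (shiftCLM x e') ∂(μ.prod ν) := by
  obtain ⟨h1, h2⟩ := hμν.opForm_reconstruct (adjD μ ν F) e e' v u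
  simp only [hμν.opForm_adjD] at h1 h2
  constructor
  · refine (LinearIsometryEquiv.integrable_comp_iff Complex.conjLIE).mpr h1 |>.congr
      (Filter.Eventually.of_forall fun x => ?_)
    simp
  · have := congrArg conj h2
    rw [← integral_conj] at this
    simpa only [map_mul, Complex.conj_conj] using this

/-- Reconstruction writes the operator kernel at an arbitrary Φ as an integral of its values at
elementary tensors, which replaces a density argument. -/
theorem IsDualMeasure.opForm_injective (hμν : IsDualMeasure μ ν) {e : 𝓢(𝔤, ℂ)}
    (he : ∫ X, e X * conj (e X) ∂μ = 1) {F G : 𝓢'(Phase 𝔤, ℂ)}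
    (h : ∀ u v, opForm μ F u v = opForm μ G u v) : F = G := by
  refine hμν.opKernel_injective (ContinuousLinearMap.ext fun Φ => ?_)
  have hF := (hμν.integrable_and_apply_eq e e (opKernel μ F) Φ).2
  have hG := (hμν.integrable_and_apply_eq e e (opKernel μ G) Φ).2
  rw [he, one_mul] at hF hG
  rw [hF, hG]
  congr 1
  funext x
  have h1 := h (sliceRight x (coeff μ 𝔤 e Φ)) (conjS (shiftCLM x e))
  rw [opForm_eq, opForm_eq, conjS_conjS] at h1
  rw [swapCLM_tensorCLM, h1]

/-- The two shifts act on the two factors of each rank-one term of the kernel of Op(h) separately.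
-/
theorem IsDualMeasure.frakE_eq_sum (hμν : IsDualMeasure μ ν) {h : 𝓢(Phase 𝔤, ℂ)} {m : ℕ}
    {e : Fin m → 𝓢(𝔤, ℂ)} (he : ∀ X Y, kernelOf ν h (X, Y) = ∑ i, e i X * conj (e i Y))
    (f : 𝓢'(Phase 𝔤, ℂ)) (y z : Phase 𝔤) :
    frakE μ ν h f (y, z) = ∑ i, opForm μ f (shiftCLM z (e i)) (shiftCLM y (e i)) := by
  rw [hμν.frakE_eq]
  simp only [opForm_eq]
  rw [← map_sum]
  congr 1
  ext p
  rw [sum_apply, conjS_apply, leftShift_apply, starK_apply, leftShift_apply,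
    starK_apply, he]
  simp only [tensorCLM_apply, conjS_apply, shiftCLM_apply, map_mul, map_sum, conj_expI,
    Complex.conj_conj, Finset.mul_sum, neg_neg]
  refine Finset.sum_congr rfl fun i _ => ?_
  ring

theorem IsDualMeasure.isProjection (hμν : IsDualMeasure μ ν) {h : 𝓢(Phase 𝔤, ℂ)}
    (h_idem : h = sharp μ ν h h) (h_adj : h = adj μ ν h) : IsProjection μ (kernelOf ν h) where
  idem X Y := by
    have h1 := congrArg (kernelOf ν) h_idem
    rw [sharp_eq, hμν.kernelOf_symbolOf] at h1
    have h2 := congrArg (fun K : 𝓢(𝔤 × 𝔤, ℂ) => K (X, Y)) h1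
    simp only [compK_apply] at h2
    exact h2.symm
  symm X Y := by
    have h1 := congrArg (kernelOf ν) h_adj
    rw [adj_eq, hμν.kernelOf_symbolOf] at h1
    have h2 := congrArg (fun K : 𝓢(𝔤 × 𝔤, ℂ) => K (X, Y)) h1
    exact h2.symm

variable (μ) in
/-- The two-fold coefficients `∫∫ φ(X, W) (U_y e)(X) conj (U_z e)(W) dX dW`. -/
noncomputable def doubleCoeff (e : 𝓢(𝔤, ℂ)) : 𝓢(𝔤 × 𝔤, ℂ) →L[ℂ] 𝓢(Phase 𝔤 × Phase 𝔤, ℂ) :=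
  conjCLM (coeff μ (Phase 𝔤) e) ∘L swapCLM ∘L coeff μ 𝔤 e ∘L swapCLM

theorem coeff_tensor {M : Type*} [NormedAddCommGroup M] [NormedSpace ℝ M]
    (e u : 𝓢(𝔤, ℂ)) (w : 𝓢(M, ℂ)) :
    coeff μ M e (tensorCLM 𝔤 w u) = tensorCLM (Phase 𝔤) w (wav μ e u) := by
  ext ⟨x, m⟩
  exact congrArg (fun g : 𝓢(M, ℂ) => g m) (sliceRight_coeff_tensor (μ := μ) e u w x)

theorem conjS_tensorCLM {V W : Type*} [NormedAddCommGroup V] [NormedSpace ℝ V]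
    [NormedAddCommGroup W] [NormedSpace ℝ W] (f : 𝓢(V, ℂ)) (g : 𝓢(W, ℂ)) :
    conjS (tensorCLM W f g) = tensorCLM W (conjS f) (conjS g) := by
  ext p
  simp

theorem doubleCoeff_tensor (e u v : 𝓢(𝔤, ℂ)) : doubleCoeff μ e (tensorCLM 𝔤 u (conjS v)) =
    tensorCLM (Phase 𝔤) (wav μ e u) (conjS (wav μ e v)) := by
  simp only [doubleCoeff, ContinuousLinearMap.comp_apply, conjCLM_apply, swapCLM_tensorCLM,
    coeff_tensor, conjS_tensorCLM, conjS_conjS]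

end Forms

/-! ### Schwartz functions in L² -/

section SquareIntegrable

variable {V : Type*} [NormedAddCommGroup V] [NormedSpace ℝ V] [FiniteDimensional ℝ V]
  [MeasurableSpace V] [BorelSpace V] {m : Measure V} [m.IsAddHaarMeasure]

theorem denseRange_toLp_two : DenseRange fun f : 𝓢(V, ℂ) => f.toLp 2 m :=
  SchwartzMap.denseRange_toLpCLM (F := ℂ) (p := 2) (μ := m) (by simp)

theorem inner_toLp_left (k : 𝓢(V, ℂ)) (a : Lp ℂ 2 m) :
    inner ℂ (k.toLp 2 m) a = ∫ x, a x * conj (k x) ∂m := by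
  rw [L2.inner_def]
  refine integral_congr_ae ?_
  filter_upwards [k.coeFn_toLp 2 m] with x hx
  rw [RCLike.inner_apply, hx]

theorem inner_toLp_toLp (u v : 𝓢(V, ℂ)) :
    inner ℂ (v.toLp 2 m) (u.toLp 2 m) = ∫ x, u x * conj (v x) ∂m := by
  rw [inner_toLp_left]
  refine integral_congr_ae ?_
  filter_upwards [u.coeFn_toLp 2 m] with x hx
  rw [hx]

theorem inner_memLp_toLp {a b : V → ℂ} (ha : MemLp a 2 m) (hb : MemLp b 2 m) :
    inner ℂ (hb.toLp b) (ha.toLp a) = ∫ x, a x * conj (b x) ∂m := by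
  rw [L2.inner_def]
  refine integral_congr_ae ?_
  filter_upwards [ha.coeFn_toLp, hb.coeFn_toLp] with x h1 h2
  rw [RCLike.inner_apply, h1, h2]

theorem toLp_eq_of_forall_integral_eq {a a' : V → ℂ} (ha : MemLp a 2 m) (ha' : MemLp a' 2 m)
    (h : ∀ k : 𝓢(V, ℂ), ∫ x, a x * conj (k x) ∂m = ∫ x, a' x * conj (k x) ∂m) :
    ha.toLp a = ha'.toLp a' := by
  have key : ∀ {c : V → ℂ} (hc : MemLp c 2 m) (k : 𝓢(V, ℂ)),
      inner ℂ (k.toLp 2 m) (hc.toLp c) = ∫ x, c x * conj (k x) ∂m := fun hc k => by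
    rw [inner_toLp_left]
    refine integral_congr_ae ?_
    filter_upwards [hc.coeFn_toLp] with x hx
    rw [hx]
  refine ext_inner_left ℂ fun w => ?_
  refine denseRange_toLp_two.induction_on (p := fun w => inner ℂ w (ha.toLp a) =
    inner ℂ w (ha'.toLp a')) w (isClosed_eq (by fun_prop) (by fun_prop)) fun k => ?_
  rw [key ha, key ha', h]

end SquareIntegrable

/-! ### Orthogonality relations on L² -/

section Isometry

variable {𝔤 : Type*} [RealNormedLieAlgebra 𝔤] [FiniteDimensional ℝ 𝔤] [LieRing.IsNilpotent 𝔤]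
  [MeasurableSpace 𝔤] [BorelSpace 𝔤] {μ : Measure 𝔤} [μ.IsAddHaarMeasure]
  {ν : Measure (𝔤 →L[ℝ] ℝ)} [ν.IsAddHaarMeasure]

/-- Reconstruction is applied to the identity operator, whose distributional kernel is integration
over the diagonal. -/
theorem IsDualMeasure.integral_wav_mul_conj (hμν : IsDualMeasure μ ν) (e e' u v : 𝓢(𝔤, ℂ)) :
    ∫ x, wav μ e u x * conj (wav μ e' v x) ∂(μ.prod ν) =
      (∫ X, e' X * conj (e X) ∂μ) * ∫ X, u X * conj (v X) ∂μ := by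
  have hid : ∀ u v, opForm μ (ofKernel ν (SchwartzMap.integralCLM ℂ μ ∘L diagonalCLM)) u v =
      ∫ X, u X * conj (v X) ∂μ := fun u v => by
    rw [opForm_eq, hμν.opKernel_ofKernel, ContinuousLinearMap.comp_apply,
      SchwartzMap.integralCLM_apply]
    congr 1
    funext X
    exact mul_comm _ _
  have h := (hμν.opForm_reconstruct
    (ofKernel ν (SchwartzMap.integralCLM ℂ μ ∘L diagonalCLM)) e e' u v).2
  simp only [hid] at h
  rw [h]
  congr 1
  funext x
  rw [wav_apply e' v, ← integral_conj]
  congr 2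
  funext X
  rw [map_mul, Complex.conj_conj, mul_comm]

variable (μ ν) in
/-- The extension of the coefficient map `u ↦ ⟨u, U_x e⟩` to square-integrable functions. -/
noncomputable def wavL2 (e : 𝓢(𝔤, ℂ)) : Lp ℂ 2 μ →L[ℂ] Lp ℂ 2 (μ.prod ν) :=
  ((SchwartzMap.toLpCLM ℂ ℂ 2 (μ.prod ν)).toLinearMap ∘ₗ (wav μ e).toLinearMap).extendOfNorm
    (SchwartzMap.toLpCLM ℂ ℂ 2 μ).toLinearMap

theorem IsDualMeasure.wavL2_toLp (hμν : IsDualMeasure μ ν) (e u : 𝓢(𝔤, ℂ)) :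
    wavL2 μ ν e (u.toLp 2 μ) = (wav μ e u).toLp 2 (μ.prod ν) := by
  -- The extension agrees with the coefficient map only once that map is bounded; the orthogonality
  -- relation for equal windows and equal vectors gives the constant ‖e‖.
  refine LinearMap.extendOfNorm_eq (e := (SchwartzMap.toLpCLM ℂ ℂ 2 μ).toLinearMap)
    denseRange_toLp_two ⟨Real.sqrt (∫ X, ‖e X‖ ^ 2 ∂μ), fun u => ?_⟩ u
  change ‖(wav μ e u).toLp 2 (μ.prod ν)‖ ≤ _ * ‖u.toLp 2 μ‖
  have h := hμν.integral_wav_mul_conj e e u u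
  rw [← inner_toLp_toLp (wav μ e u), ← inner_toLp_toLp u, inner_self_eq_norm_sq_to_K,
    inner_self_eq_norm_sq_to_K, integral_mul_conj_self] at h
  have h2 : ‖(wav μ e u).toLp 2 (μ.prod ν)‖ ^ 2 = (∫ X, ‖e X‖ ^ 2 ∂μ) * ‖u.toLp 2 μ‖ ^ 2 := by
    refine Complex.ofReal_injective ?_
    rw [Complex.ofReal_mul, Complex.ofReal_pow, Complex.ofReal_pow]
    exact h
  have h3 : 0 ≤ ∫ X, ‖e X‖ ^ 2 ∂μ := integral_nonneg fun X => by positivity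
  refine le_of_sq_le_sq ?_ (by positivity)
  rw [h2, mul_pow, Real.sq_sqrt h3]

theorem IsDualMeasure.inner_wavL2 (hμν : IsDualMeasure μ ν) (e e' : 𝓢(𝔤, ℂ)) (a b : Lp ℂ 2 μ) :
    inner ℂ (wavL2 μ ν e' b) (wavL2 μ ν e a) =
      (∫ X, e' X * conj (e X) ∂μ) * inner ℂ b a := by
  refine denseRange_toLp_two.induction_on₂ (p := fun a b => inner ℂ (wavL2 μ ν e' b)
    (wavL2 μ ν e a) = (∫ X, e' X * conj (e X) ∂μ) * inner ℂ b a)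
    (isClosed_eq (by fun_prop) (by fun_prop)) (fun u v => ?_) a b
  rw [hμν.wavL2_toLp, hμν.wavL2_toLp, inner_toLp_toLp, inner_toLp_toLp,
    hμν.integral_wav_mul_conj]

/-- Approximate a by Schwartz functions: a subsequence of the images converges almost everywhere,
while for each fixed x the coefficient is continuous in a. -/
theorem IsDualMeasure.coeFn_wavL2 (hμν : IsDualMeasure μ ν) (e : 𝓢(𝔤, ℂ)) (a : Lp ℂ 2 μ) :
    wavL2 μ ν e a =ᵐ[μ.prod ν] fun x => ∫ X, a X * conj (shiftCLM x e X) ∂μ := by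
  obtain ⟨s, hs, hlim⟩ := mem_closure_iff_seq_limit.mp
    ((denseRange_toLp_two (V := 𝔤) (m := μ)).closure_range ▸ Set.mem_univ a)
  choose u hu using hs
  have h1 : Filter.Tendsto (fun n => wavL2 μ ν e (s n)) Filter.atTop (nhds (wavL2 μ ν e a)) :=
    ((wavL2 μ ν e).continuous.tendsto a).comp hlim
  obtain ⟨ns, hns, hae⟩ := (tendstoInMeasure_of_tendsto_Lp h1).exists_seq_tendsto_ae
  have h2 : ∀ n, wavL2 μ ν e (s n) =ᵐ[μ.prod ν] wav μ e (u n) := fun n => by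
    rw [← hu n, hμν.wavL2_toLp]
    exact SchwartzMap.coeFn_toLp _ _ _
  filter_upwards [hae, ae_all_iff.mpr h2] with x hx hx2
  refine tendsto_nhds_unique hx ?_
  simp only [hx2]
  have h3 : ∀ n, wav μ e (u n) x = inner ℂ ((shiftCLM x e).toLp 2 μ) (s n) := fun n => by
    rw [← hu n]
    change _ = inner ℂ ((shiftCLM x e).toLp 2 μ) ((u n).toLp 2 μ)
    rw [inner_toLp_toLp, wav_apply]
  simp only [h3]
  rw [← inner_toLp_left]
  have h4 : Continuous fun b : Lp ℂ 2 μ => inner ℂ ((shiftCLM x e).toLp 2 μ) b := by fun_prop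
  exact ((h4.tendsto a).comp hlim).comp hns.tendsto_atTop

/-- The orthogonality relations for coefficients of square-integrable functions. -/
theorem IsDualMeasure.integral_coeff_mul_conj (hμν : IsDualMeasure μ ν) (e e' : 𝓢(𝔤, ℂ))
    {a b : 𝔤 → ℂ} (ha : MemLp a 2 μ) (hb : MemLp b 2 μ) :
    Integrable (fun x => (∫ X, a X * conj (shiftCLM x e X) ∂μ) *
      conj (∫ X, b X * conj (shiftCLM x e' X) ∂μ)) (μ.prod ν) ∧
    ∫ x, (∫ X, a X * conj (shiftCLM x e X) ∂μ) * conj (∫ X, b X * conj (shiftCLM x e' X) ∂μ)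
      ∂(μ.prod ν) = (∫ X, e' X * conj (e X) ∂μ) * ∫ X, a X * conj (b X) ∂μ := by
  have key : ∀ {c : 𝔤 → ℂ} (hc : MemLp c 2 μ) (w : 𝓢(𝔤, ℂ)),
      wavL2 μ ν w (hc.toLp c) =ᵐ[μ.prod ν] fun x => ∫ X, c X * conj (shiftCLM x w X) ∂μ :=
    fun hc w => by
      filter_upwards [hμν.coeFn_wavL2 w (hc.toLp _)] with x hx
      rw [hx]
      refine integral_congr_ae ?_
      filter_upwards [hc.coeFn_toLp] with X hX
      rw [hX]
  have h := hμν.inner_wavL2 e e' (ha.toLp a) (hb.toLp b)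
  rw [inner_memLp_toLp, L2.inner_def] at h
  have h3 : (fun x => inner ℂ (wavL2 μ ν e' (hb.toLp b) x) (wavL2 μ ν e (ha.toLp a) x))
      =ᵐ[μ.prod ν] fun x => (∫ X, a X * conj (shiftCLM x e X) ∂μ) *
        conj (∫ X, b X * conj (shiftCLM x e' X) ∂μ) := by
    filter_upwards [key ha e, key hb e'] with x h1 h2
    rw [RCLike.inner_apply, h1, h2]
  exact ⟨(L2.integrable_inner _ _).congr h3, (integral_congr_ae h3).symm.trans h⟩

/-- The function a is the image of G under the Hilbert space adjoint of the coefficient map. -/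
theorem IsDualMeasure.exists_memLp_of_coeff (hμν : IsDualMeasure μ ν) (e : 𝓢(𝔤, ℂ))
    {G : Phase 𝔤 → ℂ} (hG : MemLp G 2 (μ.prod ν)) : ∃ a : 𝔤 → ℂ, MemLp a 2 μ ∧
      ∀ k : 𝓢(𝔤, ℂ), ∫ x, conj (wav μ e k x) * G x ∂(μ.prod ν) = ∫ X, a X * conj (k X) ∂μ := by
  refine ⟨ContinuousLinearMap.adjoint (wavL2 μ ν e) (hG.toLp G), Lp.memLp _, fun k => ?_⟩
  rw [← inner_toLp_left, ContinuousLinearMap.adjoint_inner_right, hμν.wavL2_toLp,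
    inner_toLp_left]
  refine integral_congr_ae ?_
  filter_upwards [hG.coeFn_toLp] with x hx
  rw [hx, mul_comm]

end Isometry

/-! ### Functions are determined by their integrals against Schwartz functions -/

section Uniqueness

variable {W : Type*} [NormedAddCommGroup W] [NormedSpace ℝ W] [FiniteDimensional ℝ W]
  [MeasurableSpace W] [BorelSpace W] {m : Measure W} [m.IsAddHaarMeasure]

/-- A compactly supported smooth real function as a complex Schwartz function. -/
theorem exists_schwartz_eq {g : W → ℝ} (hg : ContDiff ℝ (⊤ : ℕ∞) g) (hc : HasCompactSupport g) :
    ∃ φ : 𝓢(W, ℂ), ∀ x, φ x = g x :=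
  ⟨HasCompactSupport.toSchwartzMap (f := fun x => (g x : ℂ))
    (hc.comp_left Complex.ofReal_zero) (Complex.ofRealCLM.contDiff.comp hg), fun _ => rfl⟩

theorem ae_eq_zero_of_integral_schwartz {D : W → ℂ}
    (hD : ∀ φ : 𝓢(W, ℂ), Integrable (fun x => D x * φ x) m)
    (h0 : ∀ φ : 𝓢(W, ℂ), ∫ x, D x * φ x ∂m = 0) : ∀ᵐ x ∂m, D x = 0 := by
  refine ae_eq_zero_of_integral_contDiff_smul_eq_zero (fun x => ?_) fun g hg hc => ?_
  · let b : ContDiffBump x := ⟨1, 2, one_pos, one_lt_two⟩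
    obtain ⟨φ, hφ⟩ := exists_schwartz_eq b.contDiff b.hasCompactSupport
    refine ⟨Metric.closedBall x 1, Metric.closedBall_mem_nhds x one_pos, ?_⟩
    refine (hD φ).integrableOn.congr_fun (fun y hy => ?_) Metric.isClosed_closedBall.measurableSet
    simp only [hφ, b.one_of_mem_closedBall hy, Complex.ofReal_one, mul_one]
  · obtain ⟨φ, hφ⟩ := exists_schwartz_eq hg hc
    rw [← h0 φ]
    congr 1
    funext x
    rw [hφ, Complex.real_smul, mul_comm]

end Uniqueness

/-! ### Distributions given by kernels -/

section KernelDistributions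

variable {V : Type*} [NormedAddCommGroup V] [NormedSpace ℝ V] [FiniteDimensional ℝ V]
  [MeasurableSpace V] [BorelSpace V] {m : Measure V} [m.IsAddHaarMeasure]
  {T S U : 𝓢'(V × V, ℂ)} {K L : V × V → ℂ}

theorem IsKernel.add (hT : IsKernel m T K) (hS : IsKernel m S L) :
    IsKernel m (T + S) (fun p => K p + L p) := by
  refine ⟨hT.1.add hS.1, fun φ => ?_⟩
  have h := (hT.2 φ).1.add (hS.2 φ).1
  simp only [add_mul]
  refine ⟨h, ?_⟩
  rw [integral_add (hT.2 φ).1 (hS.2 φ).1, ← (hT.2 φ).2, ← (hS.2 φ).2]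
  rfl

theorem IsKernel.smul (c : ℂ) (hT : IsKernel m T K) :
    IsKernel m (c • T) (fun p => c * K p) := by
  refine ⟨hT.1.const_mul c, fun φ => ?_⟩
  simp only [mul_assoc]
  refine ⟨(hT.2 φ).1.const_mul c, ?_⟩
  rw [integral_const_mul, ← (hT.2 φ).2]
  rfl

theorem IsKernel.zero : IsKernel m (0 : 𝓢'(V × V, ℂ)) (fun _ => 0) :=
  ⟨aestronglyMeasurable_const, fun φ => by simp⟩

theorem IsKernel.congr (hT : IsKernel m T K) (h : K =ᵐ[m.prod m] L) : IsKernel m T L := by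
  refine ⟨hT.1.congr h, fun φ => ?_⟩
  have h1 : (fun p => K p * φ p) =ᵐ[m.prod m] fun p => L p * φ p := by
    filter_upwards [h] with p hp
    rw [hp]
  exact ⟨(hT.2 φ).1.congr h1, (hT.2 φ).2.trans (integral_congr_ae h1)⟩

theorem IsKernel.ae_eq (hT : IsKernel m T K) (hT' : IsKernel m T L) : K =ᵐ[m.prod m] L := by
  have h := ae_eq_zero_of_integral_schwartz (m := m.prod m) (D := fun p => K p - L p)
    (fun φ => by
      simp only [sub_mul]
      exact (hT.2 φ).1.sub (hT'.2 φ).1)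
    (fun φ => by
      simp only [sub_mul]
      rw [integral_sub (hT.2 φ).1 (hT'.2 φ).1, ← (hT.2 φ).2, ← (hT'.2 φ).2, sub_self])
  filter_upwards [h] with p hp
  exact sub_eq_zero.mp hp

theorem kernelAdj_apply (T : 𝓢'(V × V, ℂ)) (φ : 𝓢(V × V, ℂ)) :
    kernelAdj T φ = conj (T (starK φ)) := by
  have h : kernelAdj T = toDist (conjFun (ofDist T ∘L swapCLM)) := by
    refine distOf_eq _ fun φ => ?_
    simp only [pair, toDist_apply, conjFun_apply, conjS_conjS]
    rfl
  rw [h]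
  rfl

theorem IsKernel.kernelAdj (hT : IsKernel m T K) :
    IsKernel m (kernelAdj T) (fun p => conj (K (p.2, p.1))) := by
  have hconj : Continuous (fun z : ℂ => conj z) := Complex.continuous_conj
  refine ⟨hconj.comp_aestronglyMeasurable hT.1.prod_swap, fun φ => ?_⟩
  have h1 : ∀ p : V × V, conj (K (p.2, p.1)) * φ p =
      (fun q => conj (K q * starK φ q)) p.swap := fun p => by
    simp [Prod.swap]
  simp only [h1]
  constructor
  · exact ((LinearIsometryEquiv.integrable_comp_iff Complex.conjLIE).mpr (hT.2 (starK φ)).1).swap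
  · rw [integral_prod_swap (μ := m) (ν := m) (fun q => conj (K q * starK φ q)), integral_conj,
      ← (hT.2 (starK φ)).2, kernelAdj_apply]

/-- Kernels are unique almost everywhere, so the composition may be computed with any
representatives, in particular with the everywhere defined transforms 𝔈_h. -/
theorem IsKernelProd.of_isKernel (h : IsKernelProd m T S U) (hT : IsKernel m T K)
    (hS : IsKernel m S L) :
    (∀ φ : 𝓢(V × V, ℂ), Integrable
      (fun p : (V × V) × V => K (p.1.1, p.2) * L (p.2, p.1.2) * φ p.1) ((m.prod m).prod m)) ∧
    IsKernel m U (fun p => ∫ x, K (p.1, x) * L (x, p.2) ∂m) := by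
  obtain ⟨K', L', hK', hL', hint, hU⟩ := h
  have hK : ∀ᵐ p : (V × V) × V ∂(m.prod m).prod m, K' (p.1.1, p.2) = K (p.1.1, p.2) :=
    (QuasiMeasurePreserving.prodMap Measure.quasiMeasurePreserving_fst
      (.id m)).ae (hK'.ae_eq hT)
  have hL : ∀ᵐ p : (V × V) × V ∂(m.prod m).prod m, L' (p.2, p.1.2) = L (p.2, p.1.2) := by
    have hswap : Measure.QuasiMeasurePreserving (Prod.swap : V × V → V × V)
        (m.prod m) (m.prod m) := Measure.measurePreserving_swap.quasiMeasurePreserving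
    exact (hswap.comp (QuasiMeasurePreserving.prodMap
      Measure.quasiMeasurePreserving_snd (.id m))).ae (hL'.ae_eq hS)
  constructor
  · intro φ
    refine (hint φ).congr ?_
    filter_upwards [hK, hL] with p h1 h2
    rw [h1, h2]
  · refine hU.congr ?_
    filter_upwards [Measure.ae_ae_of_ae_prod hK, Measure.ae_ae_of_ae_prod hL] with p h1 h2
    refine integral_congr_ae ?_
    filter_upwards [h1, h2] with x h3 h4
    exact congrArg₂ (· * ·) h3 h4

end KernelDistributions

/-! ### Transforms of symbols and the weak operator product -/

section Coorbit

variable {𝔤 : Type*} [RealNormedLieAlgebra 𝔤] [FiniteDimensional ℝ 𝔤] [LieRing.IsNilpotent 𝔤]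
  [MeasurableSpace 𝔤] [BorelSpace 𝔤] {μ : Measure 𝔤} [μ.IsAddHaarMeasure]
  {ν : Measure (𝔤 →L[ℝ] ℝ)} [ν.IsAddHaarMeasure]

variable (μ ν) in
/-- The functions `e i` are orthonormal, and the kernel of the projection `Op(h)` is
`∑ i, e i ⊗ conj (e i)`. -/
structure IsFrame {m : ℕ} (h : 𝓢(Phase 𝔤, ℂ)) (e : Fin m → 𝓢(𝔤, ℂ)) : Prop where
  dual : IsDualMeasure μ ν
  orthonormal : ∀ i j, ∫ X, e i X * conj (e j X) ∂μ = if i = j then 1 else 0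
  sum_eq : ∀ X Y, kernelOf ν h (X, Y) = ∑ i, e i X * conj (e i Y)

variable {m : ℕ} {h : 𝓢(Phase 𝔤, ℂ)} {e : Fin m → 𝓢(𝔤, ℂ)}

theorem IsFrame.norm_eq (he : IsFrame μ ν h e) (j : Fin m) :
    ∫ X, e j X * conj (e j X) ∂μ = 1 := by
  rw [he.orthonormal, if_pos rfl]

theorem IsFrame.frakE_eq (he : IsFrame μ ν h e) (f : 𝓢'(Phase 𝔤, ℂ)) (y z : Phase 𝔤) :
    frakE μ ν h f (y, z) = ∑ i, opForm μ f (shiftCLM z (e i)) (shiftCLM y (e i)) :=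
  he.dual.frakE_eq_sum he.sum_eq f y z

/-- Reconstruction multiplies the summand of index i by ⟨e_i, e_j⟩, so only i = j survives. -/
theorem IsFrame.integral_frakE_mul_wav (he : IsFrame μ ν h e) (f : 𝓢'(Phase 𝔤, ℂ)) (j : Fin m)
    (x : Phase 𝔤) (u : 𝓢(𝔤, ℂ)) :
    ∫ z, frakE μ ν h f (x, z) * wav μ (e j) u z ∂(μ.prod ν) = opForm μ f u (shiftCLM x (e j)) := by
  have h1 := fun i => he.dual.opForm_reconstruct f (e j) (e i) u (shiftCLM x (e i))
  have h2 : ∀ z, frakE μ ν h f (x, z) * wav μ (e j) u z =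
      ∑ i, wav μ (e j) u z * opForm μ f (shiftCLM z (e i)) (shiftCLM x (e i)) := fun z => by
    rw [he.frakE_eq, mul_comm, Finset.mul_sum]
  simp only [h2]
  rw [integral_finsetSum _ fun i _ => (h1 i).1]
  simp only [← (h1 _).2, he.orthonormal]
  simp

theorem IsFrame.integral_conj_wav_mul_frakE (he : IsFrame μ ν h e) (f : 𝓢'(Phase 𝔤, ℂ))
    (j : Fin m) (x : Phase 𝔤) (v : 𝓢(𝔤, ℂ)) :
    ∫ y, conj (wav μ (e j) v y) * frakE μ ν h f (y, x) ∂(μ.prod ν) =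
      opForm μ f (shiftCLM x (e j)) v := by
  have h1 := fun i => he.dual.opForm_reconstruct_conj f (e j) (e i) (shiftCLM x (e i)) v
  have h2 : ∀ y, conj (wav μ (e j) v y) * frakE μ ν h f (y, x) =
      ∑ i, conj (wav μ (e j) v y) * opForm μ f (shiftCLM x (e i)) (shiftCLM y (e i)) :=
    fun y => by rw [he.frakE_eq, Finset.mul_sum]
  simp only [h2]
  rw [integral_finsetSum _ fun i _ => (h1 i).1]
  simp only [← (h1 _).2, he.orthonormal]
  simp

theorem IsFrame.frakE_adjD (he : IsFrame μ ν h e) (f : 𝓢'(Phase 𝔤, ℂ)) (p : Phase 𝔤 × Phase 𝔤) :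
    frakE μ ν h (adjD μ ν f) p = conj (frakE μ ν h f (p.2, p.1)) := by
  obtain ⟨y, z⟩ := p
  rw [he.frakE_eq, he.frakE_eq, map_sum]
  simp only [he.dual.opForm_adjD]

variable {f g : 𝓢'(Phase 𝔤, ℂ)} {T S U : 𝓢'(Phase 𝔤 × Phase 𝔤, ℂ)}

/-- Reconstruction in both variables. The right-hand side involves f only through T, which gives
injectivity of the transform. -/
theorem IsFrame.opForm_eq_of_isKernel (he : IsFrame μ ν h e) (j : Fin m)
    (hT : IsKernel (μ.prod ν) T (frakE μ ν h f)) (u v : 𝓢(𝔤, ℂ)) :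
    opForm μ f u v =
      T (tensorCLM (Phase 𝔤) (wav μ (e j) u) (conjS (wav μ (e j) v))) := by
  obtain ⟨h1, h2⟩ := hT.2 (tensorCLM (Phase 𝔤) (wav μ (e j) u) (conjS (wav μ (e j) v)))
  rw [h2, integral_prod _ h1]
  have h3 := (he.dual.opForm_reconstruct_conj f (e j) (e j) u v).2
  rw [he.norm_eq, map_one, one_mul] at h3
  rw [h3]
  congr 1
  funext y
  rw [← he.integral_frakE_mul_wav, ← integral_const_mul]
  congr 1
  funext z
  simp only [tensorCLM_apply, conjS_apply]
  ring

/-- Test T° ∘ T on the coefficients of u and their conjugates. For fixed x the absolutely convergent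
integral over the outer variables factorises into |⟨Op(f)u, U_x e_j⟩|², and Fubini makes this
integrable in x. -/
theorem IsFrame.memLp_opForm (he : IsFrame μ ν h e) (j : Fin m)
    (hT : IsKernel (μ.prod ν) T (frakE μ ν h f))
    (hU : IsKernelProd (μ.prod ν) (kernelAdj T) T U) (u : 𝓢(𝔤, ℂ)) :
    MemLp (fun x => opForm μ f u (shiftCLM x (e j))) 2 (μ.prod ν) := by
  have hint := ((hU.of_isKernel hT.kernelAdj hT).1
    (tensorCLM (Phase 𝔤) (wav μ (e j) u) (conjS (wav μ (e j) u)))).integral_prod_right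
  have hmeas : AEStronglyMeasurable (fun x => opForm μ f u (shiftCLM x (e j))) (μ.prod ν) := by
    simp only [← he.integral_frakE_mul_wav]
    have h1 : AEStronglyMeasurable (fun p : Phase 𝔤 × Phase 𝔤 =>
        frakE μ ν h f p * wav μ (e j) u p.2) ((μ.prod ν).prod (μ.prod ν)) :=
      hT.1.mul ((wav μ (e j) u).continuous.comp continuous_snd).aestronglyMeasurable
    exact h1.integral_prod_right'
  rw [memLp_two_iff_integrable_sq_norm hmeas]
  refine hint.norm.congr (Filter.Eventually.of_forall fun x => ?_)
  have h1 : ∀ p : Phase 𝔤 × Phase 𝔤, conj (frakE μ ν h f (x, p.1)) * frakE μ ν h f (x, p.2) *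
      tensorCLM (Phase 𝔤) (wav μ (e j) u) (conjS (wav μ (e j) u)) p =
      conj (frakE μ ν h f (x, p.1) * wav μ (e j) u p.1) *
        (frakE μ ν h f (x, p.2) * wav μ (e j) u p.2) := fun p => by
    simp only [tensorCLM_apply, conjS_apply, map_mul]
    ring
  simp only [h1]
  rw [integral_prod_mul (fun y => conj (frakE μ ν h f (x, y) * wav μ (e j) u y))
    (fun z => frakE μ ν h f (x, z) * wav μ (e j) u z), integral_conj,
    he.integral_frakE_mul_wav, norm_mul, RCLike.norm_conj, pow_two]

theorem IsFrame.exists_memLp_opForm (he : IsFrame μ ν h e) (j : Fin m)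
    (hT : IsKernel (μ.prod ν) T (frakE μ ν h f))
    (hU : IsKernelProd (μ.prod ν) (kernelAdj T) T U) (u : 𝓢(𝔤, ℂ)) :
    ∃ a : 𝔤 → ℂ, MemLp a 2 μ ∧ ∀ k : 𝓢(𝔤, ℂ), opForm μ f u k = ∫ X, a X * conj (k X) ∂μ := by
  obtain ⟨a, ha, hak⟩ := he.dual.exists_memLp_of_coeff (e j) (he.memLp_opForm j hT hU u)
  refine ⟨a, ha, fun k => ?_⟩
  have h3 := (he.dual.opForm_reconstruct_conj f (e j) (e j) u k).2
  rw [he.norm_eq, map_one, one_mul] at h3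
  rw [h3, hak]

theorem IsFrame.isKernel_adjD (he : IsFrame μ ν h e)
    (hT : IsKernel (μ.prod ν) T (frakE μ ν h f)) :
    IsKernel (μ.prod ν) (kernelAdj T) (frakE μ ν h (adjD μ ν f)) := by
  have h1 := hT.kernelAdj
  simp only [← he.frakE_adjD] at h1
  exact h1

/-- The L² representatives of Op(g)u and Op(f)*v are determined almost everywhere, hence so is the
form of the product. -/
theorem IsFrame.isSymbolProd_unique (he : IsFrame μ ν h e) (j : Fin m)
    {F F' : 𝓢'(Phase 𝔤, ℂ)} (hF : IsSymbolProd μ f g F) (hF' : IsSymbolProd μ f g F') :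
    F = F' := by
  refine he.dual.opForm_injective (he.norm_eq j) fun u v => ?_
  obtain ⟨a, b, ha, hb, hak, hbk, hab⟩ := hF u v
  obtain ⟨a', b', ha', hb', hak', hbk', hab'⟩ := hF' u v
  rw [hab, hab', ← inner_memLp_toLp ha hb, ← inner_memLp_toLp ha' hb',
    toLp_eq_of_forall_integral_eq ha ha' fun k => (hak k).symm.trans (hak' k),
    toLp_eq_of_forall_integral_eq hb hb' fun k => ?_]
  have h1 := congrArg conj ((hbk k).symm.trans (hbk' k))
  rw [← integral_conj, ← integral_conj] at h1
  simpa only [map_mul, Complex.conj_conj, mul_comm] using h1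

/-- The symbol whose operator kernel is determined by the composition of two transforms. -/
theorem IsFrame.exists_isSymbolProd (he : IsFrame μ ν h e) (j : Fin m)
    (hT : IsKernel (μ.prod ν) T (frakE μ ν h f)) (hS : IsKernel (μ.prod ν) S (frakE μ ν h g))
    (hU : IsKernelProd (μ.prod ν) T S U)
    (hf : ∀ v, ∃ b : 𝔤 → ℂ, MemLp b 2 μ ∧
      ∀ k : 𝓢(𝔤, ℂ), opForm μ (adjD μ ν f) v k = ∫ X, b X * conj (k X) ∂μ)
    (hg : ∀ u, ∃ a : 𝔤 → ℂ, MemLp a 2 μ ∧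
      ∀ k : 𝓢(𝔤, ℂ), opForm μ g u k = ∫ X, a X * conj (k X) ∂μ) :
    ∃ F, IsSymbolProd μ f g F ∧ IsKernel (μ.prod ν) U (frakE μ ν h F) := by
  obtain ⟨hint, hUker⟩ := hU.of_isKernel hT hS
  choose b hb hbk using hf
  choose a ha hak using hg
  have hbk' : ∀ v k, opForm μ f k v = conj (∫ X, b v X * conj (k X) ∂μ) := fun v k => by
    rw [← hbk, he.dual.opForm_adjD, Complex.conj_conj]
  -- The orthogonality relations for Op(g)u and Op(f)*v: different windows contribute nothing, equal
  -- ones give ⟨Op(g)u, Op(f)*v⟩.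
  have hL2 : ∀ i i' u v,
      Integrable (fun x => opForm μ f (shiftCLM x (e i)) v * opForm μ g u (shiftCLM x (e i')))
        (μ.prod ν) ∧
      ∫ x, opForm μ f (shiftCLM x (e i)) v * opForm μ g u (shiftCLM x (e i')) ∂(μ.prod ν) =
        if i = i' then ∫ X, a u X * conj (b v X) ∂μ else 0 := fun i i' u v => by
    have h1 := he.dual.integral_coeff_mul_conj (e i') (e i) (ha u) (hb v)
    simp only [hbk', hak]
    simp only [he.orthonormal, ite_mul, one_mul, zero_mul] at h1
    simpa only [mul_comm] using h1
  -- Op(F) is prescribed by pairing U with the coefficients in both kernel variables, which is what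
  -- `opForm_eq_of_isKernel` forces if U is to be the transform of F.
  set F := ofKernel ν (ofDist U ∘L doubleCoeff μ (e j)) with hFdef
  have hF : ∀ u v, opForm μ F u v = ∫ X, a u X * conj (b v X) ∂μ := fun u v => by
    set φ := tensorCLM (Phase 𝔤) (wav μ (e j) u) (conjS (wav μ (e j) v)) with hφ
    rw [opForm_eq, he.dual.opKernel_ofKernel, ContinuousLinearMap.comp_apply, doubleCoeff_tensor,
      ofDist_apply, ← hφ, (hUker.2 φ).2]
    have h1 := (hL2 j j u v).2
    rw [if_pos rfl] at h1
    rw [← h1]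
    simp only [← integral_mul_const]
    -- Absolute convergence allows x to be integrated last; for fixed x the integrand splits into a
    -- product, and each factor is a reconstruction integral.
    rw [integral_integral_swap (hint φ)]
    congr 1
    funext x
    rw [← he.integral_conj_wav_mul_frakE, ← he.integral_frakE_mul_wav, ← integral_prod_mul]
    congr 1
    funext p
    simp only [hφ, tensorCLM_apply, conjS_apply]
    ring
  refine ⟨F, fun u v => ⟨a u, b v, ha u, hb v, hak u, fun k => ?_, hF u v⟩, ?_⟩
  · rw [hbk', ← integral_conj]
    simp only [map_mul, Complex.conj_conj, mul_comm]
  -- The product of the two sums over windows is a double sum, and integration over x collapses it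
  -- to its diagonal, which is the transform of F.
  · have h1 : ∀ p : Phase 𝔤 × Phase 𝔤,
        ∫ x, frakE μ ν h f (p.1, x) * frakE μ ν h g (x, p.2) ∂(μ.prod ν) =
          frakE μ ν h F p := fun p => by
      obtain ⟨y, z⟩ := p
      simp only [he.frakE_eq, Finset.sum_mul_sum]
      rw [integral_finsetSum _ fun i _ => integrable_finsetSum _ fun i' _ => (hL2 i i' _ _).1]
      refine Finset.sum_congr rfl fun i _ => ?_
      rw [integral_finsetSum _ fun i' _ => (hL2 i i' _ _).1]
      simp only [(hL2 _ _ _ _).2, hF, Finset.sum_ite_eq, Finset.mem_univ, if_true]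
    simp only [h1] at hUker
    exact hUker

end Coorbit

/-! ### Transport of involutive algebras -/

section Transport

variable {V W : Type*} [AddCommGroup V] [Module ℂ V] [AddCommGroup W] [Module ℂ W]
  {prodV : V → V → V → Prop} {invV : V → V} {B : Set V}
  {prodW : W → W → W → Prop} {invW : W → W} {R : W → V → Prop}

/-- Transport of the structure of an involutive algebra along a linear injective correspondence. -/
theorem IsInvolutiveAlgebra.transport (hB : IsInvolutiveAlgebra prodV invV B)
    (hmem : ∀ {f T}, R f T → T ∈ B) (h0 : R 0 0)
    (hadd : ∀ {f g T S}, R f T → R g S → R (f + g) (T + S))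
    (hsmul : ∀ (c : ℂ) {f T}, R f T → R (c • f) (c • T))
    (hinj : ∀ {f g T}, R f T → R g T → f = g)
    (hprod : ∀ {f g T S U}, R f T → R g S → prodV T S U → U ∈ B → ∃ F, prodW f g F ∧ R F U)
    (huniq : ∀ {f g F F'}, prodW f g F → prodW f g F' → F = F')
    (hinv : ∀ {f T}, R f T → R (invW f) (invV T))
    (inv_inv : ∀ f, invW (invW f) = f) (inv_add : ∀ f g, invW (f + g) = invW f + invW g)
    (inv_smul : ∀ (c : ℂ) f, invW (c • f) = conj c • invW f) :
    IsInvolutiveAlgebra prodW invW {f | ∃ T, R f T} := by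
  -- Products on the W side correspond to products on the V side, by uniqueness of products; `lift`
  -- is the converse, by injectivity of R. Each algebraic law is pushed to B with `key` and brought
  -- back with `lift`.
  have key : ∀ {f g F T S}, R f T → R g S → prodW f g F → ∃ U, prodV T S U ∧ R F U := by
    intro f g F T S hf hg hF
    obtain ⟨U, hU, -⟩ := hB.exists_prod T (hmem hf) S (hmem hg)
    obtain ⟨F', hF', hR⟩ := hprod hf hg hU (hB.prod_mem T (hmem hf) S (hmem hg) U hU)
    exact ⟨U, hU, huniq hF' hF ▸ hR⟩
  have lift : ∀ {f g F T S U}, R f T → R g S → R F U → prodV T S U → prodW f g F := by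
    intro f g F T S U hf hg hF hU
    obtain ⟨F', hF', hR⟩ := hprod hf hg hU (hmem hF)
    exact hinj hR hF ▸ hF'
  constructor
  · exact ⟨0, h0⟩
  · rintro f ⟨T, hT⟩ g ⟨S, hS⟩
    exact ⟨_, hadd hT hS⟩
  · rintro c f ⟨T, hT⟩
    exact ⟨_, hsmul c hT⟩
  · rintro f ⟨T, hT⟩ g ⟨S, hS⟩
    obtain ⟨U, hU, -⟩ := hB.exists_prod T (hmem hT) S (hmem hS)
    obtain ⟨F, hF, -⟩ := hprod hT hS hU (hB.prod_mem T (hmem hT) S (hmem hS) U hU)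
    exact ⟨F, hF, fun F' hF' => huniq hF' hF⟩
  · rintro f ⟨T, hT⟩ g ⟨S, hS⟩ F hF
    obtain ⟨U, -, hU⟩ := key hT hS hF
    exact ⟨U, hU⟩
  · rintro f ⟨T, hT⟩ g ⟨S, hS⟩ k ⟨Q, hQ⟩ x y hx hy
    obtain ⟨X, hX, hX'⟩ := key hT hQ hx
    obtain ⟨Y, hY, hY'⟩ := key hS hQ hy
    exact lift (hadd hT hS) hQ (hadd hX' hY')
      (hB.add_prod T (hmem hT) S (hmem hS) Q (hmem hQ) X Y hX hY)
  · rintro f ⟨T, hT⟩ g ⟨S, hS⟩ k ⟨Q, hQ⟩ x y hx hy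
    obtain ⟨X, hX, hX'⟩ := key hT hS hx
    obtain ⟨Y, hY, hY'⟩ := key hT hQ hy
    exact lift hT (hadd hS hQ) (hadd hX' hY')
      (hB.prod_add T (hmem hT) S (hmem hS) Q (hmem hQ) X Y hX hY)
  · rintro c f ⟨T, hT⟩ g ⟨S, hS⟩ x hx
    obtain ⟨X, hX, hX'⟩ := key hT hS hx
    exact lift (hsmul c hT) hS (hsmul c hX') (hB.smul_prod c T (hmem hT) S (hmem hS) X hX)
  · rintro c f ⟨T, hT⟩ g ⟨S, hS⟩ x hx
    obtain ⟨X, hX, hX'⟩ := key hT hS hx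
    exact lift hT (hsmul c hS) (hsmul c hX') (hB.prod_smul c T (hmem hT) S (hmem hS) X hX)
  · rintro f ⟨T, hT⟩ g ⟨S, hS⟩ k ⟨Q, hQ⟩ fg gk d hfg hgk hd
    obtain ⟨X, hX, hX'⟩ := key hT hS hfg
    obtain ⟨Y, hY, hY'⟩ := key hS hQ hgk
    obtain ⟨D, hD, hD'⟩ := key hX' hQ hd
    exact lift hT hY' hD'
      (hB.prod_assoc T (hmem hT) S (hmem hS) Q (hmem hQ) X Y D hX hY hD)
  · rintro f ⟨T, hT⟩
    exact ⟨_, hinv hT⟩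
  · exact fun f _ => inv_inv f
  · exact fun f _ g _ => inv_add f g
  · exact fun c f _ => inv_smul c f
  · rintro f ⟨T, hT⟩ g ⟨S, hS⟩ x hx
    obtain ⟨X, hX, hX'⟩ := key hT hS hx
    exact lift (hinv hS) (hinv hT) (hinv hX') (hB.inv_prod T (hmem hT) S (hmem hS) X hX)

end Transport

/-! ### The coorbit space -/

section Coorbit

variable {𝔤 : Type*} [RealNormedLieAlgebra 𝔤] [FiniteDimensional ℝ 𝔤] [LieRing.IsNilpotent 𝔤]
  [MeasurableSpace 𝔤] [BorelSpace 𝔤] {μ : Measure 𝔤} [μ.IsAddHaarMeasure]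
  {ν : Measure (𝔤 →L[ℝ] ℝ)} [ν.IsAddHaarMeasure] {h : 𝓢(Phase 𝔤, ℂ)}

/-- A nonzero h has rank at least one, which supplies the window e_j needed for reconstruction. -/
theorem IsDualMeasure.exists_isFrame (hμν : IsDualMeasure μ ν) (h_ne : h ≠ 0)
    (h_idem : h = sharp μ ν h h) (h_adj : h = adj μ ν h) :
    ∃ (m : ℕ) (e : Fin m → 𝓢(𝔤, ℂ)), IsFrame μ ν h e ∧ Nonempty (Fin m) := by
  obtain ⟨m, e, -, ho, hs⟩ := (hμν.isProjection h_idem h_adj).exists_orthonormal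
  refine ⟨m, e, ⟨hμν, ho, hs⟩, ?_⟩
  by_contra hm
  rw [not_nonempty_iff] at hm
  refine h_ne ?_
  rw [← hμν.symbolOf_kernelOf h]
  have h0 : kernelOf ν h = 0 := by
    ext ⟨X, Y⟩
    rw [hs X Y]
    simp
  rw [h0, map_zero]

theorem adjD_add (F G : 𝓢'(Phase 𝔤, ℂ)) :
    adjD μ ν (F + G) = adjD μ ν F + adjD μ ν G := by
  refine ext_pair fun k => ?_
  simp [pair_adjD]

theorem adjD_smul (c : ℂ) (F : 𝓢'(Phase 𝔤, ℂ)) :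
    adjD μ ν (c • F) = conj c • adjD μ ν F := by
  refine ext_pair fun k => ?_
  simp [pair_adjD]

variable {m : ℕ} {e : Fin m → 𝓢(𝔤, ℂ)}

theorem IsFrame.isInvolutiveAlgebra_co (he : IsFrame μ ν h e) (j : Fin m)
    {𝔅 : Submodule ℂ 𝓢'(Phase 𝔤 × Phase 𝔤, ℂ)}
    (h𝔅 : IsInvolutiveAlgebra (IsKernelProd (μ.prod ν)) kernelAdj
      (𝔅 : Set 𝓢'(Phase 𝔤 × Phase 𝔤, ℂ))) :
    IsInvolutiveAlgebra (IsSymbolProd μ) (adjD μ ν) (Co μ ν h 𝔅) := by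
  have hinv : ∀ {f T}, T ∈ 𝔅 ∧ IsKernel (μ.prod ν) T (frakE μ ν h f) →
      kernelAdj T ∈ 𝔅 ∧ IsKernel (μ.prod ν) (kernelAdj T) (frakE μ ν h (adjD μ ν f)) :=
    fun hT => ⟨h𝔅.inv_mem _ hT.1, he.isKernel_adjD hT.2⟩
  -- 𝔅 contains T° and the product T° ∘ T exists there, which forces Op(f)u into L². Below this is
  -- applied both to g and to f^#.
  have hop : ∀ {f T}, T ∈ 𝔅 ∧ IsKernel (μ.prod ν) T (frakE μ ν h f) → ∀ u,
      ∃ a : 𝔤 → ℂ, MemLp a 2 μ ∧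
        ∀ k : 𝓢(𝔤, ℂ), opForm μ f u k = ∫ X, a X * conj (k X) ∂μ := fun {f T} hT u => by
    obtain ⟨U, hU, -⟩ := h𝔅.exists_prod _ (h𝔅.inv_mem _ hT.1) _ hT.1
    exact he.exists_memLp_opForm j hT.2 hU u
  refine h𝔅.transport (R := fun f T => T ∈ 𝔅 ∧ IsKernel (μ.prod ν) T (frakE μ ν h f))
    (fun hT => hT.1) ⟨𝔅.zero_mem, ?_⟩ (fun {f g T S} hT hS => ⟨𝔅.add_mem hT.1 hS.1, ?_⟩)
    (fun c f T hT => ⟨𝔅.smul_mem c hT.1, ?_⟩) (fun {f g T} hf hg => ?_)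
    (fun {f g T S U} hT hS hU hmem => ?_) (fun hF hF' => he.isSymbolProd_unique j hF hF')
    hinv he.dual.adjD_adjD adjD_add adjD_smul
  · have h0 : frakE μ ν h 0 = fun _ => 0 := by
      funext p
      rw [he.frakE_eq]
      simp [opForm]
    rw [h0]
    exact IsKernel.zero
  · have h1 : frakE μ ν h (f + g) = fun p => frakE μ ν h f p + frakE μ ν h g p := by
      funext p
      rw [he.frakE_eq, he.frakE_eq, he.frakE_eq, ← Finset.sum_add_distrib]
      rfl
    rw [h1]
    exact hT.2.add hS.2
  · have h1 : frakE μ ν h (c • f) = fun p => c * frakE μ ν h f p := by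
      funext p
      rw [he.frakE_eq, he.frakE_eq, Finset.mul_sum]
      rfl
    rw [h1]
    exact hT.2.smul c
  · refine he.dual.opForm_injective (he.norm_eq j) fun u v => ?_
    rw [he.opForm_eq_of_isKernel j hf.2, he.opForm_eq_of_isKernel j hg.2]
  · obtain ⟨F, hF, hker⟩ := he.exists_isSymbolProd j hT.2 hS.2 hU (hop (hinv hT)) (hop hS)
    exact ⟨F, hF, hmem, hker⟩

end Coorbit

end NilPseudo

theorem corollary6p8 {𝔤 : Type*} [NilPseudo.RealNormedLieAlgebra 𝔤] [FiniteDimensional ℝ 𝔤]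
    [LieRing.IsNilpotent 𝔤] [MeasurableSpace 𝔤] [BorelSpace 𝔤]
    (μ : Measure 𝔤) [μ.IsAddHaarMeasure]
    (ν : Measure (𝔤 →L[ℝ] ℝ)) [ν.IsAddHaarMeasure]
    (hμν : NilPseudo.IsDualMeasure μ ν)
    (𝔅 : Submodule ℂ 𝓢'(NilPseudo.Phase 𝔤 × NilPseudo.Phase 𝔤, ℂ))
    (h𝔅 : NilPseudo.IsInvolutiveAlgebra (NilPseudo.IsKernelProd (μ.prod ν))
      NilPseudo.kernelAdj (𝔅 : Set 𝓢'(NilPseudo.Phase 𝔤 × NilPseudo.Phase 𝔤, ℂ)))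
    (h : 𝓢(NilPseudo.Phase 𝔤, ℂ)) (h_ne : h ≠ 0)
    (h_idem : h = NilPseudo.sharp μ ν h h) (h_adj : h = NilPseudo.adj μ ν h) :
    NilPseudo.IsInvolutiveAlgebra (NilPseudo.IsSymbolProd μ) (NilPseudo.adjD μ ν)
      (NilPseudo.Co μ ν h 𝔅) := by
  obtain ⟨m, e, he, ⟨j⟩⟩ := hμν.exists_isFrame h_ne h_idem h_adj
  exact he.isInvolutiveAlgebra_co j h𝔅
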